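/- Let $\Psi$ be a countably infinite set, possibly endowed with a structure of a vector space over a finite field. Let $G$ be the group of all automorphisms of $\Psi$ (all permutations, respectively all linear automorphisms) fixing pointwise a given finite subset of $\Psi$, with the topology of pointwise convergence ($\Psi$ being discrete). Let $k$ be a field of characteristic $0$. A $k[G]$-module is called smooth if the stabilizers of all its elements are open in $G$. For $T\subseteq\Psi$ let $G_T\subseteq G$ be the pointwise stabilizer of $T$; $T$ is called $G$-closed if $T=\Psi^{G_T}$. Below $T,T'$ denote finite $G$-closed subsets of $\Psi$. Set $\mathrm{Aut}(T):=N_G(G_T)/G_T$, and let $\mathrm{Aut}(T)$ act on $G/G_T$ by $[n]\cdot[g]=[gn^{-1}]$. Let $\Pi(T)$ be the set of isomorphism classes of simple $k[\mathrm{Aut}(T)]$-modules; for $\alpha\in\Pi(T)$ let $\Gamma_{T,\alpha}$ be a representative of $\alpha$. Let $V_T\subseteq\mathbb Z[G/G_T]$ be the common kernel of all morphisms of $G$-modules $\mathbb Z[G/G_T]\to\mathbb Z[G/G_{T'}]$ for all $G$-closed $T'\subsetneqq T$, and consider $V_T\otimes k$ as a submodule of $k[G/G_T]$. Set $$S_{T,\alpha}:=\mathrm{Hom}_{k[\mathrm{Aut}(T)]}(\Gamma_{T,\alpha},k[G/G_T]),\qquad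 V_{T,\alpha}:=\mathrm{Hom}_{k[\mathrm{Aut}(T)]}(\Gamma_{T,\alpha},V_T\otimes k)\subseteq S_{T,\alpha}.$$ Then the following holds. 1. The $k[G]$-module $V_{T,\alpha}$ is simple for any $T$ and any $\alpha\in\Pi(T)$, and the $k[G]$-module $V_T\otimes k$ is semisimple. Two $k[G]$-modules $V_{T,\alpha}$ and $V_{T',\alpha'}$ are isomorphic if and only if there is $g\in G$ such that $T'=g(T)$ and the isomorphism $\mathrm{Aut}(T)\to\mathrm{Aut}(T')$, $[n]\mapsto[gng^{-1}]$, transforms $\alpha$ to $\alpha'$. 2. Any simple smooth $k[G]$-module is isomorphic to $V_{T,\alpha}$ for some $T$ and some $\alpha\in\Pi(T)$. 3. Any $k[G]$-module of finite length has a smallest essential submodule and a largest semisimple submodule, and they coincide (the socle). The $k[G]$-module $k[G/G_T]$ has finite length, and its socle is $V_T\otimes k$. 4. The $k[G]$-module $S_{T,\alpha}$ is smooth, it is an injective object of the category of smooth $k[G]$-modules, and it is an essential extension of $V_{T,\alpha}$; that is, $S_{T,\alpha}$ is an injective hull of $V_{T,\alpha}$ in that category. 5. The $k[G]$-module $S_{T,\alpha}$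 is indecomposable for any $T$ and any $\alpha\in\Pi(T)$. Two $k[G]$-modules $S_{T,\alpha}$ and $S_{T',\alpha'}$ are isomorphic if and only if there is $g\in G$ such that $T'=g(T)$ and $g$ transforms $\alpha$ to $\alpha'$ (as in 1). Any indecomposable injective object of the category of smooth $k[G]$-modules is isomorphic to $S_{T,\alpha}$ for some $T$ and some $\alpha\in\Pi(T)$. 6. The simple subquotients of the $k[G]$-module $k[G/G_T]$ are, up to isomorphism, exactly the modules $V_{T',\alpha}$ for all $G$-closed subsets $T'\subseteq T$ and all $\alpha\in\Pi(T')$. -/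

import Mathlib

open scoped MonoidAlgebra TensorProduct

noncomputable section

namespace PermRep

/-! ### The groups -/

/-- `G`, a group of permutations of `Ψ`, is the group of all automorphisms of `Ψ` fixing a finite
subset `F` pointwise, where `Ψ` is either a plain set, or a vector space over a finite field
(and then the automorphisms are the linear ones). -/
inductive IsAutFixing.{v, w} {Ψ : Type v} (G : Subgroup (Equiv.Perm Ψ)) : Prop
  | set (F : Set Ψ) (hF : F.Finite) (hG : G = fixingSubgroup (Equiv.Perm Ψ) F)
  | vect (𝔽 : Type w) [Field 𝔽] [Finite 𝔽] [AddCommGroup Ψ] [Module 𝔽 Ψ] (F : Set Ψ)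
      (hF : F.Finite)
      (hG : G = (MulAction.toPermHom (Ψ ≃ₗ[𝔽] Ψ) Ψ).range ⊓ fixingSubgroup (Equiv.Perm Ψ) F)

/-- The topology of a permutation group: the topology of pointwise convergence of maps from `Ψ` to
the discrete set `Ψ`. -/
abbrev permTopology {Ψ : Type*} (G : Subgroup (Equiv.Perm Ψ)) : TopologicalSpace G :=
  TopologicalSpace.induced (fun (g : G) (x : Ψ) => g • x)
    (@Pi.topologicalSpace Ψ (fun _ => Ψ) (fun _ => ⊥))

/-- A subgroup is open if and only if it contains the pointwise stabilizer of a finite set. -/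
theorem isOpen_iff {Ψ : Type*} (G : Subgroup (Equiv.Perm Ψ)) (H : Subgroup G) :
    @IsOpen G (permTopology G) (H : Set G) ↔ ∃ S : Finset Ψ, fixingSubgroup G (S : Set Ψ) ≤ H := by
  let _ : TopologicalSpace Ψ := ⊥
  have : DiscreteTopology Ψ := ⟨rfl⟩
  let _ : TopologicalSpace G := permTopology G
  have hind : Topology.IsInducing (fun (g : G) (x : Ψ) => g • x) := ⟨rfl⟩
  constructor
  · intro h
    obtain ⟨U, hU, hUH⟩ := hind.isOpen_iff.1 h
    have h1 : (fun x : Ψ => (1 : G) • x) ∈ U := by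
      have : (1 : G) ∈ (fun (g : G) (x : Ψ) => g • x) ⁻¹' U := by rw [hUH]; exact H.one_mem
      exact this
    obtain ⟨S, u, hu, hSU⟩ := isOpen_pi_iff.1 hU _ h1
    refine ⟨S, fun g hg => ?_⟩
    have : g ∈ (fun (g : G) (x : Ψ) => g • x) ⁻¹' U := by
      apply hSU
      intro s hs
      have hgs := (mem_fixingSubgroup_iff G).1 hg s hs
      have := (hu s hs).2
      simp only [one_smul] at this
      simpa only [hgs] using this
    rw [hUH] at this
    exact this
  · rintro ⟨S, hS⟩
    have hK : IsOpen ((fixingSubgroup G (S : Set Ψ) : Subgroup G) : Set G) := by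
      refine hind.isOpen_iff.2 ⟨Set.pi (S : Set Ψ) (fun s => {s}),
        isOpen_set_pi S.finite_toSet (fun _ _ => isOpen_discrete _), ?_⟩
      ext g
      simp [mem_fixingSubgroup_iff, Set.mem_pi]
    have hmul : ∀ a : G, Continuous (fun g : G => a * g) := by
      intro a
      refine hind.continuous_iff.2 (continuous_pi fun x => ?_)
      have h1 : Continuous (fun g : G => g • x) := (continuous_apply x).comp hind.continuous
      have h2 : Continuous (fun y : Ψ => a • y) := continuous_of_discreteTopology
      have := h2.comp h1
      refine this.congr fun g => ?_
      simp [mul_smul]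
    refine isOpen_iff_mem_nhds.2 fun a ha => ?_
    have ho := hK.preimage (hmul a⁻¹)
    refine Filter.mem_of_superset (ho.mem_nhds (x := a) ?_) fun g hg => ?_
    · simp
    · have := H.mul_mem ha (hS hg)
      simpa using this

/-- A representation is smooth if the stabilizers of all vectors are open. -/
def IsSmooth {Ψ k V : Type*} {G : Subgroup (Equiv.Perm Ψ)} [Field k] [AddCommGroup V] [Module k V]
    (ρ : Representation k G V) : Prop :=
  ∀ v : V, @IsOpen G (permTopology G) {g : G | ρ g v = v}

/-- `T` is `G`-closed: it is the set of all fixed points of its pointwise stabilizer `G_T`. -/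
def IsGClosed {Ψ : Type*} (G : Subgroup (Equiv.Perm Ψ)) (T : Set Ψ) : Prop :=
  {x : Ψ | ∀ g ∈ fixingSubgroup G T, g • x = x} = T

/-! ### Generalities on representations -/

section Generalities

variable {k G V : Type*} [Field k] [Group G] [AddCommGroup V] [Module k V]

/-- A subrepresentation is essential if it meets every non-zero subrepresentation non-trivially. -/
def IsEssential {ρ : Representation k G V} (A : Subrepresentation ρ) : Prop :=
  ∀ B : Subrepresentation ρ, B ≠ ⊥ → A ⊓ B ≠ ⊥

/-- A representation is indecomposable if it is non-zero and it is not the direct sum of two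
non-zero subrepresentations. -/
def IsIndecomposable (ρ : Representation k G V) : Prop :=
  Nontrivial V ∧ ∀ A B : Subrepresentation ρ, IsCompl A B → A = ⊥ ∨ B = ⊥

/-- `A` is the socle in both senses: it is the smallest essential subrepresentation, and the
largest semisimple one. -/
def IsSocle {ρ : Representation k G V} (A : Subrepresentation ρ) : Prop :=
  IsLeast {B : Subrepresentation ρ | IsEssential B} A ∧
    IsGreatest {B : Subrepresentation ρ | B.toRepresentation.IsSemisimpleRepresentation} A

/-- The subquotient `B / A`, for subrepresentations `A ≤ B`. (In general, it is `B / (A ∩ B)`.) -/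
def subquotient {ρ : Representation k G V} (A B : Subrepresentation ρ) :
    Representation k G (B.toSubmodule ⧸ A.toSubmodule.submoduleOf B.toSubmodule) :=
  B.toRepresentation.quotient (A.toSubmodule.submoduleOf B.toSubmodule)
    (fun g x hx => A.apply_mem_toSubmodule g (v := (x : V)) hx)

end Generalities

/-- `ρ` is an injective object of the category of smooth representations of `G` over `k` (on
`k`-vector spaces in a fixed universe). -/
def IsSmoothInjective.{u, v, w} {Ψ : Type v} {k : Type u} {V : Type w}
    {G : Subgroup (Equiv.Perm Ψ)} [Field k] [AddCommGroup V] [Module k V]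
    (ρ : Representation k G V) : Prop :=
  IsSmooth ρ ∧ ∀ (M N : Type w) [AddCommGroup M] [Module k M] [AddCommGroup N] [Module k N]
    (σ : Representation k G M) (τ : Representation k G N), IsSmooth σ → IsSmooth τ →
    ∀ (i : σ.IntertwiningMap τ) (f : σ.IntertwiningMap ρ), Function.Injective i →
      ∃ h : τ.IntertwiningMap ρ, h.comp i = f

/-- `ρ` is an injective hull, in the category of smooth representations, of its
subrepresentation `A`: it is injective, and `A` is essential in it. -/
def IsSmoothInjectiveHull {Ψ k V : Type*} {G : Subgroup (Equiv.Perm Ψ)} [Field k] [AddCommGroup V]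
    [Module k V] {ρ : Representation k G V} (A : Subrepresentation ρ) : Prop :=
  IsSmoothInjective ρ ∧ IsEssential A

/-! ### The groups `Aut(T)` and their action on `G/G_T` -/

section Weyl

variable {G : Type*} [Group G]

/-- The group `N_G(H)/H`. -/
abbrev Weyl (H : Subgroup G) : Type _ :=
  ↥(Subgroup.normalizer (H : Set G)) ⧸ H.subgroupOf (Subgroup.normalizer (H : Set G))

/-- The action of `N_G(H)/H` on `G/H` by translations on the right: `[n] • [g] = [g n⁻¹]`. It
commutes with the action of `G` by translations on the left. -/
instance weylAction (H : Subgroup G) : MulAction (Weyl H) (G ⧸ H) where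
  smul := Quotient.map₂ (fun n g => g * (n : G)⁻¹) (by
    intro n n' hn g g' hg
    have hn1 : (n : G)⁻¹ * (n' : G) ∈ H :=
      (QuotientGroup.leftRel_apply (s := H.subgroupOf (Subgroup.normalizer (H : Set G)))).1 hn
    have hg1 : g⁻¹ * g' ∈ H := QuotientGroup.leftRel_apply.1 hg
    refine QuotientGroup.leftRel_apply.2 ?_
    have h1 := H.mul_mem hg1 (H.inv_mem hn1)
    have h2 := (Subgroup.mem_normalizer_iff.1 n.2 _).1 h1
    convert h2 using 1
    group)
  one_smul := by
    rintro ⟨g⟩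
    change QuotientGroup.mk (g * ((1 : Subgroup.normalizer (H : Set G)) : G)⁻¹) = QuotientGroup.mk g
    simp
  mul_smul := by
    rintro ⟨m⟩ ⟨n⟩ ⟨g⟩
    change QuotientGroup.mk (g * ((m * n : Subgroup.normalizer (H : Set G)) : G)⁻¹)
      = QuotientGroup.mk (g * (n : G)⁻¹ * (m : G)⁻¹)
    simp [mul_assoc]

theorem weyl_smul_mk (H : Subgroup G) (n : Subgroup.normalizer (H : Set G)) (g : G) :
    (QuotientGroup.mk n : Weyl H) • (QuotientGroup.mk g : G ⧸ H) =
      QuotientGroup.mk (g * (n : G)⁻¹) := rfl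

instance weyl_smulCommClass (H : Subgroup G) : SMulCommClass G (Weyl H) (G ⧸ H) where
  smul_comm := by
    rintro g ⟨n⟩ ⟨x⟩
    change QuotientGroup.mk (g * (x * (n : G)⁻¹)) = QuotientGroup.mk (g * x * (n : G)⁻¹)
    rw [mul_assoc]

/-- The representation of `G` on `R[G/H]`. -/
abbrev permRep (R : Type*) [CommRing R] (H : Subgroup G) : Representation R G R[G ⧸ H] :=
  Representation.ofMulAction R G (G ⧸ H)

/-- The representation of `N_G(H)/H` on `R[G/H]`. -/
abbrev weylRep (R : Type*) [CommRing R] (H : Subgroup G) : Representation R (Weyl H) R[G ⧸ H] :=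
  Representation.ofMulAction R (Weyl H) (G ⧸ H)

theorem permRep_weylRep_comm (R : Type*) [CommRing R] (H : Subgroup G) (g : G) (a : Weyl H)
    (x : R[G ⧸ H]) : permRep R H g (weylRep R H a x) = weylRep R H a (permRep R H g x) := by
  induction x using MonoidAlgebra.induction_linear with
  | zero => simp
  | add x y hx hy => simp [hx, hy]
  | single b r => simp [smul_comm]

end Weyl

/-! ### The modules `V_T`, `V_T ⊗ k`, `S_{T,α}` and `V_{T,α}` -/

section Modules

variable {Ψ : Type*} (G : Subgroup (Equiv.Perm Ψ))

/-- The group `Aut(T) = N_G(G_T)/G_T`. -/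
abbrev AutT (T : Set Ψ) : Type _ := Weyl (fixingSubgroup G T)

/-- The `G`-set `G/G_T`. -/
abbrev Orb (T : Set Ψ) : Type _ := G ⧸ fixingSubgroup G T

/-- `V_T`: the common kernel of all morphisms of `G`-modules `ℤ[G/G_T] → ℤ[G/G_{T'}]` for all
proper `G`-closed subsets `T'` of `T`. -/
def VT (T : Set Ψ) : Subrepresentation (permRep ℤ (fixingSubgroup G T)) where
  toSubmodule :=
    { carrier := {x | ∀ T' : Set Ψ, IsGClosed G T' → T' ⊂ T →
        ∀ π : (permRep ℤ (fixingSubgroup G T)).IntertwiningMap (permRep ℤ (fixingSubgroup G T')),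
          π x = 0}
      add_mem' := fun hx hy T' h h' π => by rw [map_add, hx T' h h' π, hy T' h h' π, add_zero]
      zero_mem' := fun T' _ _ π => map_zero π
      smul_mem' := fun c x hx T' h h' π => by rw [map_zsmul, hx T' h h' π, smul_zero] }
  apply_mem_toSubmodule := fun g x hx T' h h' π => by
    rw [Representation.IntertwiningMap.isIntertwining, hx T' h h' π, map_zero]

variable (k : Type*) [Field k]

/-- The canonical `ℤ`-linear map `ℤ[X] → k[X]`. -/
def intMap (X : Type*) : ℤ[X] →ₗ[ℤ] k[X] :=
  (MonoidAlgebra.coeffLinearEquiv ℤ).symm.toLinearMap ∘ₗ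
    Finsupp.mapRange.linearMap (Algebra.linearMap ℤ k) ∘ₗ
      (MonoidAlgebra.coeffLinearEquiv ℤ).toLinearMap

@[simp]
theorem intMap_single (X : Type*) (x : X) (n : ℤ) :
    intMap k X (MonoidAlgebra.single x n) = MonoidAlgebra.single x (n : k) := by
  ext y
  simp [intMap]

/-- The canonical `k`-linear map `k ⊗ V_T → k[G/G_T]`. -/
def VTkMap (T : Set Ψ) : k ⊗[ℤ] (VT G T).toSubmodule →ₗ[k] k[Orb G T] :=
  LinearMap.liftBaseChange k (intMap k (Orb G T) ∘ₗ (VT G T).toSubmodule.subtype)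

/-- The canonical map `k ⊗ V_T → k[G/G_T]` is injective, so that its image is `V_T ⊗ k`. -/
theorem VTkMap_injective [CharZero k] (T : Set Ψ) : Function.Injective (VTkMap G k T) := by
  classical
  have h1 : Function.Injective ((VT G T).toSubmodule.subtype.lTensor k) :=
    Module.Flat.lTensor_preserves_injective_linearMap _ (Submodule.subtype_injective _)
  let e : k ⊗[ℤ] ℤ[Orb G T] ≃ₗ[ℤ] k[Orb G T] :=
    (LinearEquiv.lTensor k (MonoidAlgebra.coeffLinearEquiv ℤ)).trans
      ((TensorProduct.finsuppScalarRight ℤ ℤ k (Orb G T)).trans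
        (MonoidAlgebra.coeffLinearEquiv ℤ).symm)
  have h2 : ∀ z, VTkMap G k T z = e ((VT G T).toSubmodule.subtype.lTensor k z) := by
    intro z
    induction z using TensorProduct.induction_on with
    | zero => simp
    | add x y hx hy => simp only [map_add, hx, hy]
    | tmul c x =>
      ext y
      have he : (e (c ⊗ₜ[ℤ] (x : ℤ[Orb G T]))).coeff y = (x : ℤ[Orb G T]).coeff y • c :=
        TensorProduct.finsuppScalarRight_apply_tmul_apply c
          (x : ℤ[Orb G T]).coeff y
      simp [VTkMap, intMap, he, mul_comm]
  intro z w hzw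
  rw [h2, h2] at hzw
  exact h1 (e.injective hzw)

/-- `V_T ⊗ k`, as a subrepresentation of `k[G/G_T]`. -/
def VTk (T : Set Ψ) : Subrepresentation (permRep k (fixingSubgroup G T)) where
  toSubmodule := LinearMap.range (VTkMap G k T)
  apply_mem_toSubmodule := by
    rintro g _ ⟨z, rfl⟩
    have key : ∀ x : ℤ[Orb G T], permRep k (fixingSubgroup G T) g (intMap k (Orb G T) x) =
        intMap k (Orb G T) (permRep ℤ (fixingSubgroup G T) g x) := by
      intro x
      induction x using MonoidAlgebra.induction_linear with
      | zero => simp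
      | add x y hx hy => simp [hx, hy]
      | single b r => simp
    induction z using TensorProduct.induction_on with
    | zero => simp
    | add x y hx hy => simpa using Submodule.add_mem _ hx hy
    | tmul c x =>
      refine ⟨c ⊗ₜ ⟨permRep ℤ (fixingSubgroup G T) g x, (VT G T).apply_mem_toSubmodule g x.2⟩, ?_⟩
      simp [VTkMap, key]

/-- `V_T ⊗ k` is also stable under `Aut(T)`. -/
theorem VTk_weyl_stable (T : Set Ψ) (a : AutT G T) {x : k[Orb G T]} (hx : x ∈ VTk G k T) :
    weylRep k (fixingSubgroup G T) a x ∈ VTk G k T := by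
  obtain ⟨z, rfl⟩ := hx
  have key : ∀ x : ℤ[Orb G T], weylRep k (fixingSubgroup G T) a (intMap k (Orb G T) x) =
      intMap k (Orb G T) (weylRep ℤ (fixingSubgroup G T) a x) := by
    intro x
    induction x using MonoidAlgebra.induction_linear with
    | zero => simp
    | add x y hx hy => simp [hx, hy]
    | single b r => simp
  have hV : ∀ x ∈ (VT G T).toSubmodule,
      weylRep ℤ (fixingSubgroup G T) a x ∈ (VT G T).toSubmodule := by
    intro x hx T' h h' π
    let r : (permRep ℤ (fixingSubgroup G T)).IntertwiningMap (permRep ℤ (fixingSubgroup G T)) :=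
      ⟨weylRep ℤ (fixingSubgroup G T) a, fun g => by
        refine LinearMap.ext fun y => ?_
        exact (permRep_weylRep_comm ℤ (fixingSubgroup G T) g a y).symm⟩
    exact hx T' h h' (π.comp r)
  induction z using TensorProduct.induction_on with
  | zero =>
    rw [map_zero, map_zero]
    exact Submodule.zero_mem (VTk G k T).toSubmodule
  | add x y hx hy =>
    rw [map_add, map_add]
    exact Submodule.add_mem (VTk G k T).toSubmodule hx hy
  | tmul c x =>
    refine ⟨c ⊗ₜ ⟨weylRep ℤ (fixingSubgroup G T) a x, hV x x.2⟩, ?_⟩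
    simp [VTkMap, key]

variable {k} {Γ : Type*} [AddCommGroup Γ] [Module k Γ]

/-- `S_{T,α} = Hom_{k[Aut(T)]}(Γ, k[G/G_T])`, where `γ` is the action of `Aut(T)` on a
representative `Γ` of `α`, with the action of `G` through its action on `k[G/G_T]`. -/
def S {T : Set Ψ} (γ : Representation k (AutT G T) Γ) :
    Representation k G (γ.IntertwiningMap (weylRep k (fixingSubgroup G T))) where
  toFun g :=
    { toFun := fun f =>
        { toLinearMap := permRep k (fixingSubgroup G T) g ∘ₗ f.toLinearMap
          isIntertwining' := fun a => by
            ext1 x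
            simp only [LinearMap.comp_apply, Representation.IntertwiningMap.toLinearMap_apply,
              Representation.IntertwiningMap.isIntertwining, permRep_weylRep_comm] }
      map_add' := fun f f' => by
        ext x : 2
        exact map_add (permRep k (fixingSubgroup G T) g) (f x) (f' x)
      map_smul' := fun c f => by
        ext x : 2
        exact map_smul (permRep k (fixingSubgroup G T) g) c (f x) }
  map_one' := by
    ext f x : 3
    exact congrArg (fun φ => φ (f x)) (map_one (permRep k (fixingSubgroup G T)))
  map_mul' g h := by
    ext f x : 3
    exact congrArg (fun φ => φ (f x)) (map_mul (permRep k (fixingSubgroup G T)) g h)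

theorem S_apply {T : Set Ψ} (γ : Representation k (AutT G T) Γ) (g : G)
    (f : γ.IntertwiningMap (weylRep k (fixingSubgroup G T))) (x : Γ) :
    S G γ g f x = permRep k (fixingSubgroup G T) g (f x) := rfl

/-- `V_{T,α} = Hom_{k[Aut(T)]}(Γ, V_T ⊗ k)`, as a subrepresentation of `S_{T,α}`. -/
def V {T : Set Ψ} (γ : Representation k (AutT G T) Γ) : Subrepresentation (S G γ) where
  toSubmodule :=
    { carrier := {f | ∀ x, f x ∈ VTk G k T}
      add_mem' := fun hf hf' x => Submodule.add_mem (VTk G k T).toSubmodule (hf x) (hf' x)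
      zero_mem' := fun _ => Submodule.zero_mem (VTk G k T).toSubmodule
      smul_mem' := fun c _ hf x => Submodule.smul_mem (VTk G k T).toSubmodule c (hf x) }
  apply_mem_toSubmodule := fun g _ hf x => (VTk G k T).apply_mem_toSubmodule g (hf x)

/-- The representation of `G` on `V_{T,α}`. -/
abbrev VRep {T : Set Ψ} (γ : Representation k (AutT G T) Γ) :
    Representation k G (V G γ).toSubmodule :=
  (V G γ).toRepresentation

variable {Γ' : Type*} [AddCommGroup Γ'] [Module k Γ']

/-- Conjugation by `g` maps the normalizer of `G_T` onto the normalizer of `G_{g(T)}`. -/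
theorem conj_mem_normalizer {T : Set Ψ} (g n : G) :
    g * n * g⁻¹ ∈ Subgroup.normalizer
        (fixingSubgroup G ((fun x => g • x) '' T) : Set G) ↔
      n ∈ Subgroup.normalizer (fixingSubgroup G T : Set G) := by
  have h : (fixingSubgroup G T).map (MulAut.conj g).toMonoidHom =
      fixingSubgroup G ((fun x => g • x) '' T) := by
    open Pointwise in exact SubMulAction.fixingSubgroup_map_conj_eq (rfl : g • T = _)
  rw [← h]
  have h2 := Subgroup.map_equiv_normalizer_eq (fixingSubgroup G T) (MulAut.conj g)
  constructor
  · intro hn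
    rw [← h2] at hn
    obtain ⟨m, hm, hmn⟩ := hn
    have : m = n := (MulAut.conj g).injective hmn
    exact this ▸ hm
  · intro hn
    rw [← h2]
    exact ⟨n, hn, rfl⟩

/-- `(T, α)` and `(T', α')` are conjugate under `G`: there is `g` in `G` with `T' = g(T)` such that
the isomorphism `Aut(T) → Aut(T')`, `[n] ↦ [g n g⁻¹]`, transforms `α` to `α'`. -/
def AreConj {T T' : Set Ψ} (γ : Representation k (AutT G T) Γ)
    (γ' : Representation k (AutT G T') Γ') : Prop :=
  ∃ g : G, T' = (fun x => g • x) '' T ∧ ∃ e : Γ ≃ₗ[k] Γ',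
    ∀ (n : Subgroup.normalizer (fixingSubgroup G T : Set G))
      (n' : Subgroup.normalizer (fixingSubgroup G T' : Set G)),
      (n' : G) = g * n * g⁻¹ → ∀ x : Γ, e (γ (n : AutT G T) x) = γ' (n' : AutT G T') (e x)

end Modules

end PermRep

end

universe u v w x

/-! An element of `G/G_T` is an embedding of `T` into `Ψ` induced by `G`, and `k[G/G_T]` consists of
finite combinations of such embeddings. All that is used about `G` is the list of combinatorial
facts in `IsGood`, checked separately for symmetric groups (by transpositions) and for linear groups
(by transvections). Orbits of `G_T` outside `T` are infinite, so every morphism `ℤ[G/G_T] →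
ℤ[G/G_{T'}]` is a sum of restrictions to subsets of `T` followed by translations. Hence `V_T ⊗ k` is
the set of combinations all of whose restrictions to smaller closed sets vanish (`mem_VTk_iff`).

The engine is an element `P` of the group algebra attached to finite closed sets `T ⊆ W`
(`exists_key_operator`, packaged as `IsKey`). It kills every vector fixed by some `G_S` with `S ⊆ W`
closed and `T ⊄ S`, and it moves the points of `W` trivially or out of `W`. It is a product of
differences of averages over finite groups, one factor for each step of a chain of closed sets
reaching `T`. If `e` is the image under `P` of the base point of `k[G/G_T]`, then `e` lies in `V_T ⊗
k`, and `P x` is the combination of the `Aut(T)`-translates of `e` whose coefficients are those of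
`x` at the embeddings of `T` onto itself (`IsKey.apply_eq_sum`). So some translate of any nonzero
`x` is sent to a nonzero element of `V_T ⊗ k`, which is therefore essential. Conversely, an element
of `V_T ⊗ k` supported on embeddings into `W` is a combination of translates of `e`
(`exists_expansion`), because an element of `V_T ⊗ k` with enough symmetry that vanishes on the
embeddings into `W` is zero (`eq_zero_of_mem_VTk`).

Applied to `Hom` from an irreducible `Γ`, this shows that every nonzero subrepresentation of
`S_{T,α}` contains `V_{T,α}` (`V_le`). Simplicity, essentiality and indecomposability follow at
once. By Maschke's theorem for the finite group `Aut(T)`, `V_T ⊗ k` is a sum of images of the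
`V_{T,α}`, hence semisimple. The quotient of `k[G/G_T]` by it embeds into the product of the
`k[G/G_{T'}]` for smaller `T'`, so induction on the size of `T` gives finite length and the list of
simple subquotients (`exists_equiv_VRep`). A simple smooth module is a quotient of some `k[G/G_T]`.

For injectivity, a morphism from a smooth module to `k[G/G_T]` is a functional vanishing on an
explicit subspace, and the key operators show that the functional to be extended vanishes where it
must (`exists_extension_permRep`). Finally, an isomorphism of the `V`'s extends to an embedding of
the `S`'s. Comparing vectors fixed by `G_T` recovers `T` and `α` up to conjugation
(`areConj_of_injective`). -/

noncomputable section

namespace PermRep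

/-! ### Subrepresentations, socles, and irreducible representations of finite groups. -/

section Generic

variable {k G V W : Type*} [Field k] [Group G] [AddCommGroup V] [Module k V]
  [AddCommGroup W] [Module k W] {ρ : Representation k G V} {σ : Representation k G W}

theorem asAlgebraHom_apply_eq_sum (ρ : Representation k G V) (P : k[G]) (v : V) :
    ρ.asAlgebraHom P v = P.coeff.sum fun g c => c • ρ g v := by
  induction P using MonoidAlgebra.induction_linear with
  | zero => simp
  | add x y hx hy =>
    rw [map_add, LinearMap.add_apply, hx, hy, MonoidAlgebra.coeff_add, Finsupp.sum_add_index']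
    · simp
    · intros; rw [add_smul]
  | single g c => simp

theorem asAlgebraHom_intertwining (f : ρ.IntertwiningMap σ) (P : k[G]) (v : V) :
    f (ρ.asAlgebraHom P v) = σ.asAlgebraHom P (f v) := by
  rw [asAlgebraHom_apply_eq_sum, asAlgebraHom_apply_eq_sum, Finsupp.sum, Finsupp.sum, map_sum]
  simp [f.isIntertwining]

theorem asAlgebraHom_mem (B : Subrepresentation ρ) (P : k[G]) {v : V} (hv : v ∈ B) :
    ρ.asAlgebraHom P v ∈ B :=
  ρ.asAlgebraHom_mem_of_forall_mem B.toSubmodule (fun g _ hv => B.apply_mem_toSubmodule g hv) v hv P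

theorem asAlgebraHom_mul_apply (ρ : Representation k G V) (P Q : k[G]) (v : V) :
    ρ.asAlgebraHom (P * Q) v = ρ.asAlgebraHom P (ρ.asAlgebraHom Q v) := by
  rw [map_mul, Module.End.mul_apply]

/-- The image of a subrepresentation. -/
def subMap (f : ρ.IntertwiningMap σ) (B : Subrepresentation ρ) : Subrepresentation σ where
  toSubmodule := B.toSubmodule.map f.toLinearMap
  apply_mem_toSubmodule g := by
    rintro _ ⟨v, hv, rfl⟩
    exact ⟨ρ g v, B.apply_mem_toSubmodule g hv, f.isIntertwining _ _ g v⟩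

/-- The preimage of a subrepresentation. -/
def subComap (f : ρ.IntertwiningMap σ) (B : Subrepresentation σ) : Subrepresentation ρ where
  toSubmodule := B.toSubmodule.comap f.toLinearMap
  apply_mem_toSubmodule g v hv := by
    change f (ρ g v) ∈ B
    rw [f.isIntertwining]
    exact B.apply_mem_toSubmodule g hv

theorem mem_subMap {f : ρ.IntertwiningMap σ} {B : Subrepresentation ρ} {w : W} :
    w ∈ subMap f B ↔ ∃ v ∈ B, f v = w := Iff.rfl

theorem mem_subComap {f : ρ.IntertwiningMap σ} {B : Subrepresentation σ} {v : V} :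
    v ∈ subComap f B ↔ f v ∈ B := Iff.rfl

theorem subrep_eq_bot_iff {B : Subrepresentation ρ} : B = ⊥ ↔ ∀ v ∈ B, v = 0 := by
  constructor
  · rintro rfl v hv
    exact hv
  · intro h
    refine le_antisymm (fun v hv => h v hv) bot_le

theorem subrep_ne_bot_iff {B : Subrepresentation ρ} : B ≠ ⊥ ↔ ∃ v ∈ B, v ≠ 0 := by
  rw [Ne, subrep_eq_bot_iff]
  push Not
  rfl

theorem subrep_mem_top (v : V) : v ∈ (⊤ : Subrepresentation ρ) := Submodule.mem_top (R := k)

theorem subrep_mem_bot {v : V} : v ∈ (⊥ : Subrepresentation ρ) ↔ v = 0 := Submodule.mem_bot k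

/-- The inclusion of a subrepresentation. -/
def incl (B : Subrepresentation ρ) : B.toRepresentation.IntertwiningMap ρ where
  toLinearMap := B.toSubmodule.subtype
  isIntertwining' _ := rfl

@[simp] theorem incl_apply (B : Subrepresentation ρ) (v : B.toSubmodule) : incl B v = v := rfl

theorem incl_injective (B : Subrepresentation ρ) : Function.Injective (incl B) :=
  Subtype.val_injective

/-- Codomain restriction of an intertwining map. -/
def codRestrict (B : Subrepresentation σ) (f : ρ.IntertwiningMap σ) (h : ∀ v, f v ∈ B) :
    ρ.IntertwiningMap B.toRepresentation where
  toLinearMap := f.toLinearMap.codRestrict B.toSubmodule h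
  isIntertwining' g := by
    ext v
    exact f.isIntertwining _ _ g v

@[simp] theorem codRestrict_apply (B : Subrepresentation σ) (f : ρ.IntertwiningMap σ)
    (h : ∀ v, f v ∈ B) (v : V) : (codRestrict B f h v : W) = f v := rfl

/-- The module attached to a subrepresentation is the corresponding submodule. -/
def toRepAsModuleEquiv (B : Subrepresentation ρ) :
    B.toRepresentation.asModule ≃ₗ[k[G]] B.asSubmodule :=
  LinearEquiv.ofBijective
    ((Representation.IntertwiningMap.equivLinearMapAsModule B.toRepresentation ρ (incl B)).codRestrict
      B.asSubmodule (fun v => (v : B.toSubmodule).2))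
    ⟨fun _ _ h => Subtype.ext (congrArg (fun z : B.asSubmodule => (z : ρ.asModule)) h),
      fun v => ⟨⟨v.1, v.2⟩, rfl⟩⟩

theorem isIrreducible_iff_isAtom (B : Subrepresentation ρ) :
    B.toRepresentation.IsIrreducible ↔ IsAtom B := by
  rw [Representation.irreducible_iff_isSimpleModule_asModule,
    (toRepAsModuleEquiv B).isSimpleModule_iff, isSimpleModule_iff_isAtom]
  exact Subrepresentation.subrepresentationSubmoduleOrderIso.isAtom_iff B

theorem isSemisimple_iff_asSubmodule (B : Subrepresentation ρ) :
    B.toRepresentation.IsSemisimpleRepresentation ↔ IsSemisimpleModule k[G] B.asSubmodule := by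
  rw [Representation.isSemisimpleRepresentation_iff_isSemisimpleModule_asModule,
    (toRepAsModuleEquiv B).isSemisimpleModule_iff]

theorem exists_complement_of_semisimple {B : Subrepresentation ρ}
    (hB : B.toRepresentation.IsSemisimpleRepresentation) (A : Subrepresentation ρ) :
    ∃ C ≤ B, A ⊓ C = ⊥ ∧ B ≤ A ⊔ C := by
  obtain ⟨D, hD⟩ := hB.exists_isCompl (subComap (incl B) A)
  refine ⟨subMap (incl B) D, ?_, ?_, ?_⟩
  · rintro _ ⟨v, -, rfl⟩
    exact v.2
  · rw [subrep_eq_bot_iff]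
    rintro _ ⟨hv, v, hvD, rfl⟩
    have : v ∈ subComap (incl B) A ⊓ D := ⟨hv, hvD⟩
    rw [hD.inf_eq_bot] at this
    rw [subrep_mem_bot.1 this, map_zero]
  · intro v hv
    have : (⟨v, hv⟩ : B.toSubmodule) ∈ subComap (incl B) A ⊔ D := by
      rw [hD.sup_eq_top]
      exact subrep_mem_top _
    obtain ⟨a, ha, d, hd, had⟩ := Submodule.mem_sup.1 this
    refine Submodule.mem_sup.2 ⟨a, ha, d, ⟨d, hd, rfl⟩, congrArg Subtype.val had⟩

/-- A complement of `A ⊓ B` inside the semisimple `B` meets `A` trivially, so it must vanish. Both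
halves of the socle characterization are instances of this. -/
theorem le_of_semisimple_of_essential {A B : Subrepresentation ρ}
    (hB : B.toRepresentation.IsSemisimpleRepresentation)
    (h : ∀ C ≤ B, A ⊓ C = ⊥ → C = ⊥) : B ≤ A := by
  obtain ⟨C, hC, hAC, hBC⟩ := exists_complement_of_semisimple hB (A ⊓ B)
  have : C = ⊥ := h C hC (by
    rw [← hAC, inf_assoc, inf_eq_right.2 hC])
  rw [this, sup_bot_eq] at hBC
  exact hBC.trans inf_le_left

theorem isSocle_of_essential_of_semisimple {A : Subrepresentation ρ} (h : IsEssential A)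
    (hs : A.toRepresentation.IsSemisimpleRepresentation) : IsSocle A := by
  refine ⟨⟨h, fun B hB => le_of_semisimple_of_essential hs fun C _ hC => ?_⟩,
    ⟨hs, fun B hB => le_of_semisimple_of_essential hB fun C _ hC => ?_⟩⟩
  · by_contra h'
    exact hB C h' hC
  · by_contra h'
    exact h C h' hC

theorem exists_atom_le (hρ : IsFiniteLength k[G] ρ.asModule) {B : Subrepresentation ρ}
    (hB : B ≠ ⊥) : ∃ A ≤ B, IsAtom A := by
  obtain ⟨-, h⟩ := isFiniteLength_iff_isNoetherian_isArtinian.1 hρ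
  let e := Subrepresentation.subrepresentationSubmoduleOrderIso (ρ := ρ)
  obtain h' | ⟨A, hA, hAB⟩ := (IsAtomic.eq_bot_or_exists_atom_le (e B))
  · exact absurd ((map_eq_bot_iff e).1 h') hB
  · refine ⟨e.symm A, ?_, ?_⟩
    · rw [← e.le_iff_le, e.apply_symm_apply]; exact hAB
    · exact (e.symm.isAtom_iff A).2 hA

/-- The socle is the sum of all simple submodules. It is essential because finite length puts a
simple submodule inside every nonzero one. -/
theorem exists_isSocle (hρ : IsFiniteLength k[G] ρ.asModule) :
    ∃ A : Subrepresentation ρ, IsSocle A := by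
  let e := Subrepresentation.subrepresentationSubmoduleOrderIso (ρ := ρ)
  let N : Submodule k[G] ρ.asModule := ⨆ m ∈ {m : Submodule k[G] ρ.asModule | IsAtom m}, m
  have hN : IsSemisimpleModule k[G] N := by
    refine isSemisimpleModule_biSup_of_isSemisimpleModule_submodule
      (p := fun m : Submodule k[G] ρ.asModule => m) fun m hm => ?_
    have := isSimpleModule_iff_isAtom.2 hm
    infer_instance
  refine ⟨e.symm N, isSocle_of_essential_of_semisimple ?_ ?_⟩
  · intro B hB h
    obtain ⟨A, hAB, hA⟩ := exists_atom_le hρ hB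
    have : A ≤ e.symm N := by
      rw [← e.le_iff_le, e.apply_symm_apply]
      exact le_biSup (fun m : Submodule k[G] ρ.asModule => m) ((e.isAtom_iff A).2 hA)
    exact hA.1 (le_bot_iff.1 (h ▸ le_inf this hAB))
  · rw [isSemisimple_iff_asSubmodule]
    exact hN

theorem equiv_asModule (e : ρ.Equiv σ) : Nonempty (ρ.asModule ≃ₗ[k[G]] σ.asModule) :=
  ⟨LinearEquiv.ofBijective
    (Representation.IntertwiningMap.equivLinearMapAsModule ρ σ e.toIntertwiningMap)
    (EquivLike.bijective e)⟩

theorem isIrreducible_congr (e : ρ.Equiv σ) (h : ρ.IsIrreducible) : σ.IsIrreducible := by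
  rw [Representation.irreducible_iff_isSimpleModule_asModule] at h ⊢
  obtain ⟨e'⟩ := equiv_asModule e
  exact e'.isSimpleModule_iff.1 h

theorem nontrivial_of_isIrreducible (h : ρ.IsIrreducible) : Nontrivial V := by
  rw [Representation.irreducible_iff_isSimpleModule_asModule] at h
  exact IsSimpleModule.nontrivial k[G] ρ.asModule

theorem exists_ne_zero_of_isIrreducible (h : ρ.IsIrreducible) : ∃ v : V, v ≠ 0 :=
  haveI := nontrivial_of_isIrreducible h
  exists_ne 0

theorem eq_bot_or_eq_top_of_isIrreducible (h : ρ.IsIrreducible) (B : Subrepresentation ρ) :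
    B = ⊥ ∨ B = ⊤ := IsSimpleOrder.eq_bot_or_eq_top B

/-- A finite-dimensional representation can be realized on coordinate vectors. -/
theorem exists_coordinate_representation [FiniteDimensional k V] (ρ : Representation k G V) :
    ∃ (n : ℕ) (τ : Representation k G (Fin n → k)), Nonempty (ρ.Equiv τ) := by
  let e : V ≃ₗ[k] (Fin (Module.finrank k V) → k) := (Module.finBasis k V).equivFun
  refine ⟨_, (e.conjAlgEquiv k : Module.End k V →* _).comp ρ, ⟨Representation.Equiv.mk e ?_⟩⟩
  intro g
  ext v : 1
  simp [LinearEquiv.conjAlgEquiv]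

theorem finiteDimensional_of_isIrreducible [Finite G] (h : ρ.IsIrreducible) :
    FiniteDimensional k V := by
  obtain ⟨x, hx⟩ := exists_ne_zero_of_isIrreducible h
  let B : Subrepresentation ρ :=
    { toSubmodule := Submodule.span k (Set.range fun g => ρ g x)
      apply_mem_toSubmodule := by
        intro g v hv
        have : (Submodule.span k (Set.range fun g => ρ g x)).map (ρ g) ≤
            Submodule.span k (Set.range fun g => ρ g x) := by
          rw [Submodule.map_span, Submodule.span_le]
          rintro _ ⟨_, ⟨a, rfl⟩, rfl⟩
          exact Submodule.subset_span ⟨g * a, by simp⟩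
        exact this ⟨v, hv, rfl⟩ }
  have hB : B = ⊤ := by
    refine (eq_bot_or_eq_top_of_isIrreducible h B).resolve_left ?_
    refine subrep_ne_bot_iff.2 ⟨x, Submodule.subset_span ⟨1, by simp⟩, hx⟩
  have : (⊤ : Submodule k V) = Submodule.span k (Set.range fun g => ρ g x) :=
    (congrArg Subrepresentation.toSubmodule hB).symm
  exact ⟨this ▸ Submodule.fg_span (Set.finite_range _)⟩

/-- A non-zero functional on an irreducible finite-dimensional representation generates the dual. -/
theorem span_functional_eq_top [FiniteDimensional k V] (h : ρ.IsIrreducible)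
    {l : Module.Dual k V} (hl : l ≠ 0) :
    Submodule.span k (Set.range fun g : G => l ∘ₗ ρ g) = ⊤ := by
  -- The common kernel of the translates of `l` is a subrepresentation, and it is proper since `l ≠
  -- 0`. So it vanishes, and the double annihilator of the span is the whole dual.
  set M := Submodule.span k (Set.range fun g : G => l ∘ₗ ρ g)
  let B : Subrepresentation ρ :=
    { toSubmodule := M.dualCoannihilator
      apply_mem_toSubmodule := by
        intro a v hv
        rw [Submodule.mem_dualCoannihilator] at hv ⊢
        intro φ hφ
        have : M.map (Module.Dual.transpose (R := k) (ρ a)) ≤ M := by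
          rw [Submodule.map_span, Submodule.span_le]
          rintro _ ⟨_, ⟨g, rfl⟩, rfl⟩
          refine Submodule.subset_span ⟨g * a, ?_⟩
          ext v
          simp [Module.Dual.transpose_apply]
        exact hv _ (this ⟨φ, hφ, rfl⟩) }
  have hB : B = ⊥ := by
    refine (eq_bot_or_eq_top_of_isIrreducible h B).resolve_right fun hB => hl ?_
    ext v
    have : v ∈ B := hB ▸ subrep_mem_top v
    exact (Submodule.mem_dualCoannihilator _).1 this l
      (Submodule.subset_span ⟨1, by ext; simp⟩)
  have hM : M.dualCoannihilator = ⊥ := congrArg Subrepresentation.toSubmodule hB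
  rw [← Subspace.dualCoannihilator_dualAnnihilator_eq (W := M), hM, Submodule.dualAnnihilator_bot]

end Generic


/-! ### Closed sets, embeddings, and the combinatorial axioms `IsGood`. -/

section Geometry

variable {Ψ : Type*} (G : Subgroup (Equiv.Perm Ψ))

/-- The set of all fixed points of the pointwise stabilizer of `S`. -/
def cl (S : Set Ψ) : Set Ψ := {x : Ψ | ∀ g ∈ fixingSubgroup G S, g • x = x}

variable {G}

theorem mem_fix {S : Set Ψ} {g : G} : g ∈ fixingSubgroup G S ↔ ∀ x ∈ S, g • x = x :=
  mem_fixingSubgroup_iff G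

theorem IsGClosed.cl_eq {T : Set Ψ} (h : IsGClosed G T) : cl G T = T := h

theorem subset_cl (S : Set Ψ) : S ⊆ cl G S := fun x hx _ hg => mem_fix.1 hg x hx

theorem fixing_mono {S S' : Set Ψ} (h : S ⊆ S') : fixingSubgroup G S' ≤ fixingSubgroup G S :=
  fun _ hg => mem_fix.2 fun x hx => mem_fix.1 hg x (h hx)

theorem cl_mono {S S' : Set Ψ} (h : S ⊆ S') : cl G S ⊆ cl G S' :=
  fun _ hx g hg => hx g (fixing_mono h hg)

theorem fixing_cl (S : Set Ψ) : fixingSubgroup G (cl G S) = fixingSubgroup G S :=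
  le_antisymm (fixing_mono (subset_cl S)) fun g hg => mem_fix.2 fun _ hx => hx g hg

theorem isGClosed_cl (S : Set Ψ) : IsGClosed G (cl G S) := by
  ext x
  change (∀ g ∈ fixingSubgroup G (cl G S), _) ↔ _
  rw [fixing_cl]
  rfl

theorem cl_subset {S T : Set Ψ} (hT : IsGClosed G T) (h : S ⊆ T) : cl G S ⊆ T :=
  (cl_mono h).trans hT.cl_eq.le

theorem isGClosed_of_cl_subset {T : Set Ψ} (h : cl G T ⊆ T) : IsGClosed G T :=
  le_antisymm h (subset_cl T)

theorem IsGClosed.inter {S T : Set Ψ} (hS : IsGClosed G S) (hT : IsGClosed G T) :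
    IsGClosed G (S ∩ T) :=
  isGClosed_of_cl_subset (Set.subset_inter (cl_subset hS Set.inter_subset_left)
    (cl_subset hT Set.inter_subset_right))

theorem mem_fix_image {g h : G} {S : Set Ψ} :
    h ∈ fixingSubgroup G ((g • ·) '' S) ↔ g⁻¹ * h * g ∈ fixingSubgroup G S := by
  rw [mem_fix, mem_fix, Set.forall_mem_image]
  refine forall₂_congr fun x _ => ?_
  rw [mul_smul, mul_smul, inv_smul_eq_iff]

theorem IsGClosed.image {T : Set Ψ} (hT : IsGClosed G T) (g : G) :
    IsGClosed G ((g • ·) '' T) := by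
  refine isGClosed_of_cl_subset fun x hx => ⟨g⁻¹ • x, ?_, smul_inv_smul g x⟩
  refine hT.cl_eq.le fun h hh => ?_
  have := hx (g * h * g⁻¹) (mem_fix_image.2 (by simpa [mul_assoc] using hh))
  rw [mul_smul, mul_smul, ← eq_inv_smul_iff] at this
  exact this

theorem IsGClosed.preimage {T : Set Ψ} (hT : IsGClosed G T) (g : G) :
    IsGClosed G ((g • ·) ⁻¹' T) := by
  have := hT.image g⁻¹
  convert this using 1
  ext x
  exact ⟨fun h => ⟨g • x, h, inv_smul_smul g x⟩, by rintro ⟨y, hy, rfl⟩; simpa using hy⟩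

theorem IsGClosed.eq_of_fixing_eq {S T : Set Ψ} (hS : IsGClosed G S) (hT : IsGClosed G T)
    (h : fixingSubgroup G S = fixingSubgroup G T) : S = T := by
  rw [← hS.cl_eq, ← hT.cl_eq]
  unfold cl
  rw [h]

/-- Conjugating `G_T` by `g` gives the stabilizer of `g(T)`, and a closed set is determined by its
stabilizer. -/
theorem mem_normalizer_fix_iff {T : Set Ψ} (hT : IsGClosed G T) {g : G} :
    g ∈ Subgroup.normalizer (fixingSubgroup G T : Set G) ↔ (g • ·) '' T = T := by
  rw [Subgroup.mem_normalizer_iff]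
  constructor
  · intro h
    refine (hT.image g).eq_of_fixing_eq hT ?_
    ext x
    rw [mem_fix_image]
    have := h (g⁻¹ * x * g)
    rw [this]
    simp [mul_assoc]
  · intro h x
    have := mem_fix_image (g := g) (h := g * x * g⁻¹) (S := T)
    rw [h] at this
    change _ ∈ fixingSubgroup G T ↔ _ ∈ fixingSubgroup G T
    rw [this]
    simp [mul_assoc]

theorem image_eq_of_subset {T : Set Ψ} (hT : T.Finite) {g : G} (h : (g • ·) '' T ⊆ T) :
    (g • ·) '' T = T :=
  Set.eq_of_subset_of_ncard_le h (Set.ncard_image_of_injective T (MulAction.injective g)).ge hT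

/-- The value of an element of `G/G_T` at an element of `T`. -/
def ev {T : Set Ψ} (s : Orb G T) (t : T) : Ψ :=
  Quotient.liftOn' s (fun g => g • (t : Ψ)) fun g h hgh => by
    have := mem_fix.1 (QuotientGroup.leftRel_apply.1 hgh) t t.2
    rw [mul_smul, inv_smul_eq_iff] at this
    exact this.symm

@[simp] theorem ev_mk {T : Set Ψ} (g : G) (t : T) :
    ev (QuotientGroup.mk g : Orb G T) t = g • (t : Ψ) := rfl

@[simp] theorem ev_smul {T : Set Ψ} (g : G) (s : Orb G T) (t : T) :
    ev (g • s) t = g • ev s t := by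
  induction s using QuotientGroup.induction_on with
  | H h => exact mul_smul g h (t : Ψ)

theorem orb_mk_eq_iff {T : Set Ψ} {g h : G} :
    (QuotientGroup.mk g : Orb G T) = QuotientGroup.mk h ↔ ∀ t ∈ T, g • t = h • t := by
  rw [QuotientGroup.eq, mem_fix]
  refine forall₂_congr fun x _ => ?_
  rw [mul_smul, inv_smul_eq_iff, eq_comm]

theorem ev_injective {T : Set Ψ} : Function.Injective (ev : Orb G T → T → Ψ) := by
  intro s r h
  induction s using QuotientGroup.induction_on with
  | H g =>
    induction r using QuotientGroup.induction_on with
    | H g' => exact orb_mk_eq_iff.2 fun t ht => congrFun h ⟨t, ht⟩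

/-- The image of an element of `G/G_T`, considered as an embedding of `T` into `Ψ`. -/
def img {T : Set Ψ} (s : Orb G T) : Set Ψ := Set.range (ev s)

theorem img_mk {T : Set Ψ} (g : G) : img (QuotientGroup.mk g : Orb G T) = (g • ·) '' T := by
  ext x
  simp [img]

theorem img_smul {T : Set Ψ} (g : G) (s : Orb G T) : img (g • s) = (g • ·) '' img s := by
  ext x
  simp [img]

theorem finite_img {T : Set Ψ} (hT : T.Finite) (s : Orb G T) : (img s).Finite :=
  haveI := hT.to_subtype
  Set.finite_range _

theorem finite_setOf_img_subset {T W : Set Ψ} (hT : T.Finite) (hW : W.Finite) :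
    {s : Orb G T | img s ⊆ W}.Finite := by
  have := hT.to_subtype
  have := hW.to_subtype
  refine Set.Finite.of_finite_image (f := ev) ?_ ev_injective.injOn
  refine (Set.Finite.pi' (fun _ : T => hW)).subset ?_
  rintro _ ⟨s, hs, rfl⟩ t
  exact hs ⟨t, rfl⟩

theorem img_weyl_smul {T : Set Ψ} (hT : IsGClosed G T) (a : AutT G T) (s : Orb G T) :
    img (a • s) = img s := by
  induction s using QuotientGroup.induction_on with
  | H g =>
    induction a using QuotientGroup.induction_on with
    | H n =>
      rw [weyl_smul_mk, img_mk, img_mk]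
      have := (mem_normalizer_fix_iff hT).1 (inv_mem n.2)
      conv_rhs => rw [← this, Set.image_image]
      simp [mul_smul]

theorem weyl_smul_base_injective {T : Set Ψ} :
    Function.Injective fun a : AutT G T => a • (QuotientGroup.mk 1 : Orb G T) := by
  intro a b h1
  induction a using QuotientGroup.induction_on with
  | H m =>
    induction b using QuotientGroup.induction_on with
    | H n =>
      simp only [weyl_smul_mk, one_mul] at h1
      rw [QuotientGroup.eq] at h1
      have h2 := (Subgroup.mem_normalizer_iff.1 (inv_mem n.2) _).1 h1
      refine QuotientGroup.eq.2 ?_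
      rw [Subgroup.mem_subgroupOf]
      have h3 := inv_mem h2
      simpa [mul_assoc] using h3

theorem finite_autT {T : Set Ψ} (hT : T.Finite) (hTc : IsGClosed G T) : Finite (AutT G T) := by
  have := (finite_setOf_img_subset (G := G) hT hT).to_subtype
  let f : AutT G T → {s : Orb G T | img s ⊆ T} := fun a =>
    ⟨a • (QuotientGroup.mk 1 : Orb G T), by
      change img _ ⊆ T
      rw [img_weyl_smul hTc, img_mk]; simp⟩
  exact Finite.of_injective f fun a b hab =>
    weyl_smul_base_injective (congrArg Subtype.val hab)

/-- An embedding of the finite set `T` into itself is onto, so it comes from the normalizer. With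
`weyl_smul_base_injective`, the embeddings of `T` with image in `T` form one free `Aut(T)`-orbit. -/
theorem exists_weyl_smul_base {T : Set Ψ} (hT : T.Finite) (hTc : IsGClosed G T) {s : Orb G T}
    (hs : img s ⊆ T) : ∃ a : AutT G T, s = a • (QuotientGroup.mk 1 : Orb G T) := by
  induction s using QuotientGroup.induction_on with
  | H g =>
    rw [img_mk] at hs
    have hg := (mem_normalizer_fix_iff hTc).2 (image_eq_of_subset hT hs)
    refine ⟨QuotientGroup.mk ⟨g⁻¹, inv_mem hg⟩, ?_⟩
    rw [weyl_smul_mk]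
    simp

variable (G)

/-- The properties of a permutation group on which the structure theory of its smooth
representations rests. -/
structure IsGood : Prop where
  finite_cl : ∀ S : Set Ψ, S.Finite → (cl G S).Finite
  -- A partial map from `S` into `W` is induced by an element of `G` preserving `W`.
  extend : ∀ S W : Set Ψ, IsGClosed G S → IsGClosed G W → W.Finite → S ⊆ W →
    ∀ g : G, (∀ s ∈ S, g • s ∈ W) → ∃ h : G, (∀ s ∈ S, h • s = g • s) ∧ ∀ w ∈ W, h • w ∈ W
  -- The identity on `A` and `g` on `B` glue as soon as they are compatible and `g` sends no new
  -- point of `B` into `A`.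
  amalgam : ∀ A B : Set Ψ, IsGClosed G A → A.Finite → IsGClosed G B → B.Finite → ∀ g : G,
    (∀ b ∈ B, g • b ∈ A → b ∈ A) → (∀ b ∈ B, b ∈ A → g • b = b) →
    ∃ h : G, (∀ a ∈ A, h • a = a) ∧ ∀ b ∈ B, h • b = g • b
  -- The elements of `U` fixing `T'` and those fixing `T` form different groups, but they have the
  -- same orbit on the inclusion of any `S` meeting `T` inside `T'`. The difference of the two
  -- averages detects `T` and ignores such `S`.
  oneStep : ∀ T' T W : Set Ψ, IsGClosed G T' → IsGClosed G T → IsGClosed G W → W.Finite →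
    T' ⊂ T → T ⊆ W → ∃ U : Subgroup G, Finite U ∧
      (∀ u ∈ U, ∀ w ∈ W, u • w ∈ W → u • w = w) ∧
      (∀ S ⊆ W, IsGClosed G S → S ∩ T ⊆ T' → ∀ u ∈ U, u ∈ fixingSubgroup G T' →
        ∃ u' ∈ U, u' ∈ fixingSubgroup G T ∧ ∀ s ∈ S, u • s = u' • s) ∧
      ∃ u ∈ U, u ∈ fixingSubgroup G T' ∧ u ∉ fixingSubgroup G T

end Geometry


/-! ### The universal property of `R[G/H]`. -/

section Lift

variable {R G V : Type*} [CommRing R] [Group G] [AddCommGroup V] [Module R V]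

/-- The base point of `R[G/H]`. -/
def bp (R : Type*) [CommRing R] (H : Subgroup G) : R[G ⧸ H] :=
  MonoidAlgebra.single (QuotientGroup.mk 1) 1

theorem permRep_single (H : Subgroup G) (g : G) (s : G ⧸ H) (c : R) :
    permRep R H g (MonoidAlgebra.single s c) = MonoidAlgebra.single (g • s) c :=
  Representation.ofMulAction_single g s c

theorem permRep_bp (H : Subgroup G) (g : G) :
    permRep R H g (bp R H) = MonoidAlgebra.single (QuotientGroup.mk g) 1 := by
  rw [bp, permRep_single]
  congr 1
  exact congrArg QuotientGroup.mk (mul_one g)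

/-- The morphism from `R[G/H]` determined by a vector fixed by `H`. -/
def liftFixed {H : Subgroup G} (ρ : Representation R G V) (v : V) (hv : ∀ h ∈ H, ρ h v = v) :
    (permRep R H).IntertwiningMap ρ where
  toLinearMap := Finsupp.linearCombination R (fun s : G ⧸ H =>
      Quotient.liftOn' s (fun g => ρ g v) fun g h hgh => by
        have := hv _ (QuotientGroup.leftRel_apply.1 hgh)
        rw [map_mul, Module.End.mul_apply, Representation.inv_apply_eq_iff] at this
        exact this.symm) ∘ₗ (MonoidAlgebra.coeffLinearEquiv R).toLinearMap
  isIntertwining' g := by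
    refine LinearMap.ext fun x => ?_
    induction x using MonoidAlgebra.induction_linear with
    | zero => simp
    | add x y hx hy => simp only [map_add, hx, hy]
    | single s c =>
      induction s using QuotientGroup.induction_on with
      | H h =>
        rw [LinearMap.comp_apply, permRep_single]
        simp only [LinearMap.comp_apply, LinearEquiv.coe_coe, MonoidAlgebra.coeffLinearEquiv_apply,
          MonoidAlgebra.coeff_single, Finsupp.linearCombination_single, map_smul]
        congr 1
        change ρ (g * h) v = ρ g (ρ h v)
        rw [map_mul, Module.End.mul_apply]

theorem liftFixed_single {H : Subgroup G} (ρ : Representation R G V) (v : V)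
    (hv : ∀ h ∈ H, ρ h v = v) (g : G) (c : R) :
    liftFixed ρ v hv (MonoidAlgebra.single (QuotientGroup.mk g) c) = c • ρ g v := by
  change Finsupp.linearCombination R _ (MonoidAlgebra.single _ c).coeff = _
  rw [MonoidAlgebra.coeff_single, Finsupp.linearCombination_single]
  rfl

@[simp] theorem liftFixed_bp {H : Subgroup G} (ρ : Representation R G V) (v : V)
    (hv : ∀ h ∈ H, ρ h v = v) : liftFixed ρ v hv (bp R H) = v := by
  rw [bp, liftFixed_single]; simp

theorem intertwiningMap_permRep_ext {H : Subgroup G} {ρ : Representation R G V}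
    {f f' : (permRep R H).IntertwiningMap ρ} (h : f (bp R H) = f' (bp R H)) (x : R[G ⧸ H]) :
    f x = f' x := by
  induction x using MonoidAlgebra.induction_linear with
  | zero => simp
  | add x y hx hy => simp [hx, hy]
  | single s c =>
    induction s using QuotientGroup.induction_on with
    | H g =>
      have : MonoidAlgebra.single (QuotientGroup.mk g) c = c • permRep R H g (bp R H) := by
        rw [permRep_bp]; simp
      rw [this, map_smul, map_smul, Representation.IntertwiningMap.isIntertwining,
        Representation.IntertwiningMap.isIntertwining, h]

theorem permRep_bp_of_mem {H : Subgroup G} {h : G} (hh : h ∈ H) :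
    permRep R H h (bp R H) = bp R H := by
  rw [permRep_bp, bp]
  congr 1
  exact QuotientGroup.eq.2 (by simpa using hh)

end Lift

/-! ### Weights of group algebra elements and averages over finite subgroups. -/

section Operators

variable {k G : Type*} [Field k]

/-- The total weight of an element of the group algebra against a function. -/
def weight (φ : G → k) (P : k[G]) : k := P.coeff.sum fun g c => c * φ g

theorem weight_add (φ : G → k) (P Q : k[G]) : weight φ (P + Q) = weight φ P + weight φ Q := by
  rw [weight, MonoidAlgebra.coeff_add, Finsupp.sum_add_index']
  · rfl
  · simp
  · intros; rw [add_mul]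

theorem weight_single (φ : G → k) (g : G) (c : k) :
    weight φ (MonoidAlgebra.single g c) = c * φ g := by
  simp [weight]

theorem weight_zero (φ : G → k) : weight φ (0 : k[G]) = 0 := by simp [weight]

theorem weight_smul (φ : G → k) (c : k) (P : k[G]) : weight φ (c • P) = c * weight φ P := by
  rw [weight, MonoidAlgebra.coeff_smul, Finsupp.sum_smul_index' (by simp), weight, Finsupp.mul_sum]
  simp [mul_assoc]

theorem weight_congr {φ φ' : G → k} {P : k[G]} (h : ∀ g ∈ P.coeff.support, φ g = φ' g) :
    weight φ P = weight φ' P :=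
  Finset.sum_congr rfl fun g hg => by simp only [h g hg]

theorem weight_mul_const (φ : G → k) (c : k) (P : k[G]) :
    weight (fun g => φ g * c) P = weight φ P * c := by
  rw [weight, weight, Finsupp.sum_mul]
  simp [mul_assoc]

variable [Group G]

theorem weight_mul (φ : G → k) (P Q : k[G]) :
    weight φ (P * Q) = weight (fun g => weight (fun h => φ (g * h)) Q) P := by
  induction P using MonoidAlgebra.induction_linear with
  | zero => simp [weight_zero]
  | add x y hx hy => rw [add_mul, weight_add, hx, hy, weight_add]
  | single g c =>
    rw [weight_single]
    induction Q using MonoidAlgebra.induction_linear with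
    | zero => simp [weight_zero]
    | add x y hx hy => rw [mul_add, weight_add, hx, hy, weight_add, mul_add]
    | single h d => rw [MonoidAlgebra.single_mul_single, weight_single, weight_single, mul_assoc]

theorem weight_mul_of_multiplicative (φ : G → k) (P Q : k[G])
    (h : ∀ g ∈ P.coeff.support, ∀ g' ∈ Q.coeff.support, φ (g * g') = φ g * φ g') :
    weight φ (P * Q) = weight φ P * weight φ Q := by
  rw [weight_mul, ← weight_mul_const]
  refine weight_congr fun g hg => ?_
  rw [weight_congr (φ' := fun g' => φ g' * φ g) fun g' hg' => by rw [h g hg g' hg', mul_comm],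
    weight_mul_const, mul_comm]

theorem coeff_asAlgebraHom_permRep (H : Subgroup G) (P : k[G]) (x : k[G ⧸ H]) (r : G ⧸ H) :
    ((permRep k H).asAlgebraHom P x).coeff r = weight (fun g => x.coeff (g⁻¹ • r)) P := by
  rw [asAlgebraHom_apply_eq_sum, Finsupp.sum, MonoidAlgebra.coeff_sum, Finsupp.finsetSum_apply,
    weight, Finsupp.sum]
  refine Finset.sum_congr rfl fun g _ => ?_
  rw [MonoidAlgebra.coeff_smul_apply, Representation.coeff_ofMulAction, smul_eq_mul]

/-- A vector fixed by `H` is the image of the base point of `k[G/H]` under a morphism. Relations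
between operators can thus be checked on the base point and used in any representation. -/
theorem asAlgebraHom_eq_of_bp {V : Type*} [AddCommGroup V] [Module k V] {H : Subgroup G}
    (ρ : Representation k G V) {v : V} (hv : ∀ h ∈ H, ρ h v = v) {P Q : k[G]}
    (h : (permRep k H).asAlgebraHom P (bp k H) = (permRep k H).asAlgebraHom Q (bp k H)) :
    ρ.asAlgebraHom P v = ρ.asAlgebraHom Q v := by
  have := congrArg (liftFixed ρ v hv) h
  rwa [asAlgebraHom_intertwining, asAlgebraHom_intertwining, liftFixed_bp] at this

/-- The average over a finite subgroup. -/
def avg (k : Type*) [Field k] (H : Subgroup G) [Finite H] : k[G] :=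
  letI := Fintype.ofFinite H
  (Nat.card H : k)⁻¹ • ∑ h : H, MonoidAlgebra.single (h : G) 1

variable (H : Subgroup G) [Finite H]

theorem coeff_avg (g : G) [Decidable (g ∈ H)] :
    (avg k H).coeff g = if g ∈ H then (Nat.card H : k)⁻¹ else 0 := by
  classical
  let _ := Fintype.ofFinite H
  rw [avg, MonoidAlgebra.coeff_smul_apply, MonoidAlgebra.coeff_sum, Finsupp.finsetSum_apply]
  simp only [MonoidAlgebra.coeff_single, Finsupp.single_apply]
  split_ifs with hg
  · rw [Finset.sum_eq_single ⟨g, hg⟩]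
    · simp
    · intro b _ hb
      rw [if_neg]
      exact fun h => hb (Subtype.ext h)
    · simp
  · rw [Finset.sum_eq_zero, smul_zero]
    intro b _
    rw [if_neg]
    rintro rfl
    exact hg b.2

variable {V : Type*} [AddCommGroup V] [Module k V] (ρ : Representation k G V)

theorem asAlgebraHom_avg [Fintype H] (v : V) :
    ρ.asAlgebraHom (avg k H) v = (Nat.card H : k)⁻¹ • ∑ h : H, ρ h v := by
  rw [avg, map_smul, map_sum, LinearMap.smul_apply, LinearMap.sum_apply]
  congr 1
  refine Finset.sum_congr (by ext; simp) ?_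
  simp

theorem avg_apply_of_mem {h : G} (hh : h ∈ H) (v : V) :
    ρ.asAlgebraHom (avg k H) (ρ h v) = ρ.asAlgebraHom (avg k H) v := by
  let _ := Fintype.ofFinite H
  rw [asAlgebraHom_avg, asAlgebraHom_avg]
  congr 1
  refine Fintype.sum_equiv (Equiv.mulRight ⟨h, hh⟩) _ _ fun g => ?_
  simp

theorem apply_avg_of_mem {h : G} (hh : h ∈ H) (v : V) :
    ρ h (ρ.asAlgebraHom (avg k H) v) = ρ.asAlgebraHom (avg k H) v := by
  let _ := Fintype.ofFinite H
  rw [asAlgebraHom_avg, map_smul, map_sum]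
  congr 1
  refine Fintype.sum_equiv (Equiv.mulLeft ⟨h, hh⟩) _ _ fun g => ?_
  simp

variable [CharZero k]

theorem avg_apply_of_fixed {v : V} (hv : ∀ h ∈ H, ρ h v = v) :
    ρ.asAlgebraHom (avg k H) v = v := by
  let _ := Fintype.ofFinite H
  rw [asAlgebraHom_avg, Finset.sum_congr rfl fun (h : H) _ => hv h h.2, Finset.sum_const,
    Finset.card_univ, ← Nat.card_eq_fintype_card, ← Nat.cast_smul_eq_nsmul k, smul_smul,
    inv_mul_cancel₀ (Nat.cast_ne_zero.2 Nat.card_pos.ne'), one_smul]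

/-- Two nested finite groups with the same orbit of a vector have the same average on it. -/
theorem avg_eq_avg {H' : Subgroup G} [Finite H'] (hle : H' ≤ H) {v : V}
    (hv : ∀ h ∈ H, ∃ h' ∈ H', ρ h v = ρ h' v) :
    ρ.asAlgebraHom (avg k H) v = ρ.asAlgebraHom (avg k H') v := by
  let _ := Fintype.ofFinite H
  -- The average over `H` is fixed by `H'`, so averaging again over `H'` changes nothing. After that
  -- second average each `h v` may be replaced by `h' v`, and then by `v`.
  rw [← avg_apply_of_fixed (k := k) H' ρ (v := ρ.asAlgebraHom (avg k H) v)
    fun h hh => apply_avg_of_mem H ρ (hle hh) v]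
  conv_lhs => rw [asAlgebraHom_avg H ρ v, map_smul, map_sum]
  rw [Finset.sum_congr rfl (g := fun _ => ρ.asAlgebraHom (avg k H') v), Finset.sum_const,
    Finset.card_univ, ← Nat.card_eq_fintype_card, ← Nat.cast_smul_eq_nsmul k, smul_smul,
    inv_mul_cancel₀ (Nat.cast_ne_zero.2 Nat.card_pos.ne'), one_smul]
  intro h _
  obtain ⟨h', hh', e⟩ := hv h h.2
  rw [e, avg_apply_of_mem H' ρ hh']

end Operators

/-! ### Construction of the key operators. -/

section Key

variable {Ψ : Type*} {G : Subgroup (Equiv.Perm Ψ)} {k : Type*} [Field k]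

open Classical in
/-- The indicator function of the pointwise stabilizer of `B`. -/
def ind (k : Type*) [Field k] (B : Set Ψ) (g : G) : k := if g ∈ fixingSubgroup G B then 1 else 0

theorem ind_of_mem {B : Set Ψ} {g : G} (h : g ∈ fixingSubgroup G B) : ind k B g = 1 := if_pos h

theorem ind_of_notMem {B : Set Ψ} {g : G} (h : g ∉ fixingSubgroup G B) : ind k B g = 0 := if_neg h

/-- All elements of the support of `P` move any point of `W` either trivially or out of `W`. -/
def MovesOff (W : Set Ψ) (P : k[G]) : Prop :=
  ∀ u ∈ P.coeff.support, ∀ w ∈ W, u • w ∈ W → u • w = w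

theorem mem_support_mul {P Q : k[G]} {u : G} (h : u ∈ (P * Q).coeff.support) :
    ∃ p ∈ P.coeff.support, ∃ q ∈ Q.coeff.support, p * q = u := by
  classical
  exact Finset.mem_mul.1 (MonoidAlgebra.support_coeff_mul_subset P Q h)

/-- If `q u w` lies in `W`, then `q` sends the point `u w` of `W'` into `W'`, hence fixes it. So `u
w` already lies in `W`, and `u` fixes `w`. -/
theorem MovesOff.mul {W W' : Set Ψ} {Q P : k[G]} (hW : W ⊆ W') (hQ : MovesOff W' Q)
    (hP : MovesOff W P) (h : ∀ u ∈ P.coeff.support, ∀ w ∈ W, u • w ∈ W') :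
    MovesOff W (Q * P) := by
  intro v hv w hw hvw
  obtain ⟨q, hq, u, hu, rfl⟩ := mem_support_mul hv
  rw [mul_smul] at hvw ⊢
  have h1 := hQ q hq (u • w) (h u hu w hw) (hW hvw)
  rw [h1] at hvw ⊢
  exact hP u hu w hw hvw

/-- On the supports, `q u` fixes `B` pointwise exactly when both `q` and `u` do, since `q` cannot
bring a displaced point `u b` of `W'` back to `b`. The indicator is therefore multiplicative there.
-/
theorem weight_ind_mul {W W' B : Set Ψ} {Q P : k[G]} (hW : W ⊆ W') (hQ : MovesOff W' Q)
    (h : ∀ u ∈ P.coeff.support, ∀ w ∈ W, u • w ∈ W') (hB : B ⊆ W) :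
    weight (ind k B) (Q * P) = weight (ind k B) Q * weight (ind k B) P := by
  refine weight_mul_of_multiplicative _ _ _ fun q hq u hu => ?_
  by_cases hu' : u ∈ fixingSubgroup G B
  · rw [ind_of_mem hu', mul_one, ind, ind, Subgroup.mul_mem_cancel_right _ hu']
  · rw [ind_of_notMem hu', mul_zero, ind_of_notMem]
    refine fun hqu => hu' (mem_fix.2 fun b hb => ?_)
    have h1 := mem_fix.1 hqu b hb
    rw [mul_smul] at h1
    have h2 := hQ q hq (u • b) (h u hu b (hB hb)) (by rw [h1]; exact hW (hB hb))
    rw [← h2, h1]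

variable [CharZero k]

/-- Take the average over `U ∩ G_T` minus the average over `U ∩ G_{T'}`. Equal orbits make it vanish
on the embeddings of `S`. For `T ⊆ B`, each element of its support fixing `B` has the same
coefficient `1/|U₁| - 1/|U₂|`, nonzero because `U₁` is a proper subgroup of `U₂`, and the identity
is such an element. Characteristic zero keeps the total nonzero. -/
theorem exists_step_operator (hG : IsGood G) {T' T W : Set Ψ} (hT' : IsGClosed G T')
    (hT : IsGClosed G T) (hW : IsGClosed G W) (hWf : W.Finite) (hTT : T' ⊂ T) (hTW : T ⊆ W) :
    ∃ Q : k[G], (∀ S ⊆ W, IsGClosed G S → S ∩ T ⊆ T' →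
        (permRep k (fixingSubgroup G S)).asAlgebraHom Q (bp k _) = 0) ∧ MovesOff W Q ∧
      ∀ B, T ⊆ B → B ⊆ W → weight (ind k B) Q ≠ 0 := by
  classical
  obtain ⟨U, hU, ha, hb, u₀, hu₀, hu₀', hu₀T⟩ := hG.oneStep T' T W hT' hT hW hWf hTT hTW
  let U₁ := U ⊓ fixingSubgroup G T
  let U₂ := U ⊓ fixingSubgroup G T'
  have : Finite U₁ := Set.Finite.subset (s := (U : Set G)) (Set.toFinite _) fun _ h => h.1
  have : Finite U₂ := Set.Finite.subset (s := (U : Set G)) (Set.toFinite _) fun _ h => h.1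
  have hle : U₁ ≤ U₂ := inf_le_inf_left _ (fixing_mono hTT.1)
  have hU' : ∀ u ∈ (avg k U₁ - avg k U₂).coeff.support, u ∈ U := by
    intro u hu
    by_contra h
    rw [Finsupp.mem_support_iff, MonoidAlgebra.coeff_sub, Finsupp.sub_apply, coeff_avg, coeff_avg,
      if_neg fun h' => h h'.1, if_neg fun h' => h h'.1, sub_zero] at hu
    exact hu rfl
  refine ⟨avg k U₁ - avg k U₂, fun S hSW hS hST => ?_, fun u hu => ha u (hU' u hu), ?_⟩
  · rw [map_sub, LinearMap.sub_apply, sub_eq_zero]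
    refine (avg_eq_avg U₂ _ hle fun u hu => ?_).symm
    obtain ⟨u', hu', hu'T, h⟩ := hb S hSW hS hST u hu.1 hu.2
    refine ⟨u', ⟨hu', hu'T⟩, ?_⟩
    rw [permRep_bp, permRep_bp, orb_mk_eq_iff.2 h]
  · intro B hTB hBW
    set Q := avg k U₁ - avg k U₂
    set c : k := (Nat.card U₁ : k)⁻¹ - (Nat.card U₂ : k)⁻¹
    have hlt : Nat.card U₁ < Nat.card U₂ := by
      have h1 : (U₁ : Set G) ⊂ U₂ :=
        ⟨hle, fun h => hu₀T (h (show u₀ ∈ U₂ from ⟨hu₀, hu₀'⟩)).2⟩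
      have := Set.ncard_lt_ncard h1 (Set.toFinite _)
      simpa [← Nat.card_coe_set_eq] using this
    have hc : c ≠ 0 := by
      refine sub_ne_zero.2 fun h => hlt.ne ?_
      exact_mod_cast inv_injective h
    have hQ : ∀ u ∈ Q.coeff.support.filter (· ∈ fixingSubgroup G B), Q.coeff u = c := by
      intro u hu
      obtain ⟨hu, huB⟩ := Finset.mem_filter.1 hu
      have h1 : u ∈ U₁ := ⟨hU' u hu, fixing_mono hTB huB⟩
      rw [MonoidAlgebra.coeff_sub, Finsupp.sub_apply, coeff_avg, coeff_avg, if_pos h1,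
        if_pos (hle h1)]
    have hQ1 : (1 : G) ∈ Q.coeff.support.filter (· ∈ fixingSubgroup G B) := by
      refine Finset.mem_filter.2 ⟨?_, one_mem _⟩
      rw [Finsupp.mem_support_iff, MonoidAlgebra.coeff_sub, Finsupp.sub_apply, coeff_avg,
        coeff_avg, if_pos (one_mem _), if_pos (one_mem _)]
      exact hc
    have : weight (ind k B) Q =
        ∑ u ∈ Q.coeff.support.filter (· ∈ fixingSubgroup G B), Q.coeff u := by
      rw [Finset.sum_filter]
      refine Finset.sum_congr rfl fun u _ => ?_
      simp [ind]
    rw [this, Finset.sum_congr rfl hQ, Finset.sum_const, ← Nat.cast_smul_eq_nsmul k]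
    exact smul_ne_zero (Nat.cast_ne_zero.2 (Finset.card_ne_zero_of_mem hQ1)) hc

/-- Induction on the size of `T`: an operator for a maximal closed `T' ⊂ T` is followed by a step
operator from `T'` to `T`. If `T ⊆ cl G ∅`, no closed `S` omits a point of `T` and the identity
works. Nonvanishing weights for all intermediate `B`, not just `T`, are needed to keep the induction
going. -/
theorem exists_key_operator_aux (hG : IsGood G) (n : ℕ) :
    ∀ T W : Set Ψ, T.ncard = n → IsGClosed G T → IsGClosed G W → W.Finite → T ⊆ W →
    ∃ P : k[G], (∀ S ⊆ W, IsGClosed G S → ¬ T ⊆ S →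
        (permRep k (fixingSubgroup G S)).asAlgebraHom P (bp k _) = 0) ∧ MovesOff W P ∧
      ∀ B, T ⊆ B → B ⊆ W → weight (ind k B) P ≠ 0 := by
  induction n using Nat.strong_induction_on with
  | _ n ih =>
    intro T W hn hT hW hWf hTW
    have hTf := hWf.subset hTW
    by_cases hmin : T ⊆ cl G ∅
    · refine ⟨1, fun S _ hS h => ?_, fun u hu w _ _ => ?_, fun B _ _ => ?_⟩
      · exact absurd (hmin.trans (cl_subset hS (Set.empty_subset S))) h
      · have := Finsupp.support_single_subset
          (show u ∈ (Finsupp.single (1 : G) (1 : k)).support from hu)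
        rw [Finset.mem_singleton.1 this, one_smul]
      · rw [MonoidAlgebra.one_def, weight_single, ind_of_mem (one_mem _)]
        simp
    · have hfin : {S : Set Ψ | IsGClosed G S ∧ S ⊂ T}.Finite :=
        hTf.finite_subsets.subset fun S hS => hS.2.1
      have hne : {S : Set Ψ | IsGClosed G S ∧ S ⊂ T}.Nonempty :=
        ⟨cl G ∅, isGClosed_cl _, cl_subset hT (Set.empty_subset T), hmin⟩
      obtain ⟨T', ⟨hT', hTT⟩, hmax⟩ := hfin.exists_maximal hne
      obtain ⟨P, hP1, hP2, hP3⟩ := ih T'.ncard (hn ▸ Set.ncard_lt_ncard hTT hTf) T' W rfl hT' hW hWf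
        (hTT.1.trans hTW)
      -- The step operator is built for a set containing all translates of `W` by the support of
      -- `P`, so that it also moves these translates off.
      let W₀ : Set Ψ := W ∪ ⋃ u ∈ P.coeff.support, (u • ·) '' W
      have hW₀ : W₀.Finite :=
        hWf.union (P.coeff.support.finite_toSet.biUnion fun u _ => hWf.image _)
      have hWW : W ⊆ cl G W₀ := Set.subset_union_left.trans (subset_cl W₀)
      have hPW : ∀ u ∈ P.coeff.support, ∀ w ∈ W, u • w ∈ cl G W₀ := fun u hu w hw =>
        subset_cl W₀ (Or.inr (Set.mem_biUnion hu ⟨w, hw, rfl⟩))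
      obtain ⟨Q, hQ1, hQ2, hQ3⟩ := exists_step_operator (k := k) hG hT' hT (isGClosed_cl W₀)
        (hG.finite_cl _ hW₀) hTT (hTW.trans hWW)
      refine ⟨Q * P, fun S hSW hS hTS => ?_, hQ2.mul hWW hP2 hPW, fun B hTB hBW => ?_⟩
      · rw [asAlgebraHom_mul_apply]
        -- If `T' ⊆ S`, maximality of `T'` gives `S ∩ T ⊆ T'`. Since `P` moves points of `W` off
        -- `W`, each translate `u(S)` also meets `T` inside `T'`, and `Q` kills the corresponding
        -- embedding. If `T' ⊄ S`, `P` kills it already.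
        by_cases h : T' ⊆ S
        · have hST : S ∩ T ⊆ T' := by
            refine hmax ⟨hS.inter hT, Set.inter_subset_right, fun h' => ?_⟩
              (Set.subset_inter h hTT.1)
            exact hTS fun t ht => (h' ht).1
          rw [asAlgebraHom_apply_eq_sum _ P, Finsupp.sum, map_sum]
          refine Finset.sum_eq_zero fun u hu => ?_
          rw [map_smul]
          have : (permRep k (fixingSubgroup G S)).asAlgebraHom Q
              (permRep k (fixingSubgroup G S) u (bp k _)) =
              (permRep k (fixingSubgroup G S)).asAlgebraHom 0
                (permRep k (fixingSubgroup G S) u (bp k _)) := by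
            refine asAlgebraHom_eq_of_bp (H := fixingSubgroup G ((u • ·) '' S)) _ ?_ ?_
            · intro h hh
              rw [mem_fix_image] at hh
              rw [← Module.End.mul_apply, ← map_mul, permRep_bp, permRep_bp]
              congr 1
              refine QuotientGroup.eq.2 ?_
              have := inv_mem hh
              simpa [mul_assoc] using this
            · rw [map_zero, LinearMap.zero_apply]
              refine hQ1 _ ?_ (hS.image u) ?_
              · rintro _ ⟨s, hs, rfl⟩
                exact hPW u hu s (hSW hs)
              · rintro _ ⟨⟨s, hs, rfl⟩, ht⟩
                have := hP2 u hu s (hSW hs) (hTW ht)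
                simp only [this] at ht ⊢
                exact hST ⟨hs, ht⟩
          rw [this, map_zero, LinearMap.zero_apply, smul_zero]
        · rw [hP1 S hSW hS h, map_zero]
      · rw [weight_ind_mul hWW hQ2 hPW hBW]
        exact mul_ne_zero (hQ3 B hTB (hBW.trans hWW)) (hP3 B (hTT.1.trans hTB) hBW)

/-- The operator that isolates, among all the embeddings of `T` with image in `W`, those with
image `T`. -/
theorem exists_key_operator (hG : IsGood G) (k : Type*) [Field k] [CharZero k] {T W : Set Ψ}
    (hT : IsGClosed G T) (hW : IsGClosed G W) (hWf : W.Finite) (hTW : T ⊆ W) :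
    ∃ P : k[G], (∀ S ⊆ W, IsGClosed G S → ¬ T ⊆ S →
        (permRep k (fixingSubgroup G S)).asAlgebraHom P (bp k _) = 0) ∧ MovesOff W P ∧
      weight (ind k T) P = 1 := by
  obtain ⟨P, h1, h2, h3⟩ := exists_key_operator_aux (k := k) hG _ T W rfl hT hW hWf hTW
  refine ⟨(weight (ind k T) P)⁻¹ • P, fun S hS hS' hTS => ?_, fun u hu => h2 u ?_, ?_⟩
  · rw [map_smul, LinearMap.smul_apply, h1 S hS hS' hTS, smul_zero]
  · exact Finsupp.support_smul hu
  · rw [weight_smul, inv_mul_cancel₀ (h3 T subset_rfl hTW)]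

/-- A finite average over all the elements of `G_T` that map `W` to itself. -/
theorem exists_averaging_operator (k : Type*) [Field k] [CharZero k] (T : Set Ψ) {W : Set Ψ}
    (hWf : W.Finite) :
    ∃ A : k[G], (∀ u ∈ A.coeff.support, u ∈ fixingSubgroup G T ∧ ∀ w ∈ W, u • w ∈ W) ∧
      weight 1 A = 1 ∧
      ∀ h ∈ fixingSubgroup G T, (∀ w ∈ W, h • w ∈ W) →
        (permRep k (fixingSubgroup G W)).asAlgebraHom (A * MonoidAlgebra.single h 1) (bp k _) =
          (permRep k (fixingSubgroup G W)).asAlgebraHom A (bp k _) ∧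
        (permRep k (fixingSubgroup G W)).asAlgebraHom (MonoidAlgebra.single h 1 * A) (bp k _) =
          (permRep k (fixingSubgroup G W)).asAlgebraHom A (bp k _) := by
  classical
  -- The elements of `G_T` preserving `W` may form an infinite group, but they induce finitely many
  -- embeddings of `W`. One lift of each is averaged, so invariance holds only after applying the
  -- operator to vectors fixed by `G_W`.
  let O : Set (Orb G W) := {s | img s ⊆ W ∧ ∃ h ∈ fixingSubgroup G T, s = QuotientGroup.mk h}
  have hO : O.Finite := (finite_setOf_img_subset hWf hWf).subset fun s hs => hs.1
  have hlift : ∀ s : O, ∃ h ∈ fixingSubgroup G T, s.1 = QuotientGroup.mk h := fun s => s.2.2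
  choose l hl hl' using hlift
  have hlW : ∀ s, ∀ w ∈ W, l s • w ∈ W := by
    intro s w hw
    have := s.2.1
    rw [hl' s, img_mk] at this
    exact this ⟨w, hw, rfl⟩
  let _ := hO.fintype
  have hO1 : (QuotientGroup.mk 1 : Orb G W) ∈ O := ⟨by rw [img_mk]; simp, 1, one_mem _, rfl⟩
  have hcard : (Fintype.card O : k) ≠ 0 :=
    Nat.cast_ne_zero.2 (Fintype.card_pos_iff.2 ⟨⟨_, hO1⟩⟩).ne'
  let A : k[G] := (Fintype.card O : k)⁻¹ • ∑ s : O, MonoidAlgebra.single (l s) 1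
  have hAbp : ∀ g : G, (permRep k (fixingSubgroup G W)).asAlgebraHom A
      (MonoidAlgebra.single (QuotientGroup.mk g) 1) =
      (Fintype.card O : k)⁻¹ • ∑ s : O, MonoidAlgebra.single (QuotientGroup.mk (l s * g)) 1 := by
    intro g
    simp only [A, map_smul, map_sum, LinearMap.smul_apply, LinearMap.sum_apply,
      Representation.asAlgebraHom_single_one, permRep_single]
    rfl
  have hA1 : (permRep k (fixingSubgroup G W)).asAlgebraHom A (bp k _) =
      (Fintype.card O : k)⁻¹ • ∑ s : O, MonoidAlgebra.single (s : Orb G W) 1 := by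
    rw [bp, hAbp]
    simp only [mul_one, ← hl']
  refine ⟨A, fun u hu => ?_, ?_, fun h hh hhW => ⟨?_, ?_⟩⟩
  · have h1 : u ∈ (∑ s : O, MonoidAlgebra.single (l s) (1 : k)).coeff.support :=
      Finsupp.support_smul hu
    rw [MonoidAlgebra.coeff_sum] at h1
    obtain ⟨s, -, hs⟩ := Finset.mem_biUnion.1 (Finsupp.support_finsetSum h1)
    rw [Finset.mem_singleton.1 (Finsupp.support_single_subset hs)]
    exact ⟨hl s, hlW s⟩
  · have : ∀ t : Finset O, weight 1 (∑ s ∈ t, MonoidAlgebra.single (l s) (1 : k)) = t.card := by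
      intro t
      induction t using Finset.induction_on with
      | empty => simp [weight_zero]
      | insert a t ha ih => simp [Finset.sum_insert ha, weight_add, weight_single, ih,
          Finset.card_insert_of_notMem ha, add_comm]
    rw [weight_smul, this, Finset.card_univ, inv_mul_cancel₀ hcard]
  · rw [asAlgebraHom_mul_apply, Representation.asAlgebraHom_single_one, permRep_bp, hAbp, hA1]
    congr 1
    let f : O → O := fun s => ⟨QuotientGroup.mk (l s * h), by
      rw [img_mk]
      rintro _ ⟨w, hw, rfl⟩
      simp only [mul_smul]
      exact hlW s _ (hhW w hw), l s * h, mul_mem (hl s) hh, rfl⟩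
    have hf : Function.Bijective f := by
      refine Finite.injective_iff_bijective.1 fun s r hsr => ?_
      have h1 := orb_mk_eq_iff.1 (congrArg Subtype.val hsr)
      have hsurj : (h • ·) '' W = W := image_eq_of_subset hWf (by
        rintro _ ⟨w, hw, rfl⟩; exact hhW w hw)
      rw [Subtype.ext_iff, hl' s, hl' r, orb_mk_eq_iff]
      intro w hw
      obtain ⟨w', hw', rfl⟩ := hsurj.ge hw
      have := h1 w' hw'
      rwa [mul_smul, mul_smul] at this
    exact Fintype.sum_bijective f hf _ _ fun s => rfl
  · rw [asAlgebraHom_mul_apply, Representation.asAlgebraHom_single_one, hA1, map_smul, map_sum]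
    congr 1
    let f : O → O := fun s => ⟨QuotientGroup.mk (h * l s), by
      rw [img_mk]
      rintro _ ⟨w, hw, rfl⟩
      simp only [mul_smul]
      exact hhW _ (hlW s w hw), h * l s, mul_mem hh (hl s), rfl⟩
    have hf : Function.Bijective f := by
      refine Finite.injective_iff_bijective.1 fun s r hsr => ?_
      have h1 := orb_mk_eq_iff.1 (congrArg Subtype.val hsr)
      rw [Subtype.ext_iff, hl' s, hl' r, orb_mk_eq_iff]
      intro w hw
      have := h1 w hw
      rw [mul_smul, mul_smul] at this
      exact MulAction.injective h this
    refine Fintype.sum_bijective f hf _ _ fun s => ?_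
    rw [permRep_single]
    congr 1
    rw [hl' s]
    rfl

end Key


/-! ### Kernels and extension of scalars from `ℤ` to `k`. -/

section Flat

variable {X Y : Type*} (k : Type*) [Field k]

open Classical in
/-- The extension of scalars of a free abelian group. -/
def baseChangeEquiv (X : Type*) : k ⊗[ℤ] (X →₀ ℤ) ≃ₗ[ℤ] (X →₀ k) :=
  TensorProduct.finsuppScalarRight ℤ ℤ k X

theorem baseChangeEquiv_tmul (X : Type*) (c : k) (v : X →₀ ℤ) (x : X) :
    baseChangeEquiv k X (c ⊗ₜ v) x = v x • c := by
  classical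
  exact TensorProduct.finsuppScalarRight_apply_tmul_apply c v x

variable [CharZero k]

/-- The kernel of a morphism of free abelian groups spans the kernel of its scalar extension. -/
theorem mem_span_ker_of_flat (D : (X →₀ ℤ) →ₗ[ℤ] (Y →₀ ℤ)) (Dk : (X →₀ k) →ₗ[k] (Y →₀ k))
    (h : ∀ x y, Dk (Finsupp.single x 1) y = (D (Finsupp.single x 1) y : k)) {v : X →₀ k}
    (hv : Dk v = 0) :
    v ∈ Submodule.span k
      (Finsupp.mapRange.linearMap (Algebra.linearMap ℤ k) '' (LinearMap.ker D : Set (X →₀ ℤ))) := by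
  have hcomm : ∀ z : k ⊗[ℤ] (X →₀ ℤ),
      Dk (baseChangeEquiv k X z) = baseChangeEquiv k Y (D.lTensor k z) := by
    intro z
    induction z using TensorProduct.induction_on with
    | zero => simp
    | add x y hx hy => simp only [map_add, hx, hy]
    | tmul c w =>
      induction w using Finsupp.induction_linear with
      | zero => simp
      | add x y hx hy => simp only [TensorProduct.tmul_add, map_add, hx, hy]
      | single x n =>
        have h1 : baseChangeEquiv k X (c ⊗ₜ Finsupp.single x n) =
            ((n : k) * c) • Finsupp.single x 1 := by
          classical
          ext x'
          rw [baseChangeEquiv_tmul]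
          by_cases hx : x = x'
          · subst hx; simp
          · simp [Finsupp.single_eq_of_ne' hx]
        have h2 : D (Finsupp.single x n) = n • D (Finsupp.single x 1) := by
          rw [← map_smul]; simp
        ext y
        rw [h1, map_smul, LinearMap.lTensor_tmul, baseChangeEquiv_tmul, h2, Finsupp.smul_apply, h,
          Finsupp.smul_apply]
        simp only [smul_eq_mul, zsmul_eq_mul, Int.cast_mul]
        ring
  -- The inclusion of the kernel followed by `D` stays exact after tensoring with the torsion-free,
  -- hence flat, group `k`.
  have hex : Function.Exact (LinearMap.ker D).subtype D :=
    LinearMap.exact_subtype_ker_map D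
  have hex' := Module.Flat.lTensor_exact k hex
  obtain ⟨z, rfl⟩ := (baseChangeEquiv k X).surjective v
  rw [hcomm, LinearEquiv.map_eq_zero_iff] at hv
  obtain ⟨w, rfl⟩ := (hex' z).1 hv
  clear hv
  induction w using TensorProduct.induction_on with
  | zero => simp
  | add x y hx hy =>
    rw [map_add, map_add]
    exact add_mem hx hy
  | tmul c w =>
    rw [LinearMap.lTensor_tmul]
    have : baseChangeEquiv k X (c ⊗ₜ (w : X →₀ ℤ)) =
        c • Finsupp.mapRange.linearMap (Algebra.linearMap ℤ k) (w : X →₀ ℤ) := by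
      ext x
      rw [baseChangeEquiv_tmul]
      simp [mul_comm]
    rw [Submodule.subtype_apply, this]
    exact Submodule.smul_mem _ _ (Submodule.subset_span ⟨w, w.2, rfl⟩)

end Flat

/-! ### `V_T` and `V_T ⊗ k` described by restriction maps. -/

section Restriction

variable {Ψ : Type*} {G : Subgroup (Equiv.Perm Ψ)} (R : Type*) [CommRing R]

/-- The restriction of embeddings. -/
def res {T' T : Set Ψ} (h : T' ⊆ T) :
    (permRep R (fixingSubgroup G T)).IntertwiningMap (permRep R (fixingSubgroup G T')) :=
  liftFixed _ (bp R _) fun _ hg => permRep_bp_of_mem (fixing_mono h hg)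

/-- The restriction of an embedding. -/
def resOrb {T' T : Set Ψ} (h : T' ⊆ T) (s : Orb G T) : Orb G T' :=
  Quotient.map' id (fun g g' hg => by
    rw [QuotientGroup.leftRel_apply] at hg ⊢
    exact fixing_mono h hg) s

@[simp] theorem resOrb_mk {T' T : Set Ψ} (h : T' ⊆ T) (g : G) :
    resOrb h (QuotientGroup.mk g : Orb G T) = QuotientGroup.mk g := rfl

theorem ev_resOrb {T' T : Set Ψ} (h : T' ⊆ T) (s : Orb G T) (t : T') :
    ev (resOrb h s) t = ev s ⟨t, h t.2⟩ := by
  induction s using QuotientGroup.induction_on with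
  | H g => rfl

variable {R}

theorem res_bp {T' T : Set Ψ} (h : T' ⊆ T) :
    res (G := G) R h (bp R _) = bp R _ := liftFixed_bp _ _ _

theorem res_single {T' T : Set Ψ} (h : T' ⊆ T) (s : Orb G T) (c : R) :
    res R h (MonoidAlgebra.single s c) = MonoidAlgebra.single (resOrb h s) c := by
  induction s using QuotientGroup.induction_on with
  | H g =>
    rw [res, liftFixed_single, permRep_bp]
    simp

theorem coeff_res {T' T : Set Ψ} (h : T' ⊆ T) (x : R[Orb G T]) :
    (res R h x).coeff = Finsupp.mapDomain (resOrb h) x.coeff := by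
  induction x using MonoidAlgebra.induction_linear with
  | zero => simp
  | add x y hx hy => rw [map_add, MonoidAlgebra.coeff_add, hx, hy, MonoidAlgebra.coeff_add,
      Finsupp.mapDomain_add]
  | single s c => rw [res_single, MonoidAlgebra.coeff_single, MonoidAlgebra.coeff_single,
      Finsupp.mapDomain_single]

/-- If the orbit were finite, it could be included in the set `W` of `oneStep`. The element `u`
fixing `S` but not `x` would then send `x` to a point of `W`, hence fix it. -/
theorem infinite_orbit (hG : IsGood G) {S : Set Ψ} (hS : S.Finite) {x : Ψ} (hx : x ∉ cl G S) :
    {y | ∃ g ∈ fixingSubgroup G S, g • x = y}.Infinite := by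
  intro hO
  set O := {y | ∃ g ∈ fixingSubgroup G S, g • x = y}
  have hxT : insert x S ⊆ cl G (insert x S) := subset_cl _
  have hTT : cl G S ⊂ cl G (insert x S) :=
    ⟨cl_mono (Set.subset_insert _ _), fun h => hx (h (hxT (Set.mem_insert _ _)))⟩
  obtain ⟨U, -, ha, -, u, hu, hu', huT⟩ := hG.oneStep _ _ (cl G (insert x S ∪ O)) (isGClosed_cl S)
    (isGClosed_cl _) (isGClosed_cl _) (hG.finite_cl _ ((hS.insert x).union hO)) hTT
    (cl_mono Set.subset_union_left)
  rw [fixing_cl] at hu' huT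
  refine huT (mem_fix.2 fun y hy => ?_)
  rcases hy with rfl | hy
  · exact ha u hu y (subset_cl _ (Or.inl (Set.mem_insert _ _)))
      (subset_cl _ (Or.inr ⟨u, hu', rfl⟩))
  · exact mem_fix.1 hu' y hy

/-- An element of `R[G/G_{T'}]` fixed by `G_T` is supported on embeddings with image in `T`. -/
theorem img_subset_of_fixed (hG : IsGood G) {T T' : Set Ψ} (hT : T.Finite) (hTc : IsGClosed G T)
    {x : R[Orb G T']} (hx : ∀ g ∈ fixingSubgroup G T, permRep R (fixingSubgroup G T') g x = x)
    {s : Orb G T'} (hs : s ∈ x.coeff.support) : img s ⊆ T := by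
  rintro _ ⟨t, rfl⟩
  -- A point of the image outside `T` has an infinite `G_T`-orbit, yet invariance of `x` puts this
  -- orbit among the values of the finitely many embeddings in the support.
  by_contra h
  rw [← hTc.cl_eq] at h
  refine infinite_orbit hG hT h ((x.coeff.support.finite_toSet.image fun s => ev s t).subset ?_)
  rintro _ ⟨g, hg, rfl⟩
  refine ⟨g • s, ?_, ev_smul g s t⟩
  rw [Finset.mem_coe, Finsupp.mem_support_iff, ← hx g hg, Representation.coeff_ofMulAction,
    inv_smul_smul]
  exact Finsupp.mem_support_iff.1 hs

/-- A morphism `π` is determined by its value at the base point, which is fixed by `G_T` and so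
supported on embeddings `s` of `T'` into `T`. Each `s` contributes the restriction to the closed
proper subset `s(T')` followed by a morphism, so `π` vanishes where all restrictions do. -/
theorem mem_VT_iff (hG : IsGood G) {T : Set Ψ} (hT : T.Finite) (hTc : IsGClosed G T)
    (x : ℤ[Orb G T]) :
    x ∈ VT G T ↔ ∀ T' (_ : IsGClosed G T') (h : T' ⊂ T), res ℤ h.1 x = 0 := by
  constructor
  · intro hx T' hT' h
    exact hx T' hT' h _
  · intro hx T' hT' h π
    set y := π (bp ℤ _)
    have hy : ∀ g ∈ fixingSubgroup G T, permRep ℤ (fixingSubgroup G T') g y = y := by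
      intro g hg
      rw [← Representation.IntertwiningMap.isIntertwining, permRep_bp_of_mem hg]
    have key : ∀ s ∈ y.coeff.support, ∃ ψ : (permRep ℤ (fixingSubgroup G T)).IntertwiningMap
        (permRep ℤ (fixingSubgroup G T')), ψ (bp ℤ _) = MonoidAlgebra.single s (y.coeff s) ∧
          ψ x = 0 := by
      intro s hs
      have hsT := img_subset_of_fixed hG hT hTc hy hs
      induction s using QuotientGroup.induction_on with
      | H g =>
        rw [img_mk] at hsT
        have hss : (g • ·) '' T' ⊂ T := by
          refine hsT.ssubset_of_ne fun he => ?_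
          have h1 := Set.ncard_image_of_injective T' (MulAction.injective g)
          rw [he] at h1
          exact (Set.ncard_lt_ncard h hT).ne h1.symm
        have hfix : ∀ f ∈ fixingSubgroup G ((g • ·) '' T'), permRep ℤ (fixingSubgroup G T') f
            (MonoidAlgebra.single (QuotientGroup.mk g) (y.coeff (QuotientGroup.mk g))) =
            MonoidAlgebra.single (QuotientGroup.mk g) (y.coeff (QuotientGroup.mk g)) := by
          intro f hf
          rw [permRep_single]
          congr 1
          refine orb_mk_eq_iff.2 fun t ht => ?_
          change (f * g) • t = g • t
          rw [mul_smul]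
          exact mem_fix.1 hf (g • t) ⟨t, ht, rfl⟩
        refine ⟨(liftFixed _ _ hfix).comp (res ℤ hss.1), ?_, ?_⟩
        · rw [Representation.IntertwiningMap.comp_apply, res_bp, liftFixed_bp]
        · rw [Representation.IntertwiningMap.comp_apply, hx _ (hT'.image g) hss, map_zero]
    choose! ψ hψ hψx using key
    have : π x = (∑ s ∈ y.coeff.support, ψ s) x := by
      refine intertwiningMap_permRep_ext ?_ x
      rw [Representation.IntertwiningMap.sum_apply, Finset.sum_congr rfl hψ]
      exact (MonoidAlgebra.sum_coeff_single y).symm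
    rw [this, Representation.IntertwiningMap.sum_apply, Finset.sum_eq_zero hψx]

/-- There are finitely many restrictions. They are collected into one map to a free module on a
disjoint union, whose kernel over `k` is spanned by its kernel over `ℤ`. -/
theorem mem_VTk_iff (hG : IsGood G) (k : Type*) [Field k] [CharZero k] {T : Set Ψ}
    (hT : T.Finite) (hTc : IsGClosed G T) (x : k[Orb G T]) :
    x ∈ VTk G k T ↔ ∀ T' (_ : IsGClosed G T') (h : T' ⊂ T), res k h.1 x = 0 := by
  classical
  constructor
  · rintro ⟨z, rfl⟩ T' hT' h
    induction z using TensorProduct.induction_on with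
    | zero => rw [map_zero, map_zero]
    | add x y hx hy => rw [map_add, map_add, hx, hy, add_zero]
    | tmul c v =>
      have hv := (mem_VT_iff hG hT hTc v).1 v.2 T' hT' h
      have h1 : ∀ w : ℤ[Orb G T], res k h.1 (intMap k _ w) = intMap k _ (res ℤ h.1 w) := by
        intro w
        induction w using MonoidAlgebra.induction_linear with
        | zero => simp
        | add x y hx hy => simp only [map_add, hx, hy]
        | single s n => rw [intMap_single, res_single, res_single, intMap_single]
      have h2 : VTkMap G k T (c ⊗ₜ v) = c • intMap k _ (v : ℤ[Orb G T]) := by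
        simp [VTkMap]
      rw [h2, map_smul, h1, hv, map_zero, smul_zero]
  · intro hx
    let ι := {T' : Set Ψ // IsGClosed G T' ∧ T' ⊂ T}
    have : Finite ι := (hT.finite_subsets.subset fun S (hS : IsGClosed G S ∧ S ⊂ T) => hS.2.1)
    let _ := Fintype.ofFinite ι
    let r : ∀ i : ι, Orb G T → Σ i : ι, Orb G i.1 := fun i s => ⟨i, resOrb i.2.2.1 s⟩
    let D : (Orb G T →₀ ℤ) →ₗ[ℤ] ((Σ i : ι, Orb G i.1) →₀ ℤ) :=
      ∑ i, Finsupp.lmapDomain ℤ ℤ (r i)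
    let Dk : (Orb G T →₀ k) →ₗ[k] ((Σ i : ι, Orb G i.1) →₀ k) :=
      ∑ i, Finsupp.lmapDomain k k (r i)
    have hDk : Dk x.coeff = 0 := by
      rw [LinearMap.sum_apply]
      refine Finset.sum_eq_zero fun i _ => ?_
      rw [Finsupp.lmapDomain_apply]
      have h1 : r i = Sigma.mk i ∘ resOrb i.2.2.1 := rfl
      rw [h1, Finsupp.mapDomain_comp, ← coeff_res, hx i.1 i.2.1 i.2.2, MonoidAlgebra.coeff_zero,
        Finsupp.mapDomain_zero]
    have hspan := mem_span_ker_of_flat k D Dk (fun s y => by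
      simp [D, Dk, LinearMap.sum_apply, Finsupp.finsetSum_apply, Finsupp.single_apply]) hDk
    have hle : Submodule.span k (Finsupp.mapRange.linearMap (Algebra.linearMap ℤ k) ''
        (LinearMap.ker D : Set (Orb G T →₀ ℤ))) ≤
        (VTk G k T).toSubmodule.map (MonoidAlgebra.coeffLinearEquiv k).toLinearMap := by
      rw [Submodule.span_le]
      rintro _ ⟨v, hv, rfl⟩
      refine ⟨intMap k _ (MonoidAlgebra.ofCoeff v), ?_, rfl⟩
      have hvT : MonoidAlgebra.ofCoeff v ∈ VT G T := by
        refine (mem_VT_iff hG hT hTc _).2 fun T' hT' h => ?_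
        refine MonoidAlgebra.coeff_injective ?_
        rw [coeff_res, MonoidAlgebra.coeff_zero]
        ext y
        let j : ι := ⟨T', hT', h⟩
        have hD : (D v) ⟨j, y⟩ = 0 := by
          rw [show D v = 0 from hv]; rfl
        rw [LinearMap.sum_apply, Finsupp.finsetSum_apply, Finset.sum_eq_single j] at hD
        · have h1 : r j = Sigma.mk j ∘ resOrb h.1 := rfl
          rw [Finsupp.lmapDomain_apply, h1, Finsupp.mapDomain_comp,
            Finsupp.mapDomain_apply sigma_mk_injective] at hD
          exact hD
        · intro i _ hi
          rw [Finsupp.lmapDomain_apply, Finsupp.mapDomain_of_notMem_range]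
          rintro ⟨s, hs⟩
          exact hi (congrArg Sigma.fst hs)
        · simp
      refine ⟨1 ⊗ₜ ⟨_, hvT⟩, ?_⟩
      simp [VTkMap]
    obtain ⟨y, hy, hyx⟩ := hle hspan
    rwa [show y = x from MonoidAlgebra.coeff_injective hyx] at hy

end Restriction


/-! ### Consequences of the key operators for `k[G/G_T]` and `V_T ⊗ k`. -/

section Structure

variable {Ψ : Type*} {G : Subgroup (Equiv.Perm Ψ)} {k : Type*} [Field k]

/-- The elements of `k[G/G_T]` supported on embeddings with image in `W`. -/
def supp (k : Type*) [Field k] (T W : Set Ψ) : Submodule k k[Orb G T] where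
  carrier := {x | ∀ s, x.coeff s ≠ 0 → img s ⊆ W}
  add_mem' := by
    intro x y hx hy s hs
    by_cases h : x.coeff s = 0
    · refine hy s fun h' => hs ?_
      rw [MonoidAlgebra.coeff_add, Finsupp.add_apply, h, h', add_zero]
    · exact hx s h
  zero_mem' := by
    intro s hs
    simp at hs
  smul_mem' := by
    intro c x hx s hs
    refine hx s fun h => hs ?_
    rw [MonoidAlgebra.coeff_smul_apply, h, smul_zero]

theorem supp_mono {T W W' : Set Ψ} (h : W ⊆ W') : supp (G := G) k T W ≤ supp k T W' :=
  fun _ hx s hs => (hx s hs).trans h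

theorem permRep_mem_supp {T W W' : Set Ψ} {g : G} (h : ∀ w ∈ W, g • w ∈ W') {x : k[Orb G T]}
    (hx : x ∈ supp k T W) : permRep k (fixingSubgroup G T) g x ∈ supp k T W' := by
  intro s hs
  rw [Representation.coeff_ofMulAction] at hs
  have := hx _ hs
  rw [← smul_inv_smul g s, img_smul]
  rintro _ ⟨w, hw, rfl⟩
  exact h w (this hw)

theorem permRep_eq_self_of_mem_supp {T W : Set Ψ} {g : G} (h : g ∈ fixingSubgroup G W)
    {x : k[Orb G T]} (hx : x ∈ supp k T W) : permRep k (fixingSubgroup G T) g x = x := by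
  have hfix : ∀ s : Orb G T, img s ⊆ W → g • s = s := by
    intro s hs
    refine ev_injective (funext fun t => ?_)
    rw [ev_smul]
    exact mem_fix.1 h _ (hs ⟨t, rfl⟩)
  ext s
  rw [Representation.coeff_ofMulAction]
  by_cases h1 : x.coeff s = 0
  · by_cases h2 : x.coeff (g⁻¹ • s) = 0
    · rw [h1, h2]
    · have := hfix _ (hx _ h2)
      rw [smul_inv_smul] at this
      rw [← this]
  · conv_lhs => rw [← hfix s (hx s h1), inv_smul_smul]

theorem exists_supp (hG : IsGood G) {T S : Set Ψ} (hT : T.Finite) (hS : S.Finite)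
    {M : Submodule k k[Orb G T]} (hM : M.FG) :
    ∃ W : Set Ψ, W.Finite ∧ IsGClosed G W ∧ S ⊆ W ∧ M ≤ supp k T W := by
  obtain ⟨X, rfl⟩ := hM
  let W₀ : Set Ψ := S ∪ ⋃ x ∈ X, ⋃ s ∈ x.coeff.support, img s
  have hW₀ : W₀.Finite := hS.union (X.finite_toSet.biUnion fun x _ =>
    x.coeff.support.finite_toSet.biUnion fun s _ => finite_img hT s)
  refine ⟨cl G W₀, hG.finite_cl _ hW₀, isGClosed_cl _,
    Set.subset_union_left.trans (subset_cl W₀), Submodule.span_le.2 fun x hx s hs => ?_⟩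
  refine Set.Subset.trans ?_ (subset_cl W₀)
  refine Set.Subset.trans ?_ Set.subset_union_right
  exact (Set.subset_biUnion_of_mem (u := fun s => img s) (Finsupp.mem_support_iff.2 hs)).trans
    (Set.subset_biUnion_of_mem (u := fun x : k[Orb G T] => ⋃ s ∈ x.coeff.support, img s) hx)

/-- The action of `Aut(T)` on `k[G/G_T]` by morphisms of representations. -/
def weylMap (k : Type*) [Field k] {T : Set Ψ} (a : AutT G T) :
    (permRep k (fixingSubgroup G T)).IntertwiningMap (permRep k (fixingSubgroup G T)) where
  toLinearMap := weylRep k (fixingSubgroup G T) a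
  isIntertwining' g := LinearMap.ext fun x =>
    (permRep_weylRep_comm k (fixingSubgroup G T) g a x).symm

@[simp] theorem weylMap_apply {T : Set Ψ} (a : AutT G T) (x : k[Orb G T]) :
    weylMap k a x = weylRep k (fixingSubgroup G T) a x := rfl

theorem weylRep_single {T : Set Ψ} (a : AutT G T) (s : Orb G T) (c : k) :
    weylRep k (fixingSubgroup G T) a (MonoidAlgebra.single s c) =
      MonoidAlgebra.single (a • s) c :=
  Representation.ofMulAction_single a s c

/-- `P` is an operator that isolates, among all the embeddings of `T` with image in `W`, those with
image `T`. -/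
structure IsKey (T W : Set Ψ) (P : k[G]) : Prop where
  kill : ∀ S ⊆ W, IsGClosed G S → ¬ T ⊆ S →
    (permRep k (fixingSubgroup G S)).asAlgebraHom P (bp k _) = 0
  movesOff : MovesOff W P
  weight_eq : weight (ind k T) P = 1

namespace IsKey

variable {T W : Set Ψ} {P : k[G]} (hP : IsKey T W P)

include hP

theorem apply_eq_zero {V : Type*} [AddCommGroup V] [Module k V] {ρ : Representation k G V}
    {S : Set Ψ} (hSW : S ⊆ W) (hS : IsGClosed G S) (hTS : ¬ T ⊆ S) {v : V}
    (hv : ∀ g ∈ fixingSubgroup G S, ρ g v = v) : ρ.asAlgebraHom P v = 0 := by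
  rw [asAlgebraHom_eq_of_bp (Q := 0) ρ hv, map_zero, LinearMap.zero_apply]
  rw [hP.kill S hSW hS hTS, map_zero, LinearMap.zero_apply]

theorem coeff_base :
    ((permRep k (fixingSubgroup G T)).asAlgebraHom P (bp k _)).coeff (QuotientGroup.mk 1) = 1 := by
  classical
  rw [coeff_asAlgebraHom_permRep, ← hP.weight_eq]
  refine weight_congr fun g hg => ?_
  rw [bp, MonoidAlgebra.coeff_single, Finsupp.single_apply, ind]
  refine if_congr ?_ rfl rfl
  change QuotientGroup.mk 1 = QuotientGroup.mk (g⁻¹ * 1) ↔ _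
  rw [QuotientGroup.eq]
  simp

theorem coeff_eq_zero (hTW : T ⊆ W) {s : Orb G T} (hs : img s ⊆ W) (h1 : s ≠ QuotientGroup.mk 1) :
    ((permRep k (fixingSubgroup G T)).asAlgebraHom P (bp k _)).coeff s = 0 := by
  classical
  rw [coeff_asAlgebraHom_permRep, weight, Finsupp.sum]
  refine Finset.sum_eq_zero fun g hg => ?_
  rw [bp, MonoidAlgebra.coeff_single, Finsupp.single_apply, if_neg, mul_zero]
  intro h
  have h2 : s = QuotientGroup.mk g := by
    rw [eq_inv_smul_iff] at h
    rw [← h]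
    exact congrArg QuotientGroup.mk (mul_one g)
  refine h1 (h2.trans (orb_mk_eq_iff.2 fun t ht => ?_))
  rw [one_smul]
  refine hP.movesOff g hg t (hTW ht) (hs ?_)
  rw [h2, img_mk]
  exact ⟨t, ht, rfl⟩

variable (hT : T.Finite) (hTc : IsGClosed G T)

include hT hTc

/-- The image of `s` is closed with as many points as `T`, so if it differs from `T` it does not
contain `T`, and `P` kills the vectors fixed by its stabilizer. -/
theorem apply_single_eq_zero {s : Orb G T} (hs : img s ⊆ W) (hsT : ¬ img s ⊆ T) (c : k) :
    (permRep k (fixingSubgroup G T)).asAlgebraHom P (MonoidAlgebra.single s c) = 0 := by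
  induction s using QuotientGroup.induction_on with
  | H g =>
    rw [img_mk] at hs hsT
    refine hP.apply_eq_zero hs (hTc.image g) (fun h => hsT ?_) fun f hf => ?_
    · exact (Set.eq_of_subset_of_ncard_le h
        (Set.ncard_image_of_injective T (MulAction.injective g)).le (hT.image _)).ge
    · rw [permRep_single]
      congr 1
      refine orb_mk_eq_iff.2 fun t ht => ?_
      change (f * g) • t = g • t
      rw [mul_smul]
      exact mem_fix.1 hf (g • t) ⟨t, ht, rfl⟩

/-- Only the embeddings of `T` onto itself survive `P`. These are the `Aut(T)`-translates of the
base point, and `P` commutes with `Aut(T)`. -/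
theorem apply_eq_sum [Fintype (AutT G T)] {x : k[Orb G T]} (hx : x ∈ supp k T W) :
    (permRep k (fixingSubgroup G T)).asAlgebraHom P x =
      ∑ a : AutT G T, x.coeff (a • (QuotientGroup.mk 1 : Orb G T)) •
        weylRep k _ a ((permRep k (fixingSubgroup G T)).asAlgebraHom P (bp k _)) := by
  classical
  have h1 : ∀ a : AutT G T, x.coeff (a • (QuotientGroup.mk 1 : Orb G T)) •
      weylRep k _ a ((permRep k (fixingSubgroup G T)).asAlgebraHom P (bp k _)) =
      (permRep k (fixingSubgroup G T)).asAlgebraHom P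
        (MonoidAlgebra.single (a • (QuotientGroup.mk 1 : Orb G T))
          (x.coeff (a • (QuotientGroup.mk 1 : Orb G T)))) := by
    intro a
    rw [← weylMap_apply, asAlgebraHom_intertwining, weylMap_apply, bp, weylRep_single, ← map_smul]
    simp
  simp only [h1]
  rw [← Finset.sum_image (s := Finset.univ)
    (g := fun a : AutT G T => a • (QuotientGroup.mk 1 : Orb G T))
    (f := fun s => (permRep k (fixingSubgroup G T)).asAlgebraHom P
        (MonoidAlgebra.single s (x.coeff s))) fun a _ b _ h => weyl_smul_base_injective h]
  conv_lhs => rw [← MonoidAlgebra.sum_coeff_single x, Finsupp.sum, map_sum]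
  set I := Finset.univ.image fun a : AutT G T => a • (QuotientGroup.mk 1 : Orb G T)
  refine (Finset.sum_subset (Finset.inter_subset_left (s₂ := I)) fun s hs hs' => ?_).symm.trans
    (Finset.sum_subset (Finset.inter_subset_right (s₁ := x.coeff.support)) fun s hs hs' => ?_)
  · refine hP.apply_single_eq_zero hT hTc (hx s (Finsupp.mem_support_iff.1 hs)) (fun h => hs' ?_) _
    obtain ⟨a, rfl⟩ := exists_weyl_smul_base hT hTc h
    exact Finset.mem_inter.2 ⟨hs, Finset.mem_image_of_mem _ (Finset.mem_univ a)⟩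
  · have : x.coeff s = 0 := by
      by_contra h
      exact hs' (Finset.mem_inter.2 ⟨Finsupp.mem_support_iff.2 h, hs⟩)
    rw [this]; simp

-- No element of the support of `P` sends the base embedding to another embedding with image in `W`.
-- So the translates of `e` by `Aut(T)` have distinct leading embeddings, and coefficients can be
-- read off.
omit hT in
theorem coeff_weyl (hTW : T ⊆ W) [DecidableEq (AutT G T)] (a : AutT G T) :
    (weylRep k _ a ((permRep k (fixingSubgroup G T)).asAlgebraHom P (bp k _))).coeff
      (QuotientGroup.mk 1 : Orb G T) = if a = 1 then 1 else 0 := by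
  rw [Representation.coeff_ofMulAction]
  split_ifs with h
  · rw [h, inv_one, one_smul, hP.coeff_base]
  · refine hP.coeff_eq_zero hTW ?_ fun h' => h ?_
    · rw [img_weyl_smul hTc, img_mk]; simpa using hTW
    · have h2 : a⁻¹ • (QuotientGroup.mk 1 : Orb G T) =
          (1 : AutT G T) • (QuotientGroup.mk 1 : Orb G T) := by rw [h', one_smul]
      exact inv_eq_one.1 (weyl_smul_base_injective h2)

theorem coeff_base_apply (hTW : T ⊆ W) {x : k[Orb G T]} (hx : x ∈ supp k T W) :
    ((permRep k (fixingSubgroup G T)).asAlgebraHom P x).coeff (QuotientGroup.mk 1) =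
      x.coeff (QuotientGroup.mk 1) := by
  classical
  have := finite_autT hT hTc
  let _ := Fintype.ofFinite (AutT G T)
  rw [hP.apply_eq_sum hT hTc hx, MonoidAlgebra.coeff_sum, Finsupp.finsetSum_apply,
    Finset.sum_eq_single 1]
  · rw [MonoidAlgebra.coeff_smul_apply, hP.coeff_weyl hTc hTW, if_pos rfl, one_smul, smul_eq_mul,
      mul_one]
  · intro a _ ha
    rw [MonoidAlgebra.coeff_smul_apply, hP.coeff_weyl hTc hTW, if_neg ha, smul_zero]
  · simp

variable [CharZero k] (hG : IsGood G)

include hG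

theorem base_mem_VTk (hTW : T ⊆ W) :
    (permRep k (fixingSubgroup G T)).asAlgebraHom P (bp k _) ∈ VTk G k T := by
  refine (mem_VTk_iff hG k hT hTc _).2 fun T' hT' h => ?_
  rw [asAlgebraHom_intertwining, res_bp]
  exact hP.kill T' (h.1.trans hTW) hT' h.2

theorem apply_mem_VTk (hTW : T ⊆ W) {x : k[Orb G T]} (hx : x ∈ supp k T W) :
    (permRep k (fixingSubgroup G T)).asAlgebraHom P x ∈ VTk G k T := by
  have := finite_autT hT hTc
  let _ := Fintype.ofFinite (AutT G T)
  rw [hP.apply_eq_sum hT hTc hx]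
  exact Submodule.sum_mem (VTk G k T).toSubmodule fun a _ =>
    Submodule.smul_mem (VTk G k T).toSubmodule _
      (VTk_weyl_stable G k T a (hP.base_mem_VTk hT hTc hG hTW))

end IsKey

theorem exists_isKey [CharZero k] (hG : IsGood G) {T W : Set Ψ} (hT : IsGClosed G T)
    (hW : IsGClosed G W) (hWf : W.Finite) (hTW : T ⊆ W) : ∃ P : k[G], IsKey T W P := by
  obtain ⟨P, h1, h2, h3⟩ := exists_key_operator hG k hT hW hWf hTW
  exact ⟨P, h1, h2, h3⟩

theorem exists_translate_coeff_ne_zero {T : Set Ψ} {x : k[Orb G T]} (hx : x ≠ 0) :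
    ∃ g : G, (permRep k (fixingSubgroup G T) g x).coeff (QuotientGroup.mk 1) ≠ 0 := by
  have : ∃ s, x.coeff s ≠ 0 := by
    by_contra! h
    exact hx (MonoidAlgebra.coeff_injective (Finsupp.ext h))
  obtain ⟨s, hs⟩ := this
  induction s using QuotientGroup.induction_on with
  | H g =>
    refine ⟨g⁻¹, ?_⟩
    rw [Representation.coeff_ofMulAction, inv_inv]
    change x.coeff (QuotientGroup.mk (g * 1)) ≠ 0
    rwa [mul_one]

variable [CharZero k] (hG : IsGood G) {T : Set Ψ} (hT : T.Finite) (hTc : IsGClosed G T)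

include hG hT hTc

/-- After a translation, the coefficient of a given nonzero element at the base point is nonzero. A
key operator keeps this coefficient and lands in `V_T ⊗ k`. -/
theorem isEssential_VTk : IsEssential (VTk G k T) := by
  intro B hB
  obtain ⟨x, hxB, hx⟩ := subrep_ne_bot_iff.1 hB
  obtain ⟨g, hg⟩ := exists_translate_coeff_ne_zero hx
  set y := permRep k (fixingSubgroup G T) g x
  obtain ⟨W, hWf, hW, hTW, hyW⟩ := exists_supp hG hT hT (Submodule.fg_span_singleton y)
  have hy := hyW (Submodule.mem_span_singleton_self y)
  obtain ⟨P, hP⟩ := exists_isKey (k := k) hG hTc hW hWf hTW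
  refine subrep_ne_bot_iff.2 ⟨(permRep k (fixingSubgroup G T)).asAlgebraHom P y,
    ⟨hP.apply_mem_VTk hT hTc hG hTW hy, asAlgebraHom_mem B P (B.apply_mem_toSubmodule g hxB)⟩, ?_⟩
  intro h
  rw [← hP.coeff_base_apply hT hTc hTW hy, h] at hg
  exact hg rfl

/-- An element of `V_T ⊗ k` is determined by its coefficients at the embeddings with image in `W`
if it is invariant under enough elements of `G_W`. -/
theorem eq_zero_of_mem_VTk {W Z : Set Ψ} (hWf : W.Finite) (hW : IsGClosed G W) (hZf : Z.Finite)
    (hZ : IsGClosed G Z) (hWZ : W ⊆ Z) {z : k[Orb G T]} (hz : z ∈ VTk G k T)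
    (hzZ : z ∈ supp k T Z) (hzW : ∀ s, img s ⊆ W → z.coeff s = 0)
    (hinv : ∀ h ∈ fixingSubgroup G W, (∀ w ∈ Z, h • w ∈ Z) →
      permRep k (fixingSubgroup G T) h z = z) : z = 0 := by
  classical
  by_contra hne
  -- `L s` is the part of `T` that `s` sends into `W`. An `s` in the support with the largest `L s`
  -- leads to a contradiction: all terms of the support restricting to `s` on `L s` turn out to have
  -- the coefficient of `s`, while their sum vanishes.
  let L : Orb G T → Set Ψ := fun s => {t | ∃ h : t ∈ T, ev s ⟨t, h⟩ ∈ W}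
  have hLT : ∀ s, L s ⊆ T := fun s t ht => ht.1
  have hLmk : ∀ g : G, L (QuotientGroup.mk g) = T ∩ (g • ·) ⁻¹' W := by
    intro g
    ext t
    simp [L]
  have hLc : ∀ s, IsGClosed G (L s) := by
    intro s
    induction s using QuotientGroup.induction_on with
    | H g => rw [hLmk]; exact hTc.inter (hW.preimage g)
  have hsne : z.coeff.support.Nonempty := by
    rw [Finsupp.support_nonempty_iff]
    exact fun h => hne (MonoidAlgebra.coeff_injective h)
  obtain ⟨s, hs, hmax⟩ := z.coeff.support.exists_max_image (fun s => (L s).ncard) hsne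
  have hLs : L s ⊂ T := by
    refine (hLT s).ssubset_of_ne fun h => Finsupp.mem_support_iff.1 hs (hzW s ?_)
    rintro _ ⟨t, rfl⟩
    exact (h.ge t.2).2
  have h0 := (mem_VTk_iff hG k hT hTc z).1 hz (L s) (hLc s) hLs
  have h1 : (Finsupp.mapDomain (resOrb hLs.1) z.coeff) (resOrb hLs.1 s) = 0 := by
    rw [← coeff_res, h0]; rfl
  rw [Finsupp.mapDomain, Finsupp.sum_apply, Finsupp.sum] at h1
  simp only [Finsupp.single_apply] at h1
  rw [← Finset.sum_filter, Finset.sum_congr rfl (g := fun _ => z.coeff s), Finset.sum_const,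
    ← Nat.cast_smul_eq_nsmul k, smul_eq_mul, mul_eq_zero] at h1
  · rcases h1 with h1 | h1
    · rw [Nat.cast_eq_zero, Finset.card_eq_zero] at h1
      have : s ∈ z.coeff.support.filter fun r => resOrb hLs.1 r = resOrb hLs.1 s :=
        Finset.mem_filter.2 ⟨hs, rfl⟩
      rw [h1] at this
      exact absurd this (Finset.notMem_empty s)
    · exact Finsupp.mem_support_iff.1 hs h1
  · intro r hr
    obtain ⟨hr, hrs⟩ := Finset.mem_filter.1 hr
    have hev : ∀ t (ht : t ∈ L s), ev r ⟨t, hLs.1 ht⟩ = ev s ⟨t, hLs.1 ht⟩ := by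
      intro t ht
      have := congrFun (congrArg ev hrs) ⟨t, ht⟩
      rwa [ev_resOrb, ev_resOrb] at this
    have hLr : L r = L s := by
      symm
      refine Set.eq_of_subset_of_ncard_le ?_ (hmax r hr) (hT.subset (hLT r))
      rintro t ht
      exact ⟨hLs.1 ht, by rw [hev t ht]; exact ht.2⟩
    have hrZ := hzZ r (Finsupp.mem_support_iff.1 hr)
    have hsZ := hzZ s (Finsupp.mem_support_iff.1 hs)
    -- By maximality `r` and `s` send the same part of `T` into `W`, and agree on it. Amalgamation
    -- then carries `s` to `r` while fixing `W`, and the extension axiom makes the element preserve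
    -- `Z`, as the invariance hypothesis demands.
    have key : ∃ h ∈ fixingSubgroup G W, (∀ w ∈ Z, h • w ∈ Z) ∧ h • s = r := by
      clear hmax h0 h1 hrs
      induction s using QuotientGroup.induction_on with
      | H g =>
        induction r using QuotientGroup.induction_on with
        | H g' =>
          rw [img_mk] at hrZ hsZ
          simp only [ev_mk] at hev
          rw [hLmk, hLmk] at hLr
          obtain ⟨h₁, h₁W, h₁g⟩ := hG.amalgam W ((g • ·) '' T) hW hWf (hTc.image g) (hT.image _)
            (g' * g⁻¹) (by
              rintro _ ⟨t, ht, rfl⟩ h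
              simp only [mul_smul, inv_smul_smul] at h
              exact (hLr.le ⟨ht, h⟩).2) (by
              rintro _ ⟨t, ht, rfl⟩ h
              simp only [mul_smul, inv_smul_smul]
              exact hev t (by rw [hLmk]; exact ⟨ht, h⟩))
          have h₁Z : ∀ x ∈ cl G (W ∪ (g • ·) '' T), h₁ • x ∈ Z := by
            have : cl G (W ∪ (g • ·) '' T) ⊆ (h₁ • ·) ⁻¹' Z := by
              refine cl_subset (hZ.preimage h₁) ?_
              rintro x (hx | ⟨t, ht, rfl⟩)
              · change h₁ • x ∈ Z
                rw [h₁W x hx]; exact hWZ hx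
              · change h₁ • (g • t) ∈ Z
                rw [h₁g _ ⟨t, ht, rfl⟩]
                simp only [mul_smul, inv_smul_smul]
                exact hrZ ⟨t, ht, rfl⟩
            exact this
          obtain ⟨h, hh, hhZ⟩ := hG.extend _ Z (isGClosed_cl _) hZ hZf
            (cl_subset hZ (Set.union_subset hWZ hsZ)) h₁ h₁Z
          refine ⟨h, mem_fix.2 fun w hw => ?_, hhZ, orb_mk_eq_iff.2 fun t ht => ?_⟩
          · rw [hh w (subset_cl _ (Or.inl hw)), h₁W w hw]
          · change (h * g) • t = g' • t
            rw [mul_smul, hh _ (subset_cl _ (Or.inr ⟨t, ht, rfl⟩)), h₁g _ ⟨t, ht, rfl⟩]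
            simp only [mul_smul, inv_smul_smul]
    obtain ⟨h, hhW, hhZ, hhs⟩ := key
    rw [← hinv h hhW hhZ, Representation.coeff_ofMulAction, ← hhs, inv_smul_smul, hinv h hhW hhZ]

/-- The elements of `V_T ⊗ k` supported on the embeddings with image in `W` are combinations of
translates of a single element. -/
theorem exists_expansion {W : Set Ψ} (hWf : W.Finite) (hW : IsGClosed G W) (hTW : T ⊆ W) {P : k[G]}
    (hP : IsKey T W P) :
    ∃ (X : Finset (Orb G T)) (R : Orb G T → k[G]), ∀ v ∈ VTk G k T, v ∈ supp k T W →
      v = ∑ s ∈ X, v.coeff s • (permRep k (fixingSubgroup G T)).asAlgebraHom (R s)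
        ((permRep k (fixingSubgroup G T)).asAlgebraHom P (bp k _)) := by
  classical
  set e := (permRep k (fixingSubgroup G T)).asAlgebraHom P (bp k _)
  have hg : ∀ s : Orb G T, ∃ g : G, img s ⊆ W →
      s = QuotientGroup.mk g ∧ ∀ w ∈ W, g • w ∈ W := by
    intro s
    by_cases hs : img s ⊆ W
    · induction s using QuotientGroup.induction_on with
      | H g =>
        rw [img_mk] at hs
        obtain ⟨h, h1, h2⟩ := hG.extend T W hTc hW hWf hTW g fun t ht => hs ⟨t, ht, rfl⟩
        exact ⟨h, fun _ => ⟨orb_mk_eq_iff.2 fun t ht => (h1 t ht).symm, h2⟩⟩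
    · exact ⟨1, fun h => absurd h hs⟩
  choose g hg using hg
  let X := (finite_setOf_img_subset (G := G) hT hWf).toFinset
  have hX : ∀ s, s ∈ X ↔ img s ⊆ W := fun s => Set.Finite.mem_toFinset _
  let M : Submodule k k[Orb G T] := Submodule.span k
    ((X.image fun s => permRep k (fixingSubgroup G T) (g s) e : Finset k[Orb G T]) : Set k[Orb G T])
  obtain ⟨Z, hZf, hZ, hWZ, hMZ⟩ := exists_supp hG hT hWf (M := M) ⟨_, rfl⟩
  -- The difference `y` below vanishes on embeddings into `W`, and averaging over elements fixing
  -- `W` preserves this while providing the invariance needed to conclude `A y = 0`. Since `A v =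
  -- v`, applying `A` to the first guess gives the exact expansion.
  obtain ⟨A, hA1, hA2, hA3⟩ := exists_averaging_operator k W (G := G) hZf
  refine ⟨X, fun s => A * MonoidAlgebra.single (g s) 1, fun v hv hvW => ?_⟩
  set y := (∑ s ∈ X, v.coeff s • permRep k (fixingSubgroup G T) (g s) e) - v
  have hyZ : y ∈ supp k T Z := by
    refine sub_mem (sum_mem fun s hs => Submodule.smul_mem _ _ (hMZ (Submodule.subset_span ?_)))
      (supp_mono hWZ hvW)
    exact Finset.mem_coe.2 (Finset.mem_image_of_mem _ hs)
  have hyV : y ∈ VTk G k T := by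
    refine Submodule.sub_mem (VTk G k T).toSubmodule
      (Submodule.sum_mem (VTk G k T).toSubmodule fun s hs =>
        Submodule.smul_mem (VTk G k T).toSubmodule _ ((VTk G k T).apply_mem_toSubmodule _ ?_)) hv
    exact hP.base_mem_VTk hT hTc hG hTW
  have hyW : ∀ r, img r ⊆ W → y.coeff r = 0 := by
    intro r hr
    rw [MonoidAlgebra.coeff_sub, Finsupp.sub_apply, MonoidAlgebra.coeff_sum,
      Finsupp.finsetSum_apply, sub_eq_zero, Finset.sum_eq_single r]
    · rw [MonoidAlgebra.coeff_smul_apply, Representation.coeff_ofMulAction]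
      have : (g r)⁻¹ • r = QuotientGroup.mk 1 := by
        rw [inv_smul_eq_iff]
        exact (hg r hr).1.trans (congrArg QuotientGroup.mk (mul_one (g r))).symm
      rw [this, hP.coeff_base, smul_eq_mul, mul_one]
    · intro s hs hsr
      rw [hX] at hs
      rw [MonoidAlgebra.coeff_smul_apply, Representation.coeff_ofMulAction, hP.coeff_eq_zero hTW,
        smul_zero]
      · have hgW : (g s • ·) '' W = W := image_eq_of_subset hWf (by
          rintro _ ⟨w, hw, rfl⟩; exact (hg s hs).2 w hw)
        rw [img_smul]
        rintro _ ⟨x, hx, rfl⟩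
        obtain ⟨w, hw, hwx⟩ := hgW.ge (hr hx)
        simp only at hwx ⊢
        rw [← hwx, inv_smul_smul]
        exact hw
      · intro h
        rw [inv_smul_eq_iff] at h
        refine hsr ?_
        exact ((hg s hs).1.trans (congrArg QuotientGroup.mk (mul_one (g s))).symm).trans h.symm
    · intro hr'
      exact absurd ((hX r).2 hr) hr'
  have hfixZ : ∀ x ∈ supp k T Z, ∀ h ∈ fixingSubgroup G Z, permRep k (fixingSubgroup G T) h x = x :=
    fun x hx h hh => permRep_eq_self_of_mem_supp hh hx
  have hAy : (permRep k (fixingSubgroup G T)).asAlgebraHom A y = 0 := by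
    refine eq_zero_of_mem_VTk hG hT hTc hWf hW hZf hZ hWZ (asAlgebraHom_mem _ A hyV) ?_ ?_ ?_
    · rw [asAlgebraHom_apply_eq_sum]
      exact sum_mem fun u hu => Submodule.smul_mem _ _ (permRep_mem_supp (hA1 u hu).2 hyZ)
    · intro s hs
      rw [coeff_asAlgebraHom_permRep, weight, Finsupp.sum]
      refine Finset.sum_eq_zero fun u hu => ?_
      rw [hyW, mul_zero]
      rw [img_smul]
      rintro _ ⟨x, hx, rfl⟩
      simp only
      rw [mem_fix.1 (inv_mem (hA1 u hu).1) x (hs hx)]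
      exact hs hx
    · intro h hh hhZ
      have := asAlgebraHom_eq_of_bp (permRep k (fixingSubgroup G T)) (hfixZ y hyZ) (hA3 h hh hhZ).2
      rwa [asAlgebraHom_mul_apply, Representation.asAlgebraHom_single_one] at this
  have hAv : (permRep k (fixingSubgroup G T)).asAlgebraHom A v = v := by
    rw [asAlgebraHom_apply_eq_sum, Finsupp.sum, Finset.sum_congr rfl
      (g := fun u => A.coeff u • v) fun u hu => by
        rw [permRep_eq_self_of_mem_supp (hA1 u hu).1 hvW], ← Finset.sum_smul]
    have : ∑ u ∈ A.coeff.support, A.coeff u = 1 := by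
      rw [← hA2, weight, Finsupp.sum]
      simp
    rw [this, one_smul]
  rw [map_sub, sub_eq_zero, hAv, map_sum] at hAy
  refine hAy.symm.trans (Finset.sum_congr rfl fun s _ => ?_)
  rw [map_smul, asAlgebraHom_mul_apply, Representation.asAlgebraHom_single_one]

end Structure


/-! ### `V_{T,α}` is the smallest nonzero subrepresentation of `S_{T,α}`. -/

section Hom

variable {Ψ : Type*} {G : Subgroup (Equiv.Perm Ψ)} {k : Type*} [Field k] {T : Set Ψ}
  {Γ : Type*} [AddCommGroup Γ] [Module k Γ] (γ : Representation k (AutT G T) Γ)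

/-- Evaluation at a vector of `Γ`. -/
def evalS (x : Γ) : (S G γ).IntertwiningMap (permRep k (fixingSubgroup G T)) where
  toLinearMap :=
    { toFun := fun f => f x
      map_add' := fun _ _ => rfl
      map_smul' := fun _ _ => rfl }
  isIntertwining' _ := rfl

@[simp] theorem evalS_apply (x : Γ) (f : γ.IntertwiningMap (weylRep k (fixingSubgroup G T))) :
    evalS γ x f = f x := rfl

theorem asAlgebraHom_S_apply (P : k[G]) (f : γ.IntertwiningMap (weylRep k (fixingSubgroup G T)))
    (x : Γ) : (S G γ).asAlgebraHom P f x = (permRep k (fixingSubgroup G T)).asAlgebraHom P (f x) :=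
  asAlgebraHom_intertwining (evalS γ x) P f

section Average

variable [Fintype (AutT G T)]

/-- The average over `Aut(T)` of the map `x ↦ l x • v`. -/
def homAvg : Module.Dual k Γ →ₗ[k] k[Orb G T] →ₗ[k]
    γ.IntertwiningMap (weylRep k (fixingSubgroup G T)) :=
  LinearMap.mk₂ k (fun l v =>
    { toLinearMap := ∑ a : AutT G T, (l ∘ₗ γ a⁻¹).smulRight (weylRep k (fixingSubgroup G T) a v)
      isIntertwining' := fun b => by
        ext x : 1
        simp only [LinearMap.comp_apply, LinearMap.sum_apply, LinearMap.smulRight_apply, map_sum,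
          map_smul]
        refine Fintype.sum_equiv (Equiv.mulLeft b⁻¹) _ _ fun a => ?_
        simp only [Equiv.coe_mulLeft, ← Module.End.mul_apply, ← map_mul]
        simp })
    (fun l l' v => by
      ext x : 2
      simp [add_smul, Finset.sum_add_distrib])
    (fun c l v => by
      ext x : 2
      simp [mul_smul, Finset.smul_sum])
    (fun l v v' => by
      ext x : 2
      simp [Finset.sum_add_distrib])
    (fun c l v => by
      ext x : 2
      simp [Finset.smul_sum, smul_comm c])

theorem homAvg_apply (l : Module.Dual k Γ) (v : k[Orb G T]) (x : Γ) :
    homAvg γ l v x = ∑ a : AutT G T, l (γ a⁻¹ x) • weylRep k (fixingSubgroup G T) a v := by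
  change (∑ a : AutT G T, (l ∘ₗ γ a⁻¹).smulRight (weylRep k (fixingSubgroup G T) a v)) x = _
  simp

/-- `homAvg` is equivariant in the second argument. -/
def homAvgMap (l : Module.Dual k Γ) :
    (permRep k (fixingSubgroup G T)).IntertwiningMap (S G γ) where
  toLinearMap := homAvg γ l
  isIntertwining' g := by
    refine LinearMap.ext fun v => ?_
    ext x : 2
    change homAvg γ l (permRep k _ g v) x = permRep k _ g (homAvg γ l v x)
    simp only [homAvg_apply, map_sum, map_smul, permRep_weylRep_comm]

@[simp] theorem homAvgMap_apply (l : Module.Dual k Γ) (v : k[Orb G T]) :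
    homAvgMap γ l v = homAvg γ l v := rfl

variable {γ}

/-- Averaging a map that is already equivariant multiplies it by the order of `Aut(T)`. This turns a
decomposition of `f` into rank-one linear maps into one inside the equivariant maps. -/
theorem card_smul_eq_sum_homAvg {ι : Type*} (X : Finset ι) (l : ι → Module.Dual k Γ)
    (v : ι → k[Orb G T]) (f : γ.IntertwiningMap (weylRep k (fixingSubgroup G T)))
    (h : ∀ x, f x = ∑ i ∈ X, l i x • v i) :
    (Fintype.card (AutT G T) : k) • f = ∑ i ∈ X, homAvg γ (l i) (v i) := by
  ext x : 2
  change (Fintype.card (AutT G T) : k) • f x = (∑ i ∈ X, homAvg γ (l i) (v i)) x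
  rw [Representation.IntertwiningMap.sum_apply]
  simp only [homAvg_apply]
  rw [Finset.sum_comm, Finset.sum_congr rfl (g := fun _ => f x), Finset.sum_const,
    Finset.card_univ, Nat.cast_smul_eq_nsmul]
  intro a _
  simp only [← map_smul, ← map_sum]
  rw [← h, ← Representation.IntertwiningMap.isIntertwining, ← Module.End.mul_apply, ← map_mul,
    mul_inv_cancel, map_one, Module.End.one_apply]

end Average

/-- The coefficients of the values of a homomorphism at an element of `G/G_T`. -/
def coeffDual (f : γ.IntertwiningMap (weylRep k (fixingSubgroup G T))) (s : Orb G T) :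
    Module.Dual k Γ :=
  Finsupp.lapply s ∘ₗ (MonoidAlgebra.coeffLinearEquiv k).toLinearMap ∘ₗ f.toLinearMap

variable {γ}

@[simp] theorem coeffDual_apply (f : γ.IntertwiningMap (weylRep k (fixingSubgroup G T)))
    (s : Orb G T) (x : Γ) : coeffDual γ f s x = (f x).coeff s := rfl

theorem coeffDual_weyl (f : γ.IntertwiningMap (weylRep k (fixingSubgroup G T))) (a : AutT G T) :
    coeffDual γ f (a • QuotientGroup.mk 1) = coeffDual γ f (QuotientGroup.mk 1) ∘ₗ γ a⁻¹ := by
  ext x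
  rw [LinearMap.comp_apply, coeffDual_apply, coeffDual_apply,
    Representation.IntertwiningMap.isIntertwining, Representation.coeff_ofMulAction, inv_inv]

theorem fg_range [FiniteDimensional k Γ]
    (f : γ.IntertwiningMap (weylRep k (fixingSubgroup G T))) : (LinearMap.range f.toLinearMap).FG :=
  (Submodule.fg_top _).1 (Module.Finite.range f.toLinearMap).1

theorem IsKey.apply_eq_homAvg [Fintype (AutT G T)] {W : Set Ψ} {P : k[G]} (hP : IsKey T W P)
    (hT : T.Finite) (hTc : IsGClosed G T)
    {f : γ.IntertwiningMap (weylRep k (fixingSubgroup G T))} (hf : ∀ x, f x ∈ supp k T W) :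
    (S G γ).asAlgebraHom P f = homAvg γ (coeffDual γ f (QuotientGroup.mk 1))
      ((permRep k (fixingSubgroup G T)).asAlgebraHom P (bp k _)) := by
  ext x : 2
  change (S G γ).asAlgebraHom P f x = homAvg γ _ _ x
  rw [asAlgebraHom_S_apply, hP.apply_eq_sum hT hTc (hf x), homAvg_apply]
  refine Finset.sum_congr rfl fun a _ => ?_
  rw [← coeffDual_apply, coeffDual_weyl, LinearMap.comp_apply]

variable [CharZero k] (hG : IsGood G) (hT : T.Finite) (hTc : IsGClosed G T)

include hG hT hTc

/-- A key operator sends an element of `B` to `homAvg γ l e`, where `l` is its base coefficient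
functional. One nonzero `l` generates the dual of the irreducible `Γ`, so `B` contains `homAvg γ l
e` for every `l`. By `exists_expansion`, these generate all of `V G γ`. -/
theorem V_le (hγ : γ.IsIrreducible) {B : Subrepresentation (S G γ)} (hB : B ≠ ⊥) : V G γ ≤ B := by
  have := finite_autT hT hTc
  let _ := Fintype.ofFinite (AutT G T)
  have := finiteDimensional_of_isIrreducible hγ
  obtain ⟨f, hfB, hf⟩ := subrep_ne_bot_iff.1 hB
  obtain ⟨x, hx⟩ : ∃ x, f x ≠ 0 := by
    by_contra! h
    exact hf (DFunLike.ext _ _ h)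
  obtain ⟨g, hg⟩ := exists_translate_coeff_ne_zero hx
  set f' := S G γ g f
  have hf'B : f' ∈ B := B.apply_mem_toSubmodule g hfB
  have hl : coeffDual γ f' (QuotientGroup.mk 1) ≠ 0 := fun h => hg (LinearMap.congr_fun h x)
  intro v hv
  let n : AutT G T → G := fun a => (a.out : Subgroup.normalizer (fixingSubgroup G T : Set G))
  have hn : ∀ a : AutT G T, (n a)⁻¹ • (QuotientGroup.mk 1 : Orb G T) =
      a • (QuotientGroup.mk 1 : Orb G T) := by
    intro a
    conv_rhs => rw [← QuotientGroup.out_eq' a, weyl_smul_mk, one_mul]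
    exact congrArg QuotientGroup.mk (mul_one _)
  -- Translating by a representative of `a` in the normalizer composes the base coefficient
  -- functional with `γ a⁻¹`. There are finitely many translates, so a single `W` and a single `P`
  -- serve for all of them and for `v`.
  let f'' : AutT G T → γ.IntertwiningMap (weylRep k (fixingSubgroup G T)) :=
    fun a => S G γ (n a) f'
  have hf'' : ∀ a, coeffDual γ (f'' a) (QuotientGroup.mk 1) =
      coeffDual γ f' (QuotientGroup.mk 1) ∘ₗ γ a⁻¹ := by
    intro a
    rw [← coeffDual_weyl, ← hn]
    ext x
    rw [coeffDual_apply, coeffDual_apply, S_apply, Representation.coeff_ofMulAction]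
  obtain ⟨W, hWf, hW, hTW, hMW⟩ := exists_supp hG hT hT
    (M := (⨆ a, LinearMap.range (f'' a).toLinearMap) ⊔ LinearMap.range v.toLinearMap)
    ((Submodule.fg_iSup _ fun a => fg_range (f'' a)).sup (fg_range v))
  have hvW : ∀ x, v x ∈ supp k T W := fun x => hMW (Submodule.mem_sup_right ⟨x, rfl⟩)
  have hfW : ∀ a x, f'' a x ∈ supp k T W := fun a x =>
    hMW (Submodule.mem_sup_left (Submodule.mem_iSup_of_mem a ⟨x, rfl⟩))
  obtain ⟨P, hP⟩ := exists_isKey (k := k) hG hTc hW hWf hTW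
  set e := (permRep k (fixingSubgroup G T)).asAlgebraHom P (bp k _) with he
  have h1 : ∀ l : Module.Dual k Γ, homAvg γ l e ∈ B := by
    intro l
    have hl' : l ∈ (⊤ : Submodule k (Module.Dual k Γ)) := Submodule.mem_top
    rw [← span_functional_eq_top hγ hl] at hl'
    have : Submodule.span k (Set.range fun a => coeffDual γ f' (QuotientGroup.mk 1) ∘ₗ γ a) ≤
        B.toSubmodule.comap ((homAvg γ).flip e) := by
      rw [Submodule.span_le]
      rintro _ ⟨a, rfl⟩
      change homAvg γ (coeffDual γ f' (QuotientGroup.mk 1) ∘ₗ γ a) e ∈ B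
      rw [← inv_inv a, ← hf'', he, ← hP.apply_eq_homAvg hT hTc (hfW _)]
      exact asAlgebraHom_mem B P (B.apply_mem_toSubmodule _ hf'B)
    exact this hl'
  obtain ⟨X, R, hR⟩ := exists_expansion hG hT hTc hWf hW hTW hP
  have h2 := card_smul_eq_sum_homAvg X (coeffDual γ v) _ v fun x => hR (v x) (hv x) (hvW x)
  have h3 : (Fintype.card (AutT G T) : k) • v ∈ B := by
    rw [h2]
    refine Submodule.sum_mem B.toSubmodule fun s _ => ?_
    rw [← homAvgMap_apply, asAlgebraHom_intertwining]
    exact asAlgebraHom_mem B _ (h1 _)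
  have h4 : (Fintype.card (AutT G T) : k) ≠ 0 := Nat.cast_ne_zero.2 Fintype.card_ne_zero
  exact (Submodule.smul_mem_iff B.toSubmodule h4).1 h3

/-- The base coefficient of `homAvg γ l e` at `x` is `l x`. -/
theorem V_ne_bot (hγ : γ.IsIrreducible) : V G γ ≠ ⊥ := by
  classical
  have := finite_autT hT hTc
  let _ := Fintype.ofFinite (AutT G T)
  obtain ⟨x, hx⟩ := exists_ne_zero_of_isIrreducible hγ
  obtain ⟨l, hl⟩ : ∃ l : Module.Dual k Γ, l x ≠ 0 := by
    by_contra! h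
    exact hx ((Module.forall_dual_apply_eq_zero_iff k x).1 h)
  obtain ⟨P, hP⟩ := exists_isKey (k := k) hG hTc hTc hT subset_rfl
  refine subrep_ne_bot_iff.2 ⟨homAvg γ l
    ((permRep k (fixingSubgroup G T)).asAlgebraHom P (bp k _)), fun y => ?_, fun h => ?_⟩
  · rw [homAvg_apply]
    exact Submodule.sum_mem (VTk G k T).toSubmodule fun a _ =>
      Submodule.smul_mem (VTk G k T).toSubmodule _
        (VTk_weyl_stable G k T a (hP.base_mem_VTk hT hTc hG subset_rfl))
  · have h1 := congrArg (fun f => (f x).coeff (QuotientGroup.mk 1)) h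
    change (homAvg γ l _ x).coeff _ = 0 at h1
    rw [homAvg_apply, MonoidAlgebra.coeff_sum, Finsupp.finsetSum_apply,
      Finset.sum_eq_single 1] at h1
    · rw [MonoidAlgebra.coeff_smul_apply, hP.coeff_weyl hTc subset_rfl, if_pos rfl] at h1
      refine hl ?_
      simpa using h1
    · intro a _ ha
      rw [MonoidAlgebra.coeff_smul_apply, hP.coeff_weyl hTc subset_rfl, if_neg ha, smul_zero]
    · simp

theorem isAtom_V (hγ : γ.IsIrreducible) : IsAtom (V G γ) :=
  ⟨V_ne_bot hG hT hTc hγ, fun B hB => by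
    by_contra h
    exact hB.not_ge (V_le hG hT hTc hγ h)⟩

theorem isIrreducible_VRep (hγ : γ.IsIrreducible) :
    Representation.IsIrreducible (V := (V G γ).toSubmodule) (VRep G γ) :=
  (isIrreducible_iff_isAtom _).2 (isAtom_V hG hT hTc hγ)

theorem isEssential_V (hγ : γ.IsIrreducible) : IsEssential (V G γ) := fun B hB => by
  rw [inf_eq_left.2 (V_le hG hT hTc hγ hB)]
  exact V_ne_bot hG hT hTc hγ

/-- Two nonzero subrepresentations both contain `V G γ`, so they cannot be disjoint. -/
theorem isIndecomposable_S (hγ : γ.IsIrreducible) : IsIndecomposable (S G γ) := by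
  obtain ⟨v, hv, hv0⟩ := subrep_ne_bot_iff.1 (V_ne_bot hG hT hTc hγ)
  refine ⟨⟨v, 0, hv0⟩, fun A B h => ?_⟩
  by_contra! h'
  have := h.disjoint.le_bot
    ⟨V_le hG hT hTc hγ h'.1 hv, V_le hG hT hTc hγ h'.2 hv⟩
  exact hv0 this

omit hG in
/-- A subspace of `k[G/G_T]` contains `V_T ⊗ k` if it contains the values of all the elements of
`V_{T,α}`. -/
theorem VTk_le {Q : Submodule k k[Orb G T]}
    (hQ : ∀ (n : ℕ) (δ : Representation k (AutT G T) (Fin n → k)), δ.IsIrreducible →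
      ∀ f ∈ V G δ, ∀ x, f x ∈ Q) : (VTk G k T).toSubmodule ≤ Q := by
  have := finite_autT hT hTc
  let w := weylRep k (fixingSubgroup G T)
  let N : Subrepresentation w :=
    { toSubmodule := (VTk G k T).toSubmodule
      apply_mem_toSubmodule := fun a _ hv => VTk_weyl_stable G k T a hv }
  have : NeZero (Nat.card (AutT G T) : k) := ⟨Nat.cast_ne_zero.2 Nat.card_pos.ne'⟩
  have hss : IsSemisimpleModule k[AutT G T] w.asModule := inferInstance
  have hN := IsSemisimpleModule.sSup_simples_le N.asSubmodule
  intro v hv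
  have hv' : (v : w.asModule) ∈ N.asSubmodule := hv
  rw [← hN, sSup_eq_iSup'] at hv'
  refine Submodule.iSup_induction _ (motive := fun v : w.asModule => (show k[Orb G T] from v) ∈ Q)
    hv' ?_ Q.zero_mem fun _ _ => Q.add_mem
  rintro ⟨m, hm, hmN⟩ y hy
  let M : Subrepresentation w := Subrepresentation.ofSubmodule' m
  have hM : M.toRepresentation.IsIrreducible := by
    rw [isIrreducible_iff_isAtom]
    exact (Subrepresentation.subrepresentationSubmoduleOrderIso.isAtom_iff M).1
      (isSimpleModule_iff_isAtom.1 hm)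
  have := finiteDimensional_of_isIrreducible hM
  -- Passing to coordinate vectors keeps the representations of `Aut(T)` in the universe of `k`.
  obtain ⟨n, δ, ⟨e⟩⟩ := exists_coordinate_representation M.toRepresentation
  have := hQ n δ (isIrreducible_congr e hM) ((incl M).comp e.symm.toIntertwiningMap)
    (fun x => hmN (e.symm x).2) (e ⟨y, hy⟩)
  change ((e.symm (e ⟨y, hy⟩) : M.toSubmodule) : k[Orb G T]) ∈ Q at this
  rwa [Representation.Equiv.symm_apply_apply] at this

end Hom


/-! ### Irreducible quotients, finite products and subquotients. -/

section Generic

variable {k G V W U : Type*} [Field k] [Group G] [AddCommGroup V] [Module k V]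
  [AddCommGroup W] [Module k W] [AddCommGroup U] [Module k U]
  {ρ : Representation k G V} {σ : Representation k G W} {τ : Representation k G U}

/-- A bijective intertwining map is an isomorphism. -/
def equivOfBijective (f : ρ.IntertwiningMap σ) (h : Function.Bijective f) : ρ.Equiv σ :=
  Representation.Equiv.mk (LinearEquiv.ofBijective f.toLinearMap h) fun g => by
    ext v
    exact f.isIntertwining _ _ g v

@[simp] theorem equivOfBijective_apply (f : ρ.IntertwiningMap σ) (h : Function.Bijective f)
    (v : V) : equivOfBijective f h v = f v := rfl

theorem injective_iff_eq_zero (f : ρ.IntertwiningMap σ) :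
    Function.Injective f ↔ ∀ v, f v = 0 → v = 0 :=
  injective_iff_map_eq_zero f

theorem surjective_of_ne_zero (hσ : σ.IsIrreducible) (f : ρ.IntertwiningMap σ) {v : V}
    (hv : f v ≠ 0) : Function.Surjective f := by
  intro w
  have : subMap f ⊤ = ⊤ := (eq_bot_or_eq_top_of_isIrreducible hσ _).resolve_left
    (subrep_ne_bot_iff.2 ⟨f v, ⟨v, subrep_mem_top v, rfl⟩, hv⟩)
  obtain ⟨u, -, hu⟩ := mem_subMap.1 (this ▸ subrep_mem_top w : w ∈ subMap f ⊤)
  exact ⟨u, hu⟩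

theorem injective_of_ne_zero (hρ : ρ.IsIrreducible) (f : ρ.IntertwiningMap σ) {v : V}
    (hv : f v ≠ 0) : Function.Injective f := by
  have : subComap f ⊥ = ⊥ := (eq_bot_or_eq_top_of_isIrreducible hρ _).resolve_right fun h =>
    hv (subrep_mem_bot.1 (mem_subComap.1 (h ▸ subrep_mem_top v : v ∈ subComap f ⊥)))
  refine (injective_iff_eq_zero f).2 fun u hu => ?_
  exact subrep_mem_bot.1 (this ▸ (mem_subComap.2 (subrep_mem_bot.2 hu)))

theorem nonempty_equiv_of_ne_zero (hρ : ρ.IsIrreducible) (hσ : σ.IsIrreducible)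
    (f : ρ.IntertwiningMap σ) {v : V} (hv : f v ≠ 0) : Nonempty (ρ.Equiv σ) :=
  ⟨equivOfBijective f ⟨injective_of_ne_zero hρ f hv, surjective_of_ne_zero hσ f hv⟩⟩

theorem isAtom_subMap (f : ρ.IntertwiningMap σ) {B : Subrepresentation ρ} (hB : IsAtom B) :
    subMap f B = ⊥ ∨ IsAtom (subMap f B) := by
  refine or_iff_not_imp_left.2 fun h => ⟨h, fun C hC => ?_⟩
  have h1 : subComap f C ⊓ B < B := by
    refine lt_of_le_of_ne inf_le_right fun h => hC.not_ge ?_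
    rintro _ ⟨v, hv, rfl⟩
    exact (h.ge hv).1
  have h2 := hB.2 _ h1
  refine subrep_eq_bot_iff.2 fun c hc => ?_
  obtain ⟨v, hv, rfl⟩ := hC.le hc
  have : v ∈ (⊥ : Subrepresentation ρ) := h2 ▸ ⟨hc, hv⟩
  rw [subrep_mem_bot.1 this, map_zero]

/-- A morphism that kills the kernel of a morphism to a semisimple representation extends. -/
theorem exists_extension_of_semisimple (hρ : ρ.IsSemisimpleRepresentation)
    (f : τ.IntertwiningMap ρ) (p : τ.IntertwiningMap σ) (h : ∀ u, f u = 0 → p u = 0) :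
    ∃ q : ρ.IntertwiningMap σ, ∀ u, q (f u) = p u := by
  rw [Representation.isSemisimpleRepresentation_iff_isSemisimpleModule_asModule] at hρ
  let F := Representation.IntertwiningMap.equivLinearMapAsModule τ ρ f
  let p' := Representation.IntertwiningMap.equivLinearMapAsModule τ σ p
  have hk : LinearMap.ker F ≤ LinearMap.ker p' := fun u hu => h u hu
  obtain ⟨q, hq⟩ := IsSemisimpleModule.extension_property ((LinearMap.ker F).liftQ F le_rfl)
    (LinearMap.ker_eq_bot.1 (Submodule.ker_liftQ_eq_bot _ _ _ le_rfl))
    ((LinearMap.ker F).liftQ p' hk)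
  refine ⟨(Representation.IntertwiningMap.equivLinearMapAsModule ρ σ).symm q, fun u => ?_⟩
  exact LinearMap.congr_fun hq (Submodule.Quotient.mk u)

/-- If an irreducible quotient of `τ` is a quotient of the image of `τ` in a finite product, then
it is a quotient of a subrepresentation of the image in one of the factors. -/
theorem exists_factor {ι : Type*} {M : ι → Type*} [∀ i, AddCommGroup (M i)] [∀ i, Module k (M i)]
    {μ : ∀ i, Representation k G (M i)} (s : Finset ι) :
    ∀ (A : Subrepresentation τ) (f : ∀ i, τ.IntertwiningMap (μ i)) (p : τ.IntertwiningMap σ),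
    (∃ u ∈ A, p u ≠ 0) → (∀ u ∈ A, (∀ i ∈ s, f i u = 0) → p u = 0) →
    ∃ i ∈ s, ∃ B : Subrepresentation τ, (∃ u ∈ B, p u ≠ 0) ∧ ∀ u ∈ B, f i u = 0 → p u = 0 := by
  classical
  induction s using Finset.induction_on with
  | empty =>
    rintro A f p ⟨u, hu, hpu⟩ h
    exact absurd (h u hu (by simp)) hpu
  | insert i s _ ih =>
    intro A f p hA h
    -- Either the factors in `s` already control `p`, or the part of `A` that they kill is not
    -- killed by `p`. On that part the remaining factor `i` controls `p`.
    by_cases hp : ∀ u ∈ A, (∀ j ∈ s, f j u = 0) → p u = 0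
    · obtain ⟨j, hj, B, hB⟩ := ih A f p hA hp
      exact ⟨j, Finset.mem_insert_of_mem hj, B, hB⟩
    · push Not at hp
      obtain ⟨u, huA, hu, hpu⟩ := hp
      let K : Subrepresentation τ :=
        { toSubmodule := A.toSubmodule ⊓ ⨅ j ∈ s, LinearMap.ker (f j).toLinearMap
          apply_mem_toSubmodule := by
            rintro g v ⟨hvA, hv⟩
            refine ⟨A.apply_mem_toSubmodule g hvA, ?_⟩
            simp only [SetLike.mem_coe, Submodule.mem_iInf, LinearMap.mem_ker,
              Representation.IntertwiningMap.toLinearMap_apply] at hv ⊢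
            intro j hj
            rw [Representation.IntertwiningMap.isIntertwining, hv j hj, map_zero] }
      have hK : ∀ v, v ∈ K ↔ v ∈ A ∧ ∀ j ∈ s, f j v = 0 := by
        intro v
        change v ∈ A.toSubmodule ⊓ _ ↔ _
        simp only [Submodule.mem_inf, Submodule.mem_iInf, LinearMap.mem_ker,
          Representation.IntertwiningMap.toLinearMap_apply]
        rfl
      refine ⟨i, Finset.mem_insert_self i s, K, ⟨u, (hK u).2 ⟨huA, hu⟩, hpu⟩, fun v hv hiv => ?_⟩
      obtain ⟨hvA, hv⟩ := (hK v).1 hv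
      refine h v hvA fun j hj => ?_
      rcases Finset.mem_insert.1 hj with rfl | hj
      · exact hiv
      · exact hv j hj

/-- The projection of `B` to `B / A`. -/
def toSubquotient (A B : Subrepresentation ρ) :
    B.toRepresentation.IntertwiningMap (subquotient A B) where
  toLinearMap := Submodule.mkQ _
  isIntertwining' _ := rfl

theorem toSubquotient_surjective (A B : Subrepresentation ρ) :
    Function.Surjective (toSubquotient A B) := Submodule.mkQ_surjective _

theorem nonempty_subquotient_equiv {A B : Subrepresentation ρ}
    (p : B.toRepresentation.IntertwiningMap σ) (hp : Function.Surjective p)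
    (h : ∀ b : B.toSubmodule, p b = 0 ↔ (b : V) ∈ A) : Nonempty ((subquotient A B).Equiv σ) := by
  have hk : LinearMap.ker p.toLinearMap = A.toSubmodule.submoduleOf B.toSubmodule :=
    Submodule.ext fun b => h b
  refine ⟨Representation.Equiv.mk ((Submodule.quotEquivOfEq _ _ hk.symm).trans
    (p.toLinearMap.quotKerEquivOfSurjective hp)) fun g => ?_⟩
  refine LinearMap.ext fun x => ?_
  obtain ⟨b, rfl⟩ := Submodule.mkQ_surjective _ x
  exact p.isIntertwining _ _ g b

end Generic

/-! ### `V_T ⊗ k` is the socle of `k[G/G_T]`, and it is cyclic. -/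

section Socle

variable {Ψ : Type*} {G : Subgroup (Equiv.Perm Ψ)} {k : Type*} [Field k] [CharZero k]
  (hG : IsGood G) {T : Set Ψ} (hT : T.Finite) (hTc : IsGClosed G T)

include hG hT hTc

/-- `V_T ⊗ k` is generated by the images of the simple `V_{T,δ}` under evaluation at vectors, so it
lies in the sum of the simple submodules. -/
theorem isSemisimple_VTk : (VTk G k T).toRepresentation.IsSemisimpleRepresentation := by
  rw [isSemisimple_iff_asSubmodule]
  let M := (permRep k (fixingSubgroup G T)).asModule
  let N : Submodule k[G] M := ⨆ m ∈ {m : Submodule k[G] M | IsAtom m}, m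
  have hN : IsSemisimpleModule k[G] N := by
    refine isSemisimpleModule_biSup_of_isSemisimpleModule_submodule
      (p := fun m : Submodule k[G] M => m) fun m hm => ?_
    have := isSimpleModule_iff_isAtom.2 hm
    infer_instance
  have hle : (VTk G k T).asSubmodule ≤ N := by
    let e := Subrepresentation.subrepresentationSubmoduleOrderIso
      (ρ := permRep k (fixingSubgroup G T))
    have := VTk_le (Q := (e.symm N).toSubmodule) (k := k) hT hTc fun n δ hδ f hf x => by
      have hmem : f x ∈ subMap (evalS δ x) (V G δ) := ⟨f, hf, rfl⟩
      rcases isAtom_subMap (evalS δ x) (isAtom_V hG hT hTc hδ) with h | h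
      · rw [h, subrep_mem_bot] at hmem
        rw [hmem]
        exact Submodule.zero_mem _
      · have h2 : e (subMap (evalS δ x) (V G δ)) ≤ N :=
          le_biSup (fun m : Submodule k[G] M => m) ((e.isAtom_iff _).2 h)
        exact h2 hmem
    exact this
  have hinj := Submodule.inclusion_injective hle
  let F := Submodule.inclusion hle
  exact IsSemisimpleModule.of_injective (R := k[G]) (M := N) (N := (VTk G k T).asSubmodule) F hinj

theorem isSocle_VTk : IsSocle (VTk G k T) :=
  isSocle_of_essential_of_semisimple (isEssential_VTk hG hT hTc) (isSemisimple_VTk hG hT hTc)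

/-- `V_T ⊗ k` is generated by a single element. -/
theorem exists_generator : ∃ e ∈ VTk G k T, ∀ v ∈ VTk G k T,
    ∃ R : k[G], v = (permRep k (fixingSubgroup G T)).asAlgebraHom R e := by
  classical
  have := finite_autT hT hTc
  let _ := Fintype.ofFinite (AutT G T)
  obtain ⟨P₀, hP₀⟩ := exists_isKey (k := k) hG hTc hTc hT subset_rfl
  set e := (permRep k (fixingSubgroup G T)).asAlgebraHom P₀ (bp k _)
  refine ⟨e, hP₀.base_mem_VTk hT hTc hG subset_rfl, fun v hv => ?_⟩
  obtain ⟨W, hWf, hW, hTW, hMW⟩ := exists_supp hG hT hT (M := Submodule.span k {v} ⊔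
    Submodule.span k {e}) ((Submodule.fg_span_singleton v).sup (Submodule.fg_span_singleton e))
  have hvW := hMW (Submodule.mem_sup_left (Submodule.mem_span_singleton_self v))
  have heW := hMW (Submodule.mem_sup_right (Submodule.mem_span_singleton_self e))
  obtain ⟨P, hP⟩ := exists_isKey (k := k) hG hTc hW hWf hTW
  -- The operator `P` depends on `v`, but the generator must not. The coefficients of `e` at the
  -- embeddings of `T` onto itself are those of the base point, so `P` sends both to the same
  -- element.
  have h1 : (permRep k (fixingSubgroup G T)).asAlgebraHom P e =
      (permRep k (fixingSubgroup G T)).asAlgebraHom P (bp k _) := by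
    rw [hP.apply_eq_sum hT hTc heW, Finset.sum_eq_single 1]
    · rw [one_smul, hP₀.coeff_base, one_smul, map_one]
      rfl
    · intro a _ ha
      have := hP₀.coeff_weyl hTc subset_rfl a⁻¹
      rw [Representation.coeff_ofMulAction, inv_inv, if_neg (inv_ne_one.2 ha)] at this
      rw [this, zero_smul]
    · simp
  obtain ⟨X, R, hR⟩ := exists_expansion hG hT hTc hWf hW hTW hP
  refine ⟨∑ s ∈ X, v.coeff s • (R s * P), ?_⟩
  refine (hR v hv hvW).trans ?_
  rw [map_sum, LinearMap.sum_apply]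
  refine Finset.sum_congr rfl fun s _ => ?_
  rw [map_smul, LinearMap.smul_apply, asAlgebraHom_mul_apply, h1]

end Socle

/-! ### Finite length and simple subquotients of `k[G/G_T]`. -/

section FiniteLength

variable {Ψ : Type*} {G : Subgroup (Equiv.Perm Ψ)} (k : Type*) [Field k] [CharZero k]
  (hG : IsGood G)

include hG

/-- The joint restriction to all smaller closed sets has kernel `V_T ⊗ k`, which is semisimple and
cyclic, hence of finite length. Its target has finite length by induction. -/
theorem isFiniteLength_permRep {T : Set Ψ} (hT : T.Finite) (hTc : IsGClosed G T) :
    IsFiniteLength k[G] (permRep k (fixingSubgroup G T)).asModule := by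
  induction hn : T.ncard using Nat.strong_induction_on generalizing T with
  | _ n ih =>
    let ι := {T' : Set Ψ // IsGClosed G T' ∧ T' ⊂ T}
    have : Finite ι := (hT.finite_subsets.subset fun T' h => h.2.1 :
      {T' : Set Ψ | IsGClosed G T' ∧ T' ⊂ T}.Finite).to_subtype
    have hι : ∀ i : ι, IsNoetherian k[G] (permRep k (fixingSubgroup G i.1)).asModule ∧
        IsArtinian k[G] (permRep k (fixingSubgroup G i.1)).asModule := fun i =>
      isFiniteLength_iff_isNoetherian_isArtinian.1
        (ih _ (hn ▸ Set.ncard_lt_ncard i.2.2 hT) (hT.subset i.2.2.1) i.2.1 rfl)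
    have := fun i => (hι i).1
    have := fun i => (hι i).2
    let φ : (permRep k (fixingSubgroup G T)).asModule →ₗ[k[G]]
        ((i : ι) → (permRep k (fixingSubgroup G i.1)).asModule) :=
      LinearMap.pi fun i => Representation.IntertwiningMap.equivLinearMapAsModule _ _
        (res k i.2.2.1)
    have hss := (isSemisimple_iff_asSubmodule _).1 (isSemisimple_VTk (k := k) hG hT hTc)
    have hfg : Module.Finite k[G] (VTk G k T).asSubmodule := by
      obtain ⟨e, he, h⟩ := exists_generator (k := k) hG hT hTc
      refine ⟨⟨{⟨e, he⟩}, ?_⟩⟩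
      rw [Finset.coe_singleton, eq_top_iff]
      rintro ⟨v, hv⟩ -
      obtain ⟨R, hR⟩ := h v hv
      exact Submodule.mem_span_singleton.2 ⟨R, Subtype.ext hR.symm⟩
    have htfae := IsSemisimpleModule.finite_tfae (R := k[G]) (M := (VTk G k T).asSubmodule)
    have hN : IsNoetherian k[G] (VTk G k T).asSubmodule := (htfae.out 0 1).1 hfg
    have hA : IsArtinian k[G] (VTk G k T).asSubmodule := (htfae.out 0 2).1 hfg
    have hker : LinearMap.range (VTk G k T).asSubmodule.subtype = LinearMap.ker φ := by
      rw [Submodule.range_subtype]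
      ext x
      refine (mem_VTk_iff hG k hT hTc x).trans ?_
      rw [LinearMap.mem_ker, funext_iff]
      exact ⟨fun h i => h i.1 i.2.1 i.2.2, fun h T' h1 h2 => h ⟨T', h1, h2⟩⟩
    exact isFiniteLength_iff_isNoetherian_isArtinian.2
      ⟨isNoetherian_of_range_eq_ker (R := k[G])
        (M := (VTk G k T).asSubmodule) (N := (permRep k (fixingSubgroup G T)).asModule)
        (P := (i : ι) → (permRep k (fixingSubgroup G i.1)).asModule) _ φ hker, isArtinian_of_range_eq_ker (R := k[G])
        (M := (VTk G k T).asSubmodule) (N := (permRep k (fixingSubgroup G T)).asModule)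
        (P := (i : ι) → (permRep k (fixingSubgroup G i.1)).asModule) _ φ hker⟩

variable {k}

/-- The hypotheses say that the irreducible `σ` is a quotient of `f(B)`. They are phrased through
`τ` so that the induction can replace `f` by its composite with a restriction map. -/
theorem exists_equiv_VRep {T : Set Ψ} (hT : T.Finite) (hTc : IsGClosed G T) {W : Type*}
    [AddCommGroup W] [Module k W] {σ : Representation k G W} (hσ : σ.IsIrreducible) :
    ∀ {M : Type*} [AddCommGroup M] [Module k M] {τ : Representation k G M}
      (B : Subrepresentation τ) (f : τ.IntertwiningMap (permRep k (fixingSubgroup G T)))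
      (p : τ.IntertwiningMap σ), (∃ u ∈ B, p u ≠ 0) → (∀ u ∈ B, f u = 0 → p u = 0) →
    ∃ T' ⊆ T, IsGClosed G T' ∧ ∃ (n : ℕ) (δ : Representation k (AutT G T') (Fin n → k)),
      δ.IsIrreducible ∧ Nonempty (σ.Equiv (VRep G δ)) := by
  induction hn : T.ncard using Nat.strong_induction_on generalizing T with
  | _ n ih =>
    intro M _ _ τ B f p hB h
    -- If `p` kills the part of `B` lying over `V_T ⊗ k`, then it factors through the restrictions,
    -- and one smaller `T'` suffices. Otherwise `σ` is a quotient of a piece of the semisimple `V_T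
    -- ⊗ k`, hence of `V_T ⊗ k` itself, and receives a nonzero map from some `V_{T,δ}`.
    by_cases hK : ∀ u ∈ B ⊓ subComap f (VTk G k T), p u = 0
    · let ι := {T' : Set Ψ // IsGClosed G T' ∧ T' ⊂ T}
      have : Finite ι := (hT.finite_subsets.subset fun T' h => h.2.1 :
        {T' : Set Ψ | IsGClosed G T' ∧ T' ⊂ T}.Finite).to_subtype
      let _ := Fintype.ofFinite ι
      obtain ⟨i, -, C, hC, hC'⟩ := exists_factor (ι := ι) (τ := τ)
        (μ := fun i => permRep k (fixingSubgroup G i.1)) Finset.univ B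
        (fun i => (res k i.2.2.1).comp f) p hB fun u hu hfu => hK u
          ⟨hu, (mem_VTk_iff hG k hT hTc _).2 fun T' h1 h2 => hfu ⟨T', h1, h2⟩ (Finset.mem_univ _)⟩
      obtain ⟨T', hT', r⟩ := ih _ (hn ▸ Set.ncard_lt_ncard i.2.2 hT) (hT.subset i.2.2.1) i.2.1 rfl
        C ((res k i.2.2.1).comp f) p hC hC'
      exact ⟨T', hT'.trans i.2.2.1, r⟩
    · push Not at hK
      obtain ⟨u, ⟨huB, hu⟩, hpu⟩ := hK
      let K := B ⊓ subComap f (VTk G k T)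
      obtain ⟨q, hq⟩ := exists_extension_of_semisimple (isSemisimple_VTk (k := k) hG hT hTc)
        (codRestrict (VTk G k T) (f.comp (incl K)) fun v => v.2.2) (p.comp (incl K)) fun v hv =>
          h v v.2.1 (congrArg Subtype.val hv)
      have hne : ¬ (VTk G k T).toSubmodule ≤
          (LinearMap.ker q.toLinearMap).map (VTk G k T).toSubmodule.subtype := by
        intro hle
        obtain ⟨w, hw, hwu⟩ := hle hu
        refine hpu ((hq ⟨u, huB, hu⟩).symm.trans ?_)
        have : w = codRestrict (VTk G k T) (f.comp (incl K)) (fun v => v.2.2) ⟨u, huB, hu⟩ :=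
          Subtype.ext hwu
        rw [← this]
        exact hw
      have : ∃ (n : ℕ) (δ : Representation k (AutT G T) (Fin n → k)), δ.IsIrreducible ∧
          ∃ φ ∈ V G δ, ∃ x, φ x ∉
            (LinearMap.ker q.toLinearMap).map (VTk G k T).toSubmodule.subtype := by
        by_contra! h'
        exact hne (VTk_le hT hTc h')
      obtain ⟨m, δ, hδ, φ, hφ, x, hφx⟩ := this
      let r : (V G δ).toRepresentation.IntertwiningMap σ :=
        q.comp (codRestrict (V := (V G δ).toSubmodule) (VTk G k T)
          ((evalS δ x).comp (incl (V G δ))) fun v => v.2 x)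
      have hr : r ⟨φ, hφ⟩ ≠ 0 := fun h0 => hφx ⟨⟨φ x, hφ x⟩, h0, rfl⟩
      obtain ⟨e⟩ := nonempty_equiv_of_ne_zero (isIrreducible_VRep hG hT hTc hδ) hσ r hr
      exact ⟨T, subset_rfl, hTc, m, δ, hδ, ⟨e.symm⟩⟩

theorem exists_equiv_VRep_of_subquotient {T : Set Ψ} (hT : T.Finite) (hTc : IsGClosed G T)
    (A B : Subrepresentation (permRep k (fixingSubgroup G T)))
    (h : (subquotient A B).IsIrreducible) :
    ∃ T' ⊆ T, IsGClosed G T' ∧ ∃ (n : ℕ) (δ : Representation k (AutT G T') (Fin n → k)),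
      δ.IsIrreducible ∧ Nonempty ((subquotient A B).Equiv (VRep G δ)) := by
  obtain ⟨w, hw⟩ := exists_ne_zero_of_isIrreducible h
  obtain ⟨b, rfl⟩ := toSubquotient_surjective A B w
  refine exists_equiv_VRep hG hT hTc h ⊤ (incl B) (toSubquotient A B) ⟨b, subrep_mem_top b, hw⟩ ?_
  intro u _ hu
  have : u = 0 := Subtype.ext hu
  rw [this, map_zero]

/-- Evaluation at a suitable vector embeds `V_{T',γ}` into `k[G/G_{T'}]`, which is a quotient of
`k[G/G_T]` by restriction. The subquotient is the preimage of the image modulo the kernel of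
restriction. -/
theorem exists_subquotient_equiv {T T' : Set Ψ} (hT : T.Finite) (hT' : T' ⊆ T)
    (hTc' : IsGClosed G T') {Γ : Type*} [AddCommGroup Γ] [Module k Γ]
    {γ : Representation k (AutT G T') Γ} (hγ : γ.IsIrreducible) :
    ∃ A B : Subrepresentation (permRep k (fixingSubgroup G T)), A ≤ B ∧
      Nonempty ((subquotient A B).Equiv (VRep G γ)) := by
  have hTf := hT.subset hT'
  obtain ⟨φ, hφ, hφ0⟩ := subrep_ne_bot_iff.1 (V_ne_bot hG hTf hTc' hγ)
  obtain ⟨x, hx⟩ : ∃ x, φ x ≠ 0 := by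
    by_contra! h
    exact hφ0 (DFunLike.ext _ _ h)
  let i : (V G γ).toRepresentation.IntertwiningMap (permRep k (fixingSubgroup G T')) :=
    (evalS γ x).comp (incl (V G γ))
  have hi : Function.Injective i :=
    injective_of_ne_zero (isIrreducible_VRep hG hTf hTc' hγ) i (v := ⟨φ, hφ⟩) hx
  let I : Subrepresentation (permRep k (fixingSubgroup G T')) := subMap (V := (V G γ).toSubmodule) i ⊤
  let j := codRestrict I i fun v => ⟨v, subrep_mem_top v, rfl⟩
  have hj : Function.Bijective j := by
    refine ⟨fun a b hab => hi (congrArg Subtype.val hab), ?_⟩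
    rintro ⟨_, v, -, rfl⟩
    exact ⟨v, rfl⟩
  let e := equivOfBijective (V := (V G γ).toSubmodule) j hj
  have hres : Function.Surjective (res (G := G) k hT') := by
    intro y
    induction y using MonoidAlgebra.induction_linear with
    | zero => exact ⟨0, map_zero _⟩
    | add a b ha hb =>
      obtain ⟨a, rfl⟩ := ha
      obtain ⟨b, rfl⟩ := hb
      exact ⟨a + b, map_add _ a b⟩
    | single s c =>
      induction s using QuotientGroup.induction_on with
      | H g => exact ⟨MonoidAlgebra.single (QuotientGroup.mk g) c, res_single hT' _ c⟩
  refine ⟨subComap (res k hT') ⊥, subComap (res k hT') I, fun v hv => ?_,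
    nonempty_subquotient_equiv (W := (V G γ).toSubmodule) (e.symm.toIntertwiningMap.comp
      (codRestrict I ((res k hT').comp (incl _)) fun v => v.2)) ?_ fun b => ?_⟩
  · rw [mem_subComap, subrep_mem_bot] at hv
    rw [mem_subComap, hv]
    exact Submodule.zero_mem I.toSubmodule
  · refine e.symm.toLinearEquiv.surjective.comp ?_
    rintro ⟨y, hy⟩
    obtain ⟨v, rfl⟩ := hres y
    exact ⟨⟨v, hy⟩, rfl⟩
  · change e.symm.toLinearEquiv _ = 0 ↔ _
    rw [LinearEquiv.map_eq_zero_iff]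
    exact Subtype.ext_iff

end FiniteLength


/-! ### Smooth representations and the classification of the simple ones. -/

section Smooth

variable {Ψ : Type*} {G : Subgroup (Equiv.Perm Ψ)} {k : Type*} [Field k]

theorem isSmooth_iff {V : Type*} [AddCommGroup V] [Module k V] {ρ : Representation k G V} :
    IsSmooth ρ ↔ ∀ v : V, ∃ S : Set Ψ, S.Finite ∧ ∀ g ∈ fixingSubgroup G S, ρ g v = v := by
  refine forall_congr' fun v => ?_
  let H : Subgroup G :=
    { carrier := {g | ρ g v = v}
      one_mem' := by simp
      mul_mem' := fun {a b} ha hb => by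
        simp only [Set.mem_ofPred_eq] at ha hb ⊢
        rw [map_mul, Module.End.mul_apply, hb, ha]
      inv_mem' := fun {a} ha => by
        simp only [Set.mem_ofPred_eq] at ha ⊢
        rw [Representation.inv_apply_eq_iff, ha] }
  refine (isOpen_iff G H).trans ⟨?_, ?_⟩
  · rintro ⟨S, hS⟩
    exact ⟨S, S.finite_toSet, fun g hg => hS hg⟩
  · rintro ⟨S, hSf, hS⟩
    refine ⟨hSf.toFinset, fun g hg => ?_⟩
    rw [Set.Finite.coe_toFinset] at hg
    exact hS g hg

theorem isSmooth_iff_isGClosed (hG : IsGood G) {V : Type*} [AddCommGroup V] [Module k V]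
    {ρ : Representation k G V} : IsSmooth ρ ↔ ∀ v : V, ∃ S : Set Ψ, S.Finite ∧ IsGClosed G S ∧
      ∀ g ∈ fixingSubgroup G S, ρ g v = v := by
  refine isSmooth_iff.trans (forall_congr' fun v => ⟨?_, ?_⟩)
  · rintro ⟨S, hS, h⟩
    refine ⟨cl G S, hG.finite_cl S hS, isGClosed_cl S, ?_⟩
    rwa [fixing_cl]
  · rintro ⟨S, hS, -, h⟩
    exact ⟨S, hS, h⟩

theorem IsSmooth.of_injective {V W : Type*} [AddCommGroup V] [Module k V] [AddCommGroup W]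
    [Module k W] {ρ : Representation k G V} {σ : Representation k G W} (hσ : IsSmooth σ)
    (f : ρ.IntertwiningMap σ) (hf : Function.Injective f) : IsSmooth ρ := by
  rw [isSmooth_iff] at hσ ⊢
  intro v
  obtain ⟨S, hS, h⟩ := hσ (f v)
  refine ⟨S, hS, fun g hg => hf ?_⟩
  rw [Representation.IntertwiningMap.isIntertwining, h g hg]

variable [CharZero k] (hG : IsGood G)

include hG

/-- A nonzero vector is fixed by some `G_T`, so the representation is a quotient of `k[G/G_T]`. -/
theorem exists_equiv_VRep_of_isSmooth {W : Type*} [AddCommGroup W] [Module k W]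
    {ρ : Representation k G W} (hρ : IsSmooth ρ) (hirr : ρ.IsIrreducible) :
    ∃ T : Set Ψ, T.Finite ∧ IsGClosed G T ∧
      ∃ (n : ℕ) (δ : Representation k (AutT G T) (Fin n → k)), δ.IsIrreducible ∧
        Nonempty (ρ.Equiv (VRep G δ)) := by
  obtain ⟨v, hv⟩ := exists_ne_zero_of_isIrreducible hirr
  obtain ⟨T, hT, hTc, hfix⟩ := (isSmooth_iff_isGClosed hG).1 hρ v
  obtain ⟨T', hT', hTc', r⟩ := exists_equiv_VRep hG hT hTc hirr ⊤
    (Representation.IntertwiningMap.id (permRep k (fixingSubgroup G T))) (liftFixed ρ v hfix)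
    ⟨bp k _, subrep_mem_top _, by rwa [liftFixed_bp]⟩ fun u _ hu => by
      rw [Representation.IntertwiningMap.id_apply] at hu
      rw [hu, map_zero]
  exact ⟨T', hT.subset hT', hTc', r⟩

omit [CharZero k] in
theorem isSmooth_S {T : Set Ψ} (hT : T.Finite) {Γ : Type*} [AddCommGroup Γ] [Module k Γ]
    [FiniteDimensional k Γ] (γ : Representation k (AutT G T) Γ) : IsSmooth (S G γ) := by
  rw [isSmooth_iff]
  intro f
  obtain ⟨W, hWf, -, -, hMW⟩ := exists_supp hG hT hT (fg_range f)
  refine ⟨W, hWf, fun g hg => DFunLike.ext _ _ fun x => ?_⟩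
  rw [S_apply]
  exact permRep_eq_self_of_mem_supp hg (hMW ⟨x, rfl⟩)

end Smooth

/-! ### Injectivity of `k[G/G_T]` and of `S_{T,α}`. -/

section Injective

variable {Ψ : Type*} {G : Subgroup (Equiv.Perm Ψ)} {k : Type*} [Field k]

/-- The morphism to `k[G/G_T]` determined by a functional. -/
def ofFunctional {T : Set Ψ} (hT : T.Finite) {N : Type*} [AddCommGroup N] [Module k N]
    (τ : Representation k G N) (l : Module.Dual k N)
    (hl : ∀ g ∈ fixingSubgroup G T, ∀ n, l (τ g n) = l n)
    (hfin : ∀ n, ∃ S : Set Ψ, S.Finite ∧ ∀ g : G, l (τ g⁻¹ n) ≠ 0 → ∀ t ∈ T, g • t ∈ S) :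
    τ.IntertwiningMap (permRep k (fixingSubgroup G T)) :=
  let c : N → Orb G T → k := fun n s => Quotient.liftOn' s (fun g => l (τ g⁻¹ n)) fun g h hgh => by
    have := hl _ (QuotientGroup.leftRel_apply.1 hgh) (τ h⁻¹ n)
    rw [← Module.End.mul_apply, ← map_mul, mul_assoc, mul_inv_cancel, mul_one] at this
    exact this
  have hc : ∀ n, (Function.support (c n)).Finite := fun n => by
    obtain ⟨S, hS, h⟩ := hfin n
    refine (finite_setOf_img_subset (G := G) hT hS).subset fun s hs => ?_
    induction s using QuotientGroup.induction_on with
    | H g =>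
      rw [Set.mem_ofPred_eq, img_mk]
      rintro _ ⟨t, ht, rfl⟩
      exact h g hs t ht
  { toLinearMap := (MonoidAlgebra.coeffLinearEquiv k).symm.toLinearMap ∘ₗ
      { toFun := fun n => Finsupp.ofSupportFinite (c n) (hc n)
        map_add' := fun n n' => by
          ext s
          induction s using QuotientGroup.induction_on with
          | H g =>
            change l (τ g⁻¹ (n + n')) = l (τ g⁻¹ n) + l (τ g⁻¹ n')
            rw [map_add, map_add]
        map_smul' := fun a n => by
          ext s
          induction s using QuotientGroup.induction_on with
          | H g =>
            change l (τ g⁻¹ (a • n)) = a • l (τ g⁻¹ n)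
            rw [map_smul, map_smul] }
    isIntertwining' := fun g => by
      refine LinearMap.ext fun n => ?_
      ext s
      induction s using QuotientGroup.induction_on with
      | H h =>
        refine Eq.trans ?_ (Representation.coeff_ofMulAction _ _ _).symm
        change l (τ h⁻¹ (τ g n)) = l (τ (g⁻¹ * h)⁻¹ n)
        rw [mul_inv_rev, inv_inv, map_mul, Module.End.mul_apply] }

theorem coeff_ofFunctional {T : Set Ψ} (hT : T.Finite) {N : Type*} [AddCommGroup N] [Module k N]
    (τ : Representation k G N) (l : Module.Dual k N)
    (hl : ∀ g ∈ fixingSubgroup G T, ∀ n, l (τ g n) = l n)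
    (hfin : ∀ n, ∃ S : Set Ψ, S.Finite ∧ ∀ g : G, l (τ g⁻¹ n) ≠ 0 → ∀ t ∈ T, g • t ∈ S)
    (n : N) (g : G) : (ofFunctional hT τ l hl hfin n).coeff (QuotientGroup.mk g) = l (τ g⁻¹ n) :=
  rfl

/-- The subspace of the vectors on which a functional has to vanish in order to define a morphism
to `k[G/G_T]`. -/
def negligible (T : Set Ψ) {N : Type*} [AddCommGroup N] [Module k N] (τ : Representation k G N) :
    Submodule k N :=
  Submodule.span k ({n | ∃ g ∈ fixingSubgroup G T, ∃ m, n = τ g m - m} ∪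
    {n | ∃ S, S.Finite ∧ IsGClosed G S ∧ ¬ T ⊆ S ∧ ∀ g ∈ fixingSubgroup G S, τ g n = n})

variable [CharZero k] (hG : IsGood G) {T : Set Ψ} (hT : T.Finite) (hTc : IsGClosed G T)

include hG

omit [CharZero k] in
/-- Every negligible vector is killed by all the sufficiently large key operators. -/
theorem exists_kill_of_mem_negligible {N : Type*} [AddCommGroup N] [Module k N]
    {τ : Representation k G N} (hτ : IsSmooth τ) {n : N} (hn : n ∈ negligible T τ) :
    ∃ W₀ : Set Ψ, W₀.Finite ∧ ∀ (W : Set Ψ), W.Finite → IsGClosed G W → T ⊆ W → W₀ ⊆ W →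
      ∀ P A : k[G], IsKey T W P →
      (∀ u ∈ A.coeff.support, u ∈ fixingSubgroup G T ∧ ∀ w ∈ W, u • w ∈ W) →
      (∀ h ∈ fixingSubgroup G T, (∀ w ∈ W, h • w ∈ W) →
        (permRep k (fixingSubgroup G W)).asAlgebraHom (A * MonoidAlgebra.single h 1) (bp k _) =
          (permRep k (fixingSubgroup G W)).asAlgebraHom A (bp k _)) →
      τ.asAlgebraHom P (τ.asAlgebraHom A n) = 0 := by
  induction hn using Submodule.span_induction with
  | mem n hn =>
    rcases hn with ⟨g, hg, m, rfl⟩ | ⟨S, hS, hSc, hTS, hfix⟩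
    · obtain ⟨S, hS, hfix⟩ := isSmooth_iff.1 hτ m
      refine ⟨S ∪ (g • ·) '' S, hS.union (hS.image _), fun W hWf hW hTW hSW P A hP hA1 hA2 => ?_⟩
      have hclW : cl G (S ∪ T) ⊆ W :=
        cl_subset hW (Set.union_subset (Set.subset_union_left.trans hSW) hTW)
      have hgW : ∀ s ∈ cl G (S ∪ T), g • s ∈ W := by
        have : cl G (S ∪ T) ⊆ (g • ·) ⁻¹' W := by
          refine cl_subset (hW.preimage g) ?_
          rintro x (hx | hx)
          · exact hSW (Or.inr ⟨x, hx, rfl⟩)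
          · change g • x ∈ W
            rw [mem_fix.1 hg x hx]
            exact hTW hx
        exact this
      -- The element `g` is replaced by one preserving `W` and agreeing with it on `S ∪ T`. This
      -- does not change `τ g m`, and such elements are absorbed by `A`.
      obtain ⟨h, hhg, hhW⟩ := hG.extend _ W (isGClosed_cl _) hW hWf hclW g hgW
      have hhT : h ∈ fixingSubgroup G T := mem_fix.2 fun t ht => by
        rw [hhg t (subset_cl _ (Or.inr ht)), mem_fix.1 hg t ht]
      have hgm : τ g m = τ h m := by
        have h1 := hfix (h⁻¹ * g) (mem_fix.2 fun s hs => by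
          rw [mul_smul, ← hhg s (subset_cl _ (Or.inl hs)), inv_smul_smul])
        rw [map_mul, Module.End.mul_apply, Representation.inv_apply_eq_iff] at h1
        exact h1
      have hmW : ∀ u ∈ fixingSubgroup G W, τ u m = m := fun u hu =>
        hfix u (fixing_mono (Set.subset_union_left.trans hSW) hu)
      have := asAlgebraHom_eq_of_bp τ hmW (hA2 h hhT hhW)
      rw [asAlgebraHom_mul_apply, Representation.asAlgebraHom_single_one] at this
      rw [map_sub, hgm, this, sub_self, map_zero]
    · refine ⟨S, hS, fun W hWf hW hTW hSW P A hP hA1 _ => ?_⟩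
      rw [asAlgebraHom_apply_eq_sum τ A, Finsupp.sum, map_sum]
      refine Finset.sum_eq_zero fun u hu => ?_
      rw [map_smul]
      -- The translate by `u` is fixed by the stabilizer of `u(S)`, which still does not contain `T`
      -- because `u` fixes `T`.
      refine (congrArg _ (hP.apply_eq_zero (S := (u • ·) '' S) ?_ (hSc.image u) ?_ ?_)).trans
        (smul_zero _)
      · rintro _ ⟨s, hs, rfl⟩
        exact (hA1 u hu).2 s (hSW hs)
      · intro h
        refine hTS fun t ht => ?_
        obtain ⟨s, hs, hst⟩ := h ht
        have h1 := mem_fix.1 (hA1 u hu).1 t ht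
        rw [← h1] at hst
        rwa [← MulAction.injective u hst]
      · intro g hg
        rw [mem_fix_image] at hg
        have h1 := hfix _ hg
        rw [map_mul, map_mul, Module.End.mul_apply, Module.End.mul_apply,
          Representation.inv_apply_eq_iff] at h1
        exact h1
  | zero => exact ⟨∅, Set.finite_empty, fun _ _ _ _ _ _ _ _ _ _ => by rw [map_zero, map_zero]⟩
  | add n n' _ _ ih ih' =>
    obtain ⟨W₁, h₁, h₁'⟩ := ih
    obtain ⟨W₂, h₂, h₂'⟩ := ih'
    refine ⟨W₁ ∪ W₂, h₁.union h₂, fun W hWf hW hTW hSW P A hP hA1 hA2 => ?_⟩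
    rw [map_add, map_add,
      h₁' W hWf hW hTW (Set.subset_union_left.trans hSW) P A hP hA1 hA2,
      h₂' W hWf hW hTW (Set.subset_union_right.trans hSW) P A hP hA1 hA2, add_zero]
  | smul c n _ ih =>
    obtain ⟨W₁, h₁, h₁'⟩ := ih
    refine ⟨W₁, h₁, fun W hWf hW hTW hSW P A hP hA1 hA2 => ?_⟩
    rw [map_smul, map_smul, h₁' W hWf hW hTW hSW P A hP hA1 hA2, smul_zero]

include hT hTc

/-- The injectivity of `k[G/G_T]`. -/
theorem exists_extension_permRep {M N : Type*} [AddCommGroup M] [Module k M] [AddCommGroup N]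
    [Module k N] {σ : Representation k G M} {τ : Representation k G N} (hτ : IsSmooth τ)
    (i : σ.IntertwiningMap τ) (hi : Function.Injective i)
    (f : σ.IntertwiningMap (permRep k (fixingSubgroup G T))) :
    ∃ h : τ.IntertwiningMap (permRep k (fixingSubgroup G T)), ∀ m, h (i m) = f m := by
  have hσ := hτ.of_injective i hi
  -- A morphism to `k[G/G_T]` is determined by its coefficient at the base point, so it suffices to
  -- extend this functional to one vanishing on `negligible T τ`.
  let l₀ : Module.Dual k M := Finsupp.lapply (QuotientGroup.mk 1) ∘ₗ
    (MonoidAlgebra.coeffLinearEquiv k).toLinearMap ∘ₗ f.toLinearMap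
  have hl₀ : ∀ m, l₀ m = (f m).coeff (QuotientGroup.mk 1) := fun _ => rfl
  let φ : M →ₗ[k] N ⧸ negligible T τ := (negligible T τ).mkQ ∘ₗ i.toLinearMap
  have hker : l₀ ∈ (LinearMap.ker φ).dualAnnihilator := by
    rw [Submodule.mem_dualAnnihilator]
    intro m hm
    have hm' : i m ∈ negligible T τ := (Submodule.Quotient.mk_eq_zero _).1 hm
    obtain ⟨W₀, hW₀, hkill⟩ := exists_kill_of_mem_negligible hG hτ hm'
    obtain ⟨S, hS, hfix⟩ := isSmooth_iff.1 hσ m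
    have hsub := subset_cl (G := G) (W₀ ∪ S ∪ T)
    set W := cl G (W₀ ∪ S ∪ T)
    have hWf : W.Finite := hG.finite_cl _ ((hW₀.union hS).union hT)
    have hW : IsGClosed G W := isGClosed_cl _
    have hTW : T ⊆ W := Set.subset_union_right.trans hsub
    obtain ⟨P, hP⟩ := exists_isKey (k := k) hG hTc hW hWf hTW
    obtain ⟨A, hA1, hA2, hA3⟩ := exists_averaging_operator k T (G := G) hWf
    -- `P A` kills `i m`, hence `m` by injectivity of `i`, hence `f m`. But `A` (of total weight
    -- one, supported in `G_T`) and then `P` preserve the base coefficient, so that of `f m` is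
    -- zero.
    have h0 := hkill W hWf hW hTW
      ((Set.subset_union_left.trans Set.subset_union_left).trans hsub) P A hP hA1
      fun h hh hhW => (hA3 h hh hhW).1
    rw [← asAlgebraHom_intertwining, ← asAlgebraHom_intertwining] at h0
    have h1 : σ.asAlgebraHom P (σ.asAlgebraHom A m) = 0 := hi (h0.trans (map_zero i).symm)
    have h2 := congrArg f h1
    rw [asAlgebraHom_intertwining, asAlgebraHom_intertwining, map_zero] at h2
    have hfm : f m ∈ supp k T W := by
      intro s hs
      refine img_subset_of_fixed hG hWf hW (fun g hg => ?_) (Finsupp.mem_support_iff.2 hs)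
      rw [← Representation.IntertwiningMap.isIntertwining,
        hfix g (fixing_mono ((Set.subset_union_right.trans Set.subset_union_left).trans hsub) hg)]
    have hAfm : (permRep k (fixingSubgroup G T)).asAlgebraHom A (f m) ∈ supp k T W := by
      rw [asAlgebraHom_apply_eq_sum]
      exact sum_mem fun u hu => Submodule.smul_mem _ _ (permRep_mem_supp (hA1 u hu).2 hfm)
    have h3 := hP.coeff_base_apply hT hTc hTW hAfm
    rw [h2, coeff_asAlgebraHom_permRep,
      weight_congr (φ' := fun g => (1 : G → k) g * (f m).coeff (QuotientGroup.mk 1)),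
      weight_mul_const, hA2, one_mul] at h3
    · exact h3.symm
    · intro u hu
      rw [Pi.one_apply, one_mul]
      congr 1
      refine orb_mk_eq_iff.2 fun t ht => ?_
      change (u⁻¹ * 1) • t = (1 : G) • t
      rw [mul_one, one_smul]
      exact mem_fix.1 (inv_mem (hA1 u hu).1) t ht
  rw [← LinearMap.range_dualMap_eq_dualAnnihilator_ker] at hker
  obtain ⟨l', hl'⟩ := hker
  let l : Module.Dual k N := l' ∘ₗ (negligible T τ).mkQ
  have hl1 : ∀ n ∈ negligible T τ, l n = 0 := by
    intro n hn
    change l' (Submodule.Quotient.mk n) = 0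
    rw [(Submodule.Quotient.mk_eq_zero _).2 hn, map_zero]
  have hl2 : ∀ m, l (i m) = (f m).coeff (QuotientGroup.mk 1) := fun m => LinearMap.congr_fun hl' m
  refine ⟨ofFunctional hT τ l (fun g hg n => ?_) (fun n => ?_), fun m => ?_⟩
  · rw [← sub_eq_zero, ← map_sub]
    exact hl1 _ (Submodule.subset_span (Or.inl ⟨g, hg, n, rfl⟩))
  -- If `g t` is outside `S`, then `τ g⁻¹ n` is fixed by the stabilizer of `g⁻¹(S)`, which misses
  -- `t`. It is therefore negligible.
  · obtain ⟨S, hS, hSc, hfix⟩ := (isSmooth_iff_isGClosed hG).1 hτ n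
    refine ⟨S, hS, fun g hg => ?_⟩
    by_contra! h
    obtain ⟨t, ht, hgt⟩ := h
    refine hg (hl1 _ (Submodule.subset_span (Or.inr ⟨(g⁻¹ • ·) '' S, hS.image _, hSc.image _,
      fun h => hgt ?_, fun h hh => ?_⟩)))
    · obtain ⟨s, hs, hst⟩ := h ht
      rw [← hst]
      simpa using hs
    · rw [mem_fix_image, inv_inv] at hh
      have h1 := hfix _ hh
      rw [map_mul, map_mul, Module.End.mul_apply, Module.End.mul_apply] at h1
      exact (τ.inv_apply_eq_iff.2 h1.symm).symm
  · ext s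
    induction s using QuotientGroup.induction_on with
    | H g =>
      rw [coeff_ofFunctional, ← Representation.IntertwiningMap.isIntertwining, hl2,
        Representation.IntertwiningMap.isIntertwining, Representation.coeff_ofMulAction, inv_inv]
      exact congrArg _ (congrArg QuotientGroup.mk (mul_one g))

/-- The injectivity of `S_{T,α}`. -/
theorem exists_extension_S {Γ : Type*} [AddCommGroup Γ] [Module k Γ] [FiniteDimensional k Γ]
    (γ : Representation k (AutT G T) Γ) {M N : Type*} [AddCommGroup M] [Module k M]
    [AddCommGroup N] [Module k N] {σ : Representation k G M} {τ : Representation k G N}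
    (hτ : IsSmooth τ) (i : σ.IntertwiningMap τ) (hi : Function.Injective i)
    (f : σ.IntertwiningMap (S G γ)) : ∃ h : τ.IntertwiningMap (S G γ), ∀ m, h (i m) = f m := by
  have := finite_autT hT hTc
  let _ := Fintype.ofFinite (AutT G T)
  let b := Module.finBasis k Γ
  choose h hh using fun j => exists_extension_permRep hG hT hTc hτ i hi ((evalS γ (b j)).comp f)
  -- In a basis of `Γ`, an element of `S` is a tuple of elements of `k[G/G_T]`. Each component of
  -- `f` is extended separately, and averaging over `Aut(T)` restores equivariance without changing
  -- the values on `M`.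
  refine ⟨(Fintype.card (AutT G T) : k)⁻¹ • ∑ j, (homAvgMap γ (b.coord j)).comp (h j),
    fun m => ?_⟩
  rw [Representation.IntertwiningMap.smul_apply, Representation.IntertwiningMap.sum_apply]
  rw [inv_smul_eq_iff₀ (Nat.cast_ne_zero.2 Fintype.card_ne_zero),
    card_smul_eq_sum_homAvg Finset.univ (fun j => b.coord j) (fun j => f m (b j)) (f m) fun x => ?_]
  · refine Finset.sum_congr rfl fun j _ => ?_
    rw [Representation.IntertwiningMap.comp_apply, hh]
    rfl
  · simp only [← map_smul, ← map_sum]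
    congr 1
    exact (b.sum_repr x).symm

theorem isSmoothInjectiveHull_V {Γ : Type*} [AddCommGroup Γ] [Module k Γ]
    {γ : Representation k (AutT G T) Γ} (hγ : γ.IsIrreducible) :
    IsSmoothInjectiveHull (V G γ) := by
  have := finite_autT hT hTc
  have := finiteDimensional_of_isIrreducible hγ
  refine ⟨⟨isSmooth_S hG hT γ, fun M N _ _ _ _ σ τ _ hτ i f hi => ?_⟩, isEssential_V hG hT hTc hγ⟩
  obtain ⟨h, hh⟩ := exists_extension_S hG hT hTc γ hτ i hi f
  exact ⟨h, DFunLike.ext _ _ hh⟩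

end Injective


/-! ### Isomorphisms between the `V_{T,α}` and between the `S_{T,α}`. -/

section Conjugation

variable {Ψ : Type*} {G : Subgroup (Equiv.Perm Ψ)} {k : Type*} [Field k]

/-- The morphism `[x] ↦ [x g⁻¹]`. -/
def conjMap (k : Type*) [Field k] {T T' : Set Ψ} (g : G)
    (h : ∀ x ∈ fixingSubgroup G T, g * x * g⁻¹ ∈ fixingSubgroup G T') :
    (permRep k (fixingSubgroup G T)).IntertwiningMap (permRep k (fixingSubgroup G T')) :=
  liftFixed _ (MonoidAlgebra.single (QuotientGroup.mk g⁻¹) 1) fun x hx => by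
    rw [permRep_single]
    congr 1
    change QuotientGroup.mk (x * g⁻¹) = _
    rw [eq_comm, QuotientGroup.eq, inv_inv, ← mul_assoc]
    exact h x hx

theorem conjMap_single {T T' : Set Ψ} (g : G)
    (h : ∀ x ∈ fixingSubgroup G T, g * x * g⁻¹ ∈ fixingSubgroup G T') (x : G) (c : k) :
    conjMap k g h (MonoidAlgebra.single (QuotientGroup.mk x) c) =
      MonoidAlgebra.single (QuotientGroup.mk (x * g⁻¹)) c := by
  rw [conjMap, liftFixed_single, permRep_single]
  simp only [MonoidAlgebra.smul_single, smul_eq_mul, mul_one]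
  rfl

theorem conjMap_conjMap {T T' : Set Ψ} {g g' : G} (hg : g * g' = 1)
    (h : ∀ x ∈ fixingSubgroup G T, g * x * g⁻¹ ∈ fixingSubgroup G T')
    (h' : ∀ x ∈ fixingSubgroup G T', g' * x * g'⁻¹ ∈ fixingSubgroup G T) (y : k[Orb G T]) :
    conjMap k g' h' (conjMap k g h y) = y := by
  induction y using MonoidAlgebra.induction_linear with
  | zero => simp
  | add x y hx hy => rw [map_add, map_add, hx, hy]
  | single s c =>
    induction s using QuotientGroup.induction_on with
    | H x =>
      rw [conjMap_single, conjMap_single, mul_assoc, ← mul_inv_rev,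
        mul_eq_one_comm.1 hg, inv_one, mul_one]

theorem conjMap_weylRep {T T' : Set Ψ} {g : G}
    (h : ∀ x ∈ fixingSubgroup G T, g * x * g⁻¹ ∈ fixingSubgroup G T')
    {n : Subgroup.normalizer (fixingSubgroup G T : Set G)}
    {n' : Subgroup.normalizer (fixingSubgroup G T' : Set G)} (hn : (n' : G) = g * n * g⁻¹)
    (y : k[Orb G T]) : conjMap k g h (weylRep k (fixingSubgroup G T) (n : AutT G T) y) =
      weylRep k (fixingSubgroup G T') (n' : AutT G T') (conjMap k g h y) := by
  induction y using MonoidAlgebra.induction_linear with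
  | zero => simp
  | add x y hx hy => simp only [map_add, hx, hy]
  | single s c =>
    induction s using QuotientGroup.induction_on with
    | H x =>
      rw [conjMap_single, weylRep_single, weylRep_single, weyl_smul_mk, weyl_smul_mk,
        conjMap_single, hn]
      congr 2
      group

variable {T T' : Set Ψ} {Γ Γ' : Type*} [AddCommGroup Γ] [Module k Γ] [AddCommGroup Γ']
  [Module k Γ'] {γ : Representation k (AutT G T) Γ} {γ' : Representation k (AutT G T') Γ'}

/-- The morphism `S_{T,α} → S_{T',α'}` attached to an element `g` that transforms `α` to `α'`. -/
def conjMapS (g : G) (h : ∀ x ∈ fixingSubgroup G T, g * x * g⁻¹ ∈ fixingSubgroup G T')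
    (hN : ∀ n' : Subgroup.normalizer (fixingSubgroup G T' : Set G),
      ∃ n : Subgroup.normalizer (fixingSubgroup G T : Set G), (n' : G) = g * n * g⁻¹)
    (e : Γ' →ₗ[k] Γ)
    (he : ∀ (n : Subgroup.normalizer (fixingSubgroup G T : Set G))
      (n' : Subgroup.normalizer (fixingSubgroup G T' : Set G)),
      (n' : G) = g * n * g⁻¹ → ∀ x : Γ', e (γ' (n' : AutT G T') x) = γ (n : AutT G T) (e x)) :
    (S G γ).IntertwiningMap (S G γ') where
  toLinearMap :=
    { toFun := fun f =>
        { toLinearMap := (conjMap k g h).toLinearMap ∘ₗ f.toLinearMap ∘ₗ e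
          isIntertwining' := fun a' => by
            induction a' using QuotientGroup.induction_on with
            | H n' =>
              obtain ⟨n, hn⟩ := hN n'
              refine LinearMap.ext fun x => ?_
              change conjMap k g h (f (e (γ' _ x))) = weylRep k _ _ (conjMap k g h (f (e x)))
              rw [he n n' hn, Representation.IntertwiningMap.isIntertwining, conjMap_weylRep h hn] }
      map_add' := fun f f' => DFunLike.ext _ _ fun x => map_add (conjMap k g h) (f (e x)) (f' (e x))
      map_smul' := fun c f => DFunLike.ext _ _ fun x => map_smul (conjMap k g h) c (f (e x)) }
  isIntertwining' a := LinearMap.ext fun f => DFunLike.ext _ _ fun x =>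
    (conjMap k g h).isIntertwining _ _ a (f (e x))

theorem AreConj.nonempty_equiv_S (hc : AreConj G γ γ') : Nonempty ((S G γ).Equiv (S G γ')) := by
  obtain ⟨g, rfl, e, he⟩ := hc
  have h1 : ∀ x ∈ fixingSubgroup G T, g * x * g⁻¹ ∈ fixingSubgroup G ((g • ·) '' T) := by
    intro x hx
    rw [mem_fix_image]
    simpa [mul_assoc] using hx
  have h2 : ∀ x ∈ fixingSubgroup G ((g • ·) '' T), g⁻¹ * x * g⁻¹⁻¹ ∈ fixingSubgroup G T := by
    intro x hx
    rw [mem_fix_image] at hx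
    rwa [inv_inv]
  let Φ : (S G γ).IntertwiningMap (S G γ') := conjMapS g h1
    (fun n' => ⟨⟨g⁻¹ * n' * g, (conj_mem_normalizer G g _).1 (by
      have : g * (g⁻¹ * n' * g) * g⁻¹ = n' := by group
      rw [this]; exact n'.2)⟩, by
      change (n' : G) = g * (g⁻¹ * n' * g) * g⁻¹
      group⟩) e.symm.toLinearMap fun n n' hn x => by
        change e.symm _ = γ _ (e.symm x)
        rw [LinearEquiv.symm_apply_eq, he n n' hn, LinearEquiv.apply_symm_apply]
  let Φ' : (S G γ').IntertwiningMap (S G γ) := conjMapS g⁻¹ h2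
    (fun n => ⟨⟨g * n * g⁻¹, (conj_mem_normalizer G g _).2 n.2⟩, by
      change (n : G) = g⁻¹ * (g * n * g⁻¹) * g⁻¹⁻¹
      group⟩) e.toLinearMap fun n' n hn x => he n n' (by rw [hn]; group) x
  refine ⟨equivOfBijective Φ (Function.bijective_iff_has_inverse.2 ⟨Φ', fun f => ?_, fun f => ?_⟩)⟩
  · refine DFunLike.ext _ _ fun x => ?_
    change conjMap k g⁻¹ h2 (conjMap k g h1 (f (e.symm (e x)))) = f x
    rw [conjMap_conjMap (mul_inv_cancel g), LinearEquiv.symm_apply_apply]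
  · refine DFunLike.ext _ _ fun x => ?_
    change conjMap k g h1 (conjMap k g⁻¹ h2 (f (e (e.symm x)))) = f x
    rw [conjMap_conjMap (inv_mul_cancel g), LinearEquiv.apply_symm_apply]

theorem homAvg_weylRep [Fintype (AutT G T)] (l : Module.Dual k Γ) (b : AutT G T) (v : k[Orb G T]) :
    homAvg γ l (weylRep k (fixingSubgroup G T) b v) = homAvg γ (l ∘ₗ γ b) v := by
  refine DFunLike.ext _ _ fun x => ?_
  rw [homAvg_apply, homAvg_apply]
  refine Fintype.sum_equiv (Equiv.mulRight b) _ _ fun a => ?_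
  rw [Equiv.coe_mulRight, LinearMap.comp_apply, ← Module.End.mul_apply, ← Module.End.mul_apply,
    ← map_mul, ← map_mul, mul_inv_rev, mul_inv_cancel_left]

theorem coeff_homAvg_bp [Fintype (AutT G T)] (l : Module.Dual k Γ) (x : Γ) :
    (homAvg γ l (bp k _) x).coeff (QuotientGroup.mk 1) = l x := by
  classical
  rw [homAvg_apply, MonoidAlgebra.coeff_sum, Finsupp.finsetSum_apply, Finset.sum_eq_single 1]
  · simp [bp]
  · intro a _ ha
    rw [bp, weylRep_single, MonoidAlgebra.coeff_smul_apply, MonoidAlgebra.coeff_single,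
      Finsupp.single_apply, if_neg, smul_zero]
    intro h
    refine ha (weyl_smul_base_injective (h.trans (one_smul _ _).symm))
  · simp

theorem normalizer_smul_base (n : Subgroup.normalizer (fixingSubgroup G T : Set G)) :
    (n : G) • (QuotientGroup.mk 1 : Orb G T) = (n : AutT G T)⁻¹ • (QuotientGroup.mk 1 : Orb G T) := by
  change QuotientGroup.mk ((n : G) * 1) = ((n⁻¹ : Subgroup.normalizer _) : AutT G T) • _
  rw [weyl_smul_mk]
  simp

theorem coeffDual_S_base (n : Subgroup.normalizer (fixingSubgroup G T : Set G))
    (f : γ.IntertwiningMap (weylRep k (fixingSubgroup G T))) :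
    coeffDual γ (S G γ n f) (QuotientGroup.mk 1) =
      coeffDual γ f (QuotientGroup.mk 1) ∘ₗ γ (n : AutT G T)⁻¹ := by
  rw [← coeffDual_weyl]
  ext x
  rw [coeffDual_apply, coeffDual_apply, S_apply, Representation.coeff_ofMulAction]
  have := normalizer_smul_base n⁻¹
  rw [Subgroup.coe_inv, QuotientGroup.mk_inv, inv_inv] at this
  rw [this]

theorem S_homAvg_bp [Fintype (AutT G T)] (n : Subgroup.normalizer (fixingSubgroup G T : Set G))
    (l : Module.Dual k Γ) : S G γ n (homAvg γ l (bp k _)) =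
      homAvg γ (l ∘ₗ γ (n : AutT G T)⁻¹) (bp k _) := by
  rw [← homAvg_weylRep, ← homAvgMap_apply, ← homAvgMap_apply,
    ← Representation.IntertwiningMap.isIntertwining, bp, permRep_single, weylRep_single,
    normalizer_smul_base]

variable [CharZero k] (hG : IsGood G) (hT : T.Finite) (hTc : IsGClosed G T) (hT' : T'.Finite)
  (hTc' : IsGClosed G T')

include hG hT hTc

/-- The kernel would otherwise meet the essential `V G γ`. -/
theorem injective_of_injective_on_V (hγ : γ.IsIrreducible) {W : Type*} [AddCommGroup W] [Module k W]
    {ρ : Representation k G W} (θ : (S G γ).IntertwiningMap ρ)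
    (h : ∀ v ∈ V G γ, θ v = 0 → v = 0) : Function.Injective θ := by
  refine (injective_iff_eq_zero θ).2 ?_
  have : subComap θ ⊥ = ⊥ := by
    by_contra h'
    refine isEssential_V hG hT hTc hγ _ h' (subrep_eq_bot_iff.2 fun v hv => h v hv.1 ?_)
    exact hv.2
  intro v hv
  exact subrep_mem_bot.1 (this ▸ mem_subComap.2 (subrep_mem_bot.2 hv))

-- The element `homAvg γ l` of the base point is nonzero and fixed by `G_T`. Its image under `θ` has
-- a value supported on embeddings of `T'` into `T`, so such an embedding exists.
omit [CharZero k] in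
theorem exists_smul_subset (hγ : γ.IsIrreducible) (θ : (S G γ).IntertwiningMap (S G γ'))
    (hθ : Function.Injective θ) : ∃ g : G, ∀ t ∈ T', g • t ∈ T := by
  have := finite_autT hT hTc
  let _ := Fintype.ofFinite (AutT G T)
  obtain ⟨x, hx⟩ := exists_ne_zero_of_isIrreducible hγ
  obtain ⟨l, hl⟩ : ∃ l : Module.Dual k Γ, l x ≠ 0 := by
    by_contra! h
    exact hx ((Module.forall_dual_apply_eq_zero_iff k x).1 h)
  set F := homAvg γ l (bp k _)
  have hF : θ F ≠ 0 := by
    intro h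
    have h1 : F = 0 := hθ (h.trans (map_zero θ).symm)
    refine hl ?_
    rw [← coeff_homAvg_bp (γ := γ) l x]
    change (F x).coeff _ = 0
    rw [h1]
    rfl
  have hfix : ∀ g ∈ fixingSubgroup G T, S G γ g F = F := by
    intro g hg
    change S G γ g (homAvgMap γ l (bp k _)) = homAvgMap γ l (bp k _)
    rw [← Representation.IntertwiningMap.isIntertwining, permRep_bp_of_mem hg]
  obtain ⟨y, hy⟩ : ∃ y, θ F y ≠ 0 := by
    by_contra! h
    exact hF (DFunLike.ext _ _ h)
  have hne : (θ F y).coeff.support.Nonempty := by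
    rw [Finsupp.support_nonempty_iff]
    exact fun h => hy (MonoidAlgebra.coeff_injective h)
  obtain ⟨s, hs⟩ := hne
  have := img_subset_of_fixed hG hT hTc (x := θ F y) (fun g hg => by
    rw [← S_apply, ← Representation.IntertwiningMap.isIntertwining, hfix g hg]) hs
  induction s using QuotientGroup.induction_on with
  | H g =>
    rw [img_mk] at this
    exact ⟨g, fun t ht => this ⟨t, ht, rfl⟩⟩

include hT' hTc'

/-- Injectivity of the target extends the isomorphism of the `V`'s to `S G γ`, and essentiality
keeps it injective. -/
theorem exists_injective_of_VRep_equiv (hγ : γ.IsIrreducible) (hγ' : γ'.IsIrreducible)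
    (e : (VRep G γ).Equiv (VRep G γ')) :
    ∃ θ : (S G γ).IntertwiningMap (S G γ'), Function.Injective θ := by
  have := finite_autT hT hTc
  have := finite_autT hT' hTc'
  have := finiteDimensional_of_isIrreducible hγ
  have := finiteDimensional_of_isIrreducible hγ'
  obtain ⟨θ, hθ⟩ := exists_extension_S hG hT' hTc' γ' (M := (V G γ).toSubmodule)
    (isSmooth_S hG hT γ) (incl (V G γ)) (incl_injective (V G γ))
    ((incl (V G γ')).comp e.toIntertwiningMap)
  refine ⟨θ, injective_of_injective_on_V hG hT hTc hγ θ fun v hv h => ?_⟩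
  have h1 := (hθ ⟨v, hv⟩).symm.trans h
  have h2 : e ⟨v, hv⟩ = 0 := Subtype.ext h1
  have h3 : (⟨v, hv⟩ : (V G γ).toSubmodule) = 0 := by
    rw [← e.symm_apply_apply ⟨v, hv⟩, h2]
    exact e.symm.toLinearEquiv.map_zero
  exact congrArg Subtype.val h3

-- Vectors fixed by `G_T` give a copy of the dual of `Γ` inside `S G γ`. Transporting them by `g`
-- and `θ` and reading the base coefficient gives an equivariant map `D` between duals. It is
-- injective because a vector fixed by `G_{T'}` is supported on one `Aut(T')`-orbit. The transpose
-- of `D` is the required isomorphism.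
omit [CharZero k] hTc' in
theorem areConj_of_injective (hγ : γ.IsIrreducible) (hγ' : γ'.IsIrreducible) {g : G}
    (hg : T' = (fun x => g • x) '' T) (θ : (S G γ).IntertwiningMap (S G γ'))
    (hθ : Function.Injective θ) : AreConj G γ γ' := by
  have hTc' : IsGClosed G T' := hg ▸ hTc.image g
  have := finite_autT hT hTc
  have := finite_autT hT' hTc'
  have := finiteDimensional_of_isIrreducible hγ
  have := finiteDimensional_of_isIrreducible hγ'
  let _ := Fintype.ofFinite (AutT G T)
  let D : Module.Dual k Γ →ₗ[k] Module.Dual k Γ' :=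
    { toFun := fun l => coeffDual γ' (θ (S G γ g (homAvg γ l (bp k _)))) (QuotientGroup.mk 1)
      map_add' := fun l l' => by
        ext x
        simp [Representation.IntertwiningMap.coe_add]
      map_smul' := fun c l => by
        ext x
        simp [Representation.IntertwiningMap.coe_smul] }
  have hD : ∀ l, D l = coeffDual γ' (θ (S G γ g (homAvg γ l (bp k _)))) (QuotientGroup.mk 1) :=
    fun _ => rfl
  have hDn : ∀ (n : Subgroup.normalizer (fixingSubgroup G T : Set G))
      (n' : Subgroup.normalizer (fixingSubgroup G T' : Set G)), (n' : G) = g * n * g⁻¹ →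
      ∀ l, D (l ∘ₗ γ (n : AutT G T)⁻¹) = D l ∘ₗ γ' (n' : AutT G T')⁻¹ := by
    intro n n' hn l
    rw [hD, hD, ← S_homAvg_bp, ← coeffDual_S_base, ← Representation.IntertwiningMap.isIntertwining,
      ← Module.End.mul_apply, ← Module.End.mul_apply, ← map_mul, ← map_mul, hn]
    congr 4
    group
  have hDinj : ∀ l, D l = 0 → l = 0 := by
    intro l hl
    set F := homAvg γ l (bp k _) with hF
    have hfix : ∀ h ∈ fixingSubgroup G T', S G γ h (S G γ g F) = S G γ g F := by
      intro h hh
      rw [hg, mem_fix_image] at hh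
      change S G γ h (S G γ g (homAvgMap γ l (bp k _))) = S G γ g (homAvgMap γ l (bp k _))
      rw [← Representation.IntertwiningMap.isIntertwining,
        ← Representation.IntertwiningMap.isIntertwining]
      congr 1
      have h1 := permRep_bp_of_mem (R := k) hh
      rw [map_mul, map_mul, Module.End.mul_apply, Module.End.mul_apply,
        Representation.inv_apply_eq_iff] at h1
      exact h1
    have h0 : θ (S G γ g F) = 0 := by
      refine DFunLike.ext _ _ fun y => MonoidAlgebra.coeff_injective (Finsupp.ext fun s => ?_)
      by_contra hs
      have := img_subset_of_fixed hG hT' hTc' (x := θ (S G γ g F) y) (fun h hh => by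
        rw [← S_apply, ← Representation.IntertwiningMap.isIntertwining, hfix h hh])
        (Finsupp.mem_support_iff.2 hs)
      obtain ⟨a, rfl⟩ := exists_weyl_smul_base hT' hTc' this
      refine hs ?_
      rw [← coeffDual_apply, coeffDual_weyl, ← hD, hl]
      rfl
    have h1 : F = 0 := by
      have h2 : S G γ g F = 0 := hθ (h0.trans (map_zero θ).symm)
      rw [← (S G γ).inv_self_apply g F, h2, map_zero]
    ext x
    rw [← coeff_homAvg_bp (γ := γ) l x, ← hF, h1]
    rfl
  let t : Γ' →ₗ[k] Γ := (Module.evalEquiv k Γ).symm.toLinearMap ∘ₗ D.dualMap ∘ₗ Module.Dual.eval k Γ'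
  have ht : ∀ l y, l (t y) = D l y := by
    intro l y
    exact Module.apply_evalEquiv_symm_apply k Γ l _
  have htn : ∀ (n : Subgroup.normalizer (fixingSubgroup G T : Set G))
      (n' : Subgroup.normalizer (fixingSubgroup G T' : Set G)), (n' : G) = g * n * g⁻¹ →
      ∀ y, t (γ' (n' : AutT G T') y) = γ (n : AutT G T) (t y) := by
    intro n n' hn y
    refine (Module.evalEquiv k Γ).injective (LinearMap.ext fun l => ?_)
    change l (t _) = l (γ _ (t y))
    have h1 := LinearMap.congr_fun (hDn n⁻¹ n'⁻¹ (by
      rw [Subgroup.coe_inv, Subgroup.coe_inv, hn]; group) l) y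
    rw [QuotientGroup.mk_inv, QuotientGroup.mk_inv, inv_inv, inv_inv] at h1
    rw [ht]
    change D l (γ' _ y) = (l ∘ₗ γ _) (t y)
    rw [ht, h1]
    rfl
  have hsurj : Function.Surjective t := by
    rw [← LinearMap.range_eq_top, ← Submodule.dualAnnihilator_eq_bot_iff, eq_bot_iff]
    intro l hl
    refine (Submodule.mem_bot k).2 (hDinj l (LinearMap.ext fun y => ?_))
    rw [← ht]
    exact (Submodule.mem_dualAnnihilator l).1 hl _ ⟨y, rfl⟩
  -- The kernel of `t` is a subrepresentation of the irreducible `γ'`, and it is not everything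
  -- because `t` is onto a nonzero space.
  have hinj : Function.Injective t := by
    let K : Subrepresentation γ' :=
      { toSubmodule := LinearMap.ker t
        apply_mem_toSubmodule := by
          intro a' y hy
          induction a' using QuotientGroup.induction_on with
          | H n' =>
            have hn' : g⁻¹ * (n' : G) * g ∈ Subgroup.normalizer (fixingSubgroup G T : Set G) := by
              rw [← conj_mem_normalizer G g, ← hg]
              have : g * (g⁻¹ * n' * g) * g⁻¹ = (n' : G) := by group
              rw [this]
              exact n'.2
            have := htn ⟨_, hn'⟩ n' (by
              change (n' : G) = g * (g⁻¹ * n' * g) * g⁻¹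
              group) y
            rw [LinearMap.mem_ker] at hy ⊢
            rw [this, hy, map_zero] }
    have hK : K = ⊥ := by
      refine (eq_bot_or_eq_top_of_isIrreducible hγ' K).resolve_right fun h => ?_
      obtain ⟨x, hx⟩ := exists_ne_zero_of_isIrreducible hγ
      obtain ⟨y, rfl⟩ := hsurj x
      exact hx (h ▸ subrep_mem_top y : y ∈ K)
    exact LinearMap.ker_eq_bot.1 (congrArg Subrepresentation.toSubmodule hK)
  refine ⟨g, hg, (LinearEquiv.ofBijective t ⟨hinj, hsurj⟩).symm, fun n n' hn x => ?_⟩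
  rw [LinearEquiv.symm_apply_eq]
  change _ = t (γ' _ _)
  rw [htn n n' hn]
  congr 1
  exact ((LinearEquiv.ofBijective t ⟨hinj, hsurj⟩).apply_symm_apply x).symm

/-- Embeddings `S G γ → S G γ'` and back show that `T` and `T'` embed into each other. Being finite,
they have the same size and each embedding is onto. -/
theorem areConj_of_VRep_equiv (hγ : γ.IsIrreducible) (hγ' : γ'.IsIrreducible)
    (e : (VRep G γ).Equiv (VRep G γ')) : AreConj G γ γ' := by
  obtain ⟨θ, hθ⟩ := exists_injective_of_VRep_equiv hG hT hTc hT' hTc' hγ hγ' e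
  obtain ⟨θ', hθ'⟩ := exists_injective_of_VRep_equiv hG hT' hTc' hT hTc hγ' hγ e.symm
  obtain ⟨g, hg⟩ := exists_smul_subset hG hT hTc hγ θ hθ
  obtain ⟨g', hg'⟩ := exists_smul_subset hG hT' hTc' hγ' θ' hθ'
  have h1 : (g' • ·) '' T ⊆ T' := by
    rintro _ ⟨t, ht, rfl⟩
    exact hg' t ht
  have h2 : (g • ·) '' T' ⊆ T := by
    rintro _ ⟨t, ht, rfl⟩
    exact hg t ht
  have h3 : T'.ncard ≤ ((g' • ·) '' T).ncard := by
    rw [Set.ncard_image_of_injective T (MulAction.injective g'),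
      ← Set.ncard_image_of_injective T' (MulAction.injective g)]
    exact Set.ncard_le_ncard h2 hT
  exact areConj_of_injective hG hT hTc hT' hγ hγ'
    (Set.eq_of_subset_of_ncard_le h1 h3 hT').symm θ hθ

theorem nonempty_VRep_equiv_of_S_equiv (hγ : γ.IsIrreducible) (hγ' : γ'.IsIrreducible)
    (e : (S G γ).Equiv (S G γ')) : Nonempty ((VRep G γ).Equiv (VRep G γ')) := by
  have hle : V G γ ≤ subComap e.toIntertwiningMap (V G γ') := by
    refine V_le hG hT hTc hγ ?_
    obtain ⟨v, hv, hv0⟩ := subrep_ne_bot_iff.1 (V_ne_bot hG hT' hTc' hγ')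
    refine subrep_ne_bot_iff.2 ⟨e.symm v, ?_, fun h => hv0 ?_⟩
    · change e (e.symm v) ∈ V G γ'
      rwa [e.apply_symm_apply]
    · rw [← e.apply_symm_apply v, h]
      exact e.toLinearEquiv.map_zero
  obtain ⟨v, hv, hv0⟩ := subrep_ne_bot_iff.1 (V_ne_bot hG hT hTc hγ)
  refine nonempty_equiv_of_ne_zero (V := (V G γ).toSubmodule) (W := (V G γ').toSubmodule)
    (isIrreducible_VRep hG hT hTc hγ) (isIrreducible_VRep hG hT' hTc' hγ')
    (codRestrict (V := (V G γ).toSubmodule) (V G γ')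
      (e.toIntertwiningMap.comp (incl (V G γ))) fun v => hle v.2)
    (v := ⟨v, hv⟩) fun h => hv0 ?_
  have h1 : e v = 0 := congrArg Subtype.val h
  rw [← e.symm_apply_apply v, h1]
  exact e.symm.toLinearEquiv.map_zero

theorem nonempty_S_equiv_iff (hγ : γ.IsIrreducible) (hγ' : γ'.IsIrreducible) :
    Nonempty ((S G γ).Equiv (S G γ')) ↔ AreConj G γ γ' := by
  refine ⟨fun ⟨e⟩ => ?_, AreConj.nonempty_equiv_S⟩
  obtain ⟨e'⟩ := nonempty_VRep_equiv_of_S_equiv hG hT hTc hT' hTc' hγ hγ' e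
  exact areConj_of_VRep_equiv hG hT hTc hT' hTc' hγ hγ' e'

theorem nonempty_VRep_equiv_iff (hγ : γ.IsIrreducible) (hγ' : γ'.IsIrreducible) :
    Nonempty ((VRep G γ).Equiv (VRep G γ')) ↔ AreConj G γ γ' := by
  refine ⟨fun ⟨e⟩ => areConj_of_VRep_equiv hG hT hTc hT' hTc' hγ hγ' e, fun h => ?_⟩
  obtain ⟨e⟩ := h.nonempty_equiv_S
  exact nonempty_VRep_equiv_of_S_equiv hG hT hTc hT' hTc' hγ hγ' e

end Conjugation

/-! ### Indecomposable injective objects. -/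

section Indecomposable

/-- A nonzero vector generates a quotient of some `k[G/G_T]`, of finite length, so it contains a
simple submodule isomorphic to some `V_{T,δ}`. Injectivity of `ρ` extends its inclusion to `S G δ`,
and the extension is injective by essentiality. Injectivity of `S G δ` splits it, and
indecomposability leaves no complement. -/
theorem exists_equiv_S_of_isIndecomposable.{r, s} {Ψ : Type s} {G : Subgroup (Equiv.Perm Ψ)}
    {k : Type r}
    [Field k] [CharZero k] (hG : IsGood G) {I : Type (max r s)} [AddCommGroup I] [Module k I]
    {ρ : Representation k G I} (hinj : IsSmoothInjective ρ) (hind : IsIndecomposable ρ) :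
    ∃ T : Set Ψ, T.Finite ∧ IsGClosed G T ∧
      ∃ (n : ℕ) (δ : Representation k (AutT G T) (Fin n → k)), δ.IsIrreducible ∧
        Nonempty (ρ.Equiv (S G δ)) := by
  obtain ⟨hsm, hext⟩ := hinj
  obtain ⟨hnt, hdec⟩ := hind
  obtain ⟨v, hv⟩ := exists_ne (0 : I)
  obtain ⟨T₀, hT₀, hTc₀, hfix⟩ := (isSmooth_iff_isGClosed hG).1 hsm v
  let φ := liftFixed ρ v hfix
  let R : Subrepresentation ρ := subMap φ ⊤
  let φ' := codRestrict R φ fun x => ⟨x, subrep_mem_top x, rfl⟩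
  have hφ' : Function.Surjective φ' := by
    rintro ⟨_, x, -, rfl⟩
    exact ⟨x, rfl⟩
  have hR : IsFiniteLength k[G] R.toRepresentation.asModule :=
    (isFiniteLength_permRep k hG hT₀ hTc₀).of_surjective
      (f := Representation.IntertwiningMap.equivLinearMapAsModule _ _ φ') hφ'
  have hvR : v ∈ R := ⟨bp k _, subrep_mem_top _, liftFixed_bp ρ v hfix⟩
  obtain ⟨A, -, hA⟩ := exists_atom_le hR (B := ⊤)
    (subrep_ne_bot_iff.2 ⟨⟨v, hvR⟩, subrep_mem_top _, fun h => hv (congrArg Subtype.val h)⟩)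
  let j : A.toRepresentation.IntertwiningMap ρ := (incl R).comp (incl A)
  have hj : Function.Injective j := (incl_injective R).comp (incl_injective A)
  obtain ⟨T, hT, hTc, n, δ, hδ, ⟨e⟩⟩ := exists_equiv_VRep_of_isSmooth hG (hsm.of_injective j hj)
    ((isIrreducible_iff_isAtom A).2 hA)
  refine ⟨T, hT, hTc, n, δ, hδ, ?_⟩
  have := finite_autT hT hTc
  have hS := isSmooth_S hG hT δ
  let j' : (V G δ).toRepresentation.IntertwiningMap ρ := j.comp e.symm.toIntertwiningMap
  have hj' : Function.Injective j' := hj.comp e.symm.toLinearEquiv.injective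
  -- The universe of `I` is the one in which `V G δ` and `S G δ` live, so both are admissible test
  -- objects.
  obtain ⟨H, hH⟩ := hext (V G δ).toSubmodule _ _ (S G δ)
    (IsSmooth.of_injective (V := (V G δ).toSubmodule) hS (incl (V G δ)) (incl_injective (V G δ)))
    hS (incl (V G δ)) j' (incl_injective (V G δ))
  have hHv : ∀ x, H (incl (V G δ) x) = j' x := fun x => DFunLike.congr_fun hH x
  have hHinj : Function.Injective H :=
    injective_of_injective_on_V hG hT hTc hδ H fun x hx h => by
      have h1 : j' ⟨x, hx⟩ = 0 := (hHv ⟨x, hx⟩).symm.trans h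
      exact congrArg Subtype.val (hj' (h1.trans (map_zero j'.toLinearMap).symm))
  obtain ⟨r, hr⟩ := exists_extension_S hG hT hTc δ hsm H hHinj
    (Representation.IntertwiningMap.id (S G δ))
  have hr : ∀ m, r (H m) = m := hr
  have hcompl : IsCompl (subMap H ⊤) (subComap r ⊥) := by
    refine IsCompl.of_eq (subrep_eq_bot_iff.2 ?_) (top_le_iff.1 fun x _ => ?_)
    · rintro _ ⟨⟨m, -, rfl⟩, hm⟩
      have hm : r (H m) = 0 := hm
      rw [hr] at hm
      change H m = 0
      rw [hm, map_zero]
    · refine Submodule.mem_sup.2 ⟨H (r x), ⟨r x, subrep_mem_top _, rfl⟩, x - H (r x), ?_, by simp⟩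
      change r (x - H (r x)) = 0
      rw [map_sub, hr, sub_self]
  have hker : subComap r ⊥ = ⊥ := by
    refine (hdec _ _ hcompl).resolve_left ?_
    obtain ⟨x, -, hx⟩ := subrep_ne_bot_iff.1 (V_ne_bot hG hT hTc hδ)
    exact subrep_ne_bot_iff.2 ⟨H x, ⟨x, subrep_mem_top x, rfl⟩, fun h =>
      hx (hHinj (h.trans (map_zero H).symm))⟩
  refine ⟨equivOfBijective r ⟨(injective_iff_eq_zero r).2 fun x hx => ?_, fun m => ⟨H m, hr m⟩⟩⟩
  exact subrep_mem_bot.1 (hker ▸ mem_subComap.2 (subrep_mem_bot.2 hx))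

end Indecomposable


/-! ### The axioms for symmetric groups. -/

section Symmetric

variable {Ψ : Type*}

/-- An injective map of a finite set to itself, defined on a part of it, extends to a permutation. -/
theorem exists_perm_extending {X W : Set Ψ} (hW : W.Finite) (hXW : X ⊆ W) {f : Ψ → Ψ}
    (hf : ∀ x ∈ X, f x ∈ W) (hinj : Set.InjOn f X) :
    ∃ h : Equiv.Perm Ψ, (∀ x ∈ X, h x = f x) ∧ ∀ w ∈ W, h w ∈ W := by
  classical
  let _ := hW.fintype
  obtain ⟨e, he⟩ := Set.MapsTo.exists_equiv_extend_of_card_eq (α := W) (t := hW.toFinset)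
    (s := Subtype.val ⁻¹' X) (f := fun w => f w)
    (by rw [← Set.toFinset_card, Set.Finite.toFinset_eq_toFinset])
    (fun w hw => by simpa using hf w hw)
    (fun a ha b hb h => Subtype.ext (hinj ha hb h))
  let e' : Equiv.Perm {x // x ∈ W} := e.trans (Equiv.subtypeEquivRight fun x => hW.mem_toFinset)
  refine ⟨Equiv.Perm.ofSubtype e', fun x hx => ?_, fun w hw => ?_⟩
  · rw [Equiv.Perm.ofSubtype_apply_of_mem e' (hXW hx)]
    exact he ⟨x, hXW hx⟩ hx
  · exact (Equiv.Perm.ofSubtype_apply_mem_iff_mem e' w).2 hw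

variable [Infinite Ψ] {F : Set Ψ} {G : Subgroup (Equiv.Perm Ψ)}
  (hF : F.Finite) (hG : G = fixingSubgroup (Equiv.Perm Ψ) F)

include hF hG

theorem isGood_of_eq_fixingSubgroup : IsGood G := by
  classical
  have hGF : ∀ g : G, ∀ x ∈ F, g • x = x := fun g x hx =>
    (mem_fixingSubgroup_iff (Equiv.Perm Ψ)).1 (hG ▸ g.2 : (g : Equiv.Perm Ψ) ∈ _) x hx
  have hmk : ∀ h : Equiv.Perm Ψ, (∀ x ∈ F, h x = x) → ∃ g : G, ∀ x, g • x = h x := fun h hh =>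
    ⟨⟨h, hG ▸ (mem_fixingSubgroup_iff (Equiv.Perm Ψ)).2 hh⟩, fun x => rfl⟩
  have hFc : ∀ S : Set Ψ, IsGClosed G S → F ⊆ S := fun S hS x hx => by
    rw [← hS.cl_eq]
    exact fun g _ => hGF g x hx
  have hswap : ∀ t y z : Ψ, z ≠ t → z ≠ y → Equiv.swap t y z = z := fun t y z h h' =>
    Equiv.swap_apply_of_ne_of_ne h h'
  refine ⟨fun S hS => ?_, fun S W hS hW hWf hSW g hg => ?_, fun A B hA hAf hB hBf g h1 h2 => ?_,
    fun T' T W hT' hT hW hWf hTT hTW => ?_⟩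
  -- A point outside `S ∪ F` can be exchanged with another such point, so it is not fixed.
  · refine (hS.union hF).subset fun x hx => ?_
    by_contra hxS
    obtain ⟨y, hy⟩ := ((hS.union hF).union (Set.finite_singleton x)).infinite_compl.nonempty
    simp only [Set.mem_compl_iff, Set.mem_union, Set.mem_singleton_iff, not_or] at hy hxS
    obtain ⟨g, hg⟩ := hmk (Equiv.swap x y) fun z hz =>
      hswap x y z (fun h => hxS.2 (h ▸ hz)) fun h => hy.1.2 (h ▸ hz)
    have := hx g (mem_fix.2 fun z hz => by
      rw [hg]
      exact hswap x y z (fun h => hxS.1 (h ▸ hz)) fun h => hy.1.1 (h ▸ hz))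
    rw [hg, Equiv.swap_apply_left] at this
    exact hy.2 this
  · obtain ⟨h, h1, h2⟩ := exists_perm_extending hWf hSW (f := (g • ·)) hg
      (MulAction.injective g).injOn
    obtain ⟨g', hg'⟩ := hmk h fun x hx => by
      rw [h1 x (hFc S hS hx)]
      exact hGF g x hx
    exact ⟨g', fun s hs => (hg' s).trans (h1 s hs), fun w hw => by
      rw [hg']
      exact h2 w hw⟩
  -- The compatibility hypotheses say that the identity on `A` and `g` on `B` glue to an injective
  -- map on `A ∪ B`.
  · let f : Ψ → Ψ := fun x => if x ∈ A then x else g • x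
    have hfA : ∀ a ∈ A, f a = a := fun a ha => if_pos ha
    have hfB : ∀ b ∈ B, f b = g • b := fun b hb => by
      by_cases hbA : b ∈ A
      · rw [hfA b hbA, h2 b hb hbA]
      · exact if_neg hbA
    obtain ⟨h, hh, -⟩ := exists_perm_extending (X := A ∪ B) (W := A ∪ B ∪ (g • ·) '' B)
      ((hAf.union hBf).union (hBf.image _)) Set.subset_union_left (f := f) (by
        rintro x (hx | hx)
        · rw [hfA x hx]; exact Or.inl (Or.inl hx)
        · rw [hfB x hx]; exact Or.inr ⟨x, hx, rfl⟩) (by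
        have key : ∀ a ∈ A, ∀ b ∈ B, f a = f b → a = b := by
          intro a ha b hb hab
          rw [hfA a ha, hfB b hb] at hab
          rw [hab, h2 b hb (h1 b hb (hab ▸ ha))]
        rintro x (hx | hx) y (hy | hy) hxy
        · rwa [hfA x hx, hfA y hy] at hxy
        · exact key x hx y hy hxy
        · exact (key y hy x hx hxy.symm).symm
        · rw [hfB x hx, hfB y hy] at hxy
          exact MulAction.injective g hxy)
    obtain ⟨g', hg'⟩ := hmk h fun x hx => by
      rw [hh x (Or.inl (hFc A hA hx)), hfA x (hFc A hA hx)]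
    exact ⟨g', fun a ha => by rw [hg', hh a (Or.inl ha), hfA a ha],
      fun b hb => by rw [hg', hh b (Or.inr hb), hfB b hb]⟩
  -- `U` is generated by the exchange of a point `t` of `T` outside `T'` with a point `y` outside
  -- `W`. If `S ∩ T ⊆ T'`, then `t ∉ S` and `U` acts trivially on `S`.
  · obtain ⟨t, htT, htT'⟩ := Set.exists_of_ssubset hTT
    obtain ⟨y, hy⟩ := hWf.infinite_compl.nonempty
    have hWy : ∀ w ∈ W, w ≠ y := fun w hw h => hy (h ▸ hw)
    obtain ⟨u, hu⟩ := hmk (Equiv.swap t y) fun x hx =>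
      hswap t y x (fun h => htT' (h ▸ hFc T' hT' hx)) (hWy x (hFc W hW hx))
    have huu : u * u = 1 := by
      refine Subtype.ext (Equiv.ext fun x => ?_)
      change u • u • x = x
      rw [hu, hu, Equiv.swap_apply_self]
    let U : Subgroup G :=
      { carrier := {1, u}
        one_mem' := Or.inl rfl
        mul_mem' := by
          rintro a b (rfl | rfl) (rfl | rfl)
          · exact Or.inl (mul_one _)
          · exact Or.inr (one_mul _)
          · exact Or.inr (mul_one _)
          · exact Or.inl huu
        inv_mem' := by
          rintro a (rfl | rfl)
          · exact Or.inl inv_one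
          · exact Or.inr (inv_eq_of_mul_eq_one_left huu) }
    have hUf : (U : Set G).Finite := Set.toFinite {1, u}
    refine ⟨U, hUf.to_subtype, ?_, ?_, u, Or.inr rfl, ?_, ?_⟩
    · rintro _ (rfl | rfl) w hw h
      · exact one_smul G w
      · by_cases hwt : w = t
        · rw [hu, hwt, Equiv.swap_apply_left] at h
          exact absurd h hy
        · rw [hu]
          exact hswap t y w hwt (hWy w hw)
    · rintro S hSW hS hST v hv -
      refine ⟨1, Or.inl rfl, one_mem _, fun s hs => ?_⟩
      rcases hv with rfl | rfl
      · rfl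
      · rw [one_smul, hu]
        exact hswap t y s (fun h => htT' (hST ⟨h ▸ hs, htT⟩)) (hWy s (hSW hs))
    · refine mem_fix.2 fun x hx => ?_
      rw [hu]
      exact hswap t y x (fun h => htT' (h ▸ hx)) (hWy x (hTW (hTT.1 hx)))
    · intro h
      have := mem_fix.1 h t htT
      rw [hu, Equiv.swap_apply_left] at this
      exact hWy t (hTW htT) this.symm

end Symmetric

/-! ### The axioms for linear groups over a finite field. -/

section Linear

variable {𝔽 E M : Type*} [Field 𝔽] [AddCommGroup E] [Module 𝔽 E] [AddCommGroup M] [Module 𝔽 M]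

theorem exists_dual_comp_eq {φ : M →ₗ[𝔽] E} {l : Module.Dual 𝔽 M}
    (h : LinearMap.ker φ ≤ LinearMap.ker l) : ∃ l' : Module.Dual 𝔽 E, ∀ m, l' (φ m) = l m := by
  have : l ∈ LinearMap.range φ.dualMap := by
    rw [LinearMap.range_dualMap_eq_dualAnnihilator_ker, Submodule.mem_dualAnnihilator]
    exact fun m hm => h hm
  obtain ⟨l', rfl⟩ := this
  exact ⟨l', fun _ => rfl⟩

/-- Equal kernels identify the two ranges, and complements of the ranges have equal dimension. -/
theorem exists_linearEquiv_comp_eq [FiniteDimensional 𝔽 E] {p q : M →ₗ[𝔽] E}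
    (h : LinearMap.ker p = LinearMap.ker q) : ∃ e : E ≃ₗ[𝔽] E, ∀ m, e (p m) = q m := by
  obtain ⟨C, hC⟩ := Submodule.exists_isCompl (LinearMap.range p)
  obtain ⟨D, hD⟩ := Submodule.exists_isCompl (LinearMap.range q)
  let e₁ : LinearMap.range p ≃ₗ[𝔽] LinearMap.range q :=
    p.quotKerEquivRange.symm.trans ((Submodule.quotEquivOfEq _ _ h).trans q.quotKerEquivRange)
  have he₁ : ∀ m, (e₁ ⟨p m, m, rfl⟩ : E) = q m := by
    intro m
    have : p.quotKerEquivRange.symm ⟨p m, m, rfl⟩ = Submodule.Quotient.mk m := by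
      rw [LinearEquiv.symm_apply_eq]
      rfl
    simp only [e₁, LinearEquiv.trans_apply, this]
    rfl
  have hdim : Module.finrank 𝔽 C = Module.finrank 𝔽 D := by
    have h1 := Submodule.finrank_add_eq_of_isCompl hC
    have h2 := Submodule.finrank_add_eq_of_isCompl hD
    have h3 := e₁.finrank_eq
    omega
  let e₂ : C ≃ₗ[𝔽] D := LinearEquiv.ofFinrankEq C D hdim
  refine ⟨(Submodule.prodEquivOfIsCompl _ _ hC).symm.trans
    ((e₁.prodCongr e₂).trans (Submodule.prodEquivOfIsCompl _ _ hD)), fun m => ?_⟩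
  have : (Submodule.prodEquivOfIsCompl _ _ hC).symm (p m) = (⟨p m, m, rfl⟩, 0) :=
    Submodule.prodEquivOfIsCompl_symm_apply_left _ _ hC ⟨p m, m, rfl⟩
  simp [this, he₁]

/-- Two linear maps with the same kernel and with values in a finite-dimensional subspace `W` are
conjugate under an automorphism preserving `W`. -/
theorem exists_linearEquiv_comp_eq_of_le {W : Submodule 𝔽 E} [FiniteDimensional 𝔽 W]
    {p q : M →ₗ[𝔽] E} (hp : ∀ m, p m ∈ W) (hq : ∀ m, q m ∈ W)
    (h : LinearMap.ker p = LinearMap.ker q) :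
    ∃ e : E ≃ₗ[𝔽] E, (∀ m, e (p m) = q m) ∧ ∀ w ∈ W, e w ∈ W := by
  obtain ⟨e, he⟩ := exists_linearEquiv_comp_eq (p := p.codRestrict W hp) (q := q.codRestrict W hq)
    (by rw [LinearMap.ker_codRestrict, LinearMap.ker_codRestrict, h])
  obtain ⟨C, hC⟩ := Submodule.exists_isCompl W
  let e' : E ≃ₗ[𝔽] E := (Submodule.prodEquivOfIsCompl _ _ hC).symm.trans
    ((e.prodCongr (LinearEquiv.refl 𝔽 C)).trans (Submodule.prodEquivOfIsCompl _ _ hC))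
  have he' : ∀ w : W, e' w = e w := by
    intro w
    have : (Submodule.prodEquivOfIsCompl _ _ hC).symm (w : E) = (w, 0) :=
      Submodule.prodEquivOfIsCompl_symm_apply_left _ _ hC w
    simp [e', this]
  refine ⟨e', fun m => ?_, fun w hw => ?_⟩
  · refine (he' ⟨p m, hp m⟩).trans ?_
    exact congrArg Subtype.val (he m)
  · rw [he' ⟨w, hw⟩]
    exact (e ⟨w, hw⟩).2

variable {Ψ : Type*} [AddCommGroup Ψ] [Module 𝔽 Ψ] {F : Set Ψ}
  {G : Subgroup (Equiv.Perm Ψ)} (hF : F.Finite)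
  (hG : G = (MulAction.toPermHom (Ψ ≃ₗ[𝔽] Ψ) Ψ).range ⊓ fixingSubgroup (Equiv.Perm Ψ) F)

theorem finite_span [Finite 𝔽] {S : Set Ψ} (hS : S.Finite) :
    ((Submodule.span 𝔽 S : Submodule 𝔽 Ψ) : Set Ψ).Finite := by
  have : FiniteDimensional 𝔽 (Submodule.span 𝔽 S) := FiniteDimensional.span_of_finite 𝔽 hS
  have : Finite (Submodule.span 𝔽 S) := Module.finite_of_finite 𝔽
  exact Set.toFinite _

include hG

theorem exists_linearEquiv_of_mem (g : G) : ∃ L : Ψ ≃ₗ[𝔽] Ψ, ∀ x, g • x = L x := by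
  obtain ⟨⟨L, hL⟩, -⟩ : (g : Equiv.Perm Ψ) ∈
      (MulAction.toPermHom (Ψ ≃ₗ[𝔽] Ψ) Ψ).range ⊓ fixingSubgroup (Equiv.Perm Ψ) F := hG ▸ g.2
  exact ⟨L, fun x => (DFunLike.congr_fun hL x).symm⟩

theorem smul_eq_of_mem (g : G) {x : Ψ} (hx : x ∈ F) : g • x = x := by
  obtain ⟨-, h⟩ : (g : Equiv.Perm Ψ) ∈
      (MulAction.toPermHom (Ψ ≃ₗ[𝔽] Ψ) Ψ).range ⊓ fixingSubgroup (Equiv.Perm Ψ) F := hG ▸ g.2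
  exact (mem_fixingSubgroup_iff (Equiv.Perm Ψ)).1 h x hx

theorem exists_smul_eq (L : Ψ ≃ₗ[𝔽] Ψ) (hL : ∀ x ∈ F, L x = x) : ∃ g : G, ∀ x, g • x = L x :=
  ⟨⟨MulAction.toPermHom (Ψ ≃ₗ[𝔽] Ψ) Ψ L, hG ▸
    ⟨⟨L, rfl⟩, (mem_fixingSubgroup_iff (Equiv.Perm Ψ)).2 hL⟩⟩, fun _ => rfl⟩

theorem exists_submodule_of_isGClosed {T : Set Ψ} (hT : IsGClosed G T) :
    ∃ V : Submodule 𝔽 Ψ, (V : Set Ψ) = T ∧ F ⊆ V := by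
  refine ⟨{ carrier := T, add_mem' := ?_, zero_mem' := ?_, smul_mem' := ?_ }, rfl, ?_⟩
  · intro x y hx hy
    rw [← hT.cl_eq] at hx hy ⊢
    intro g hg
    obtain ⟨L, hL⟩ := exists_linearEquiv_of_mem hG g
    have h1 := hx g hg
    have h2 := hy g hg
    rw [hL] at h1 h2 ⊢
    rw [map_add, h1, h2]
  · rw [← hT.cl_eq]
    intro g hg
    obtain ⟨L, hL⟩ := exists_linearEquiv_of_mem hG g
    rw [hL, map_zero]
  · intro c x hx
    rw [← hT.cl_eq] at hx ⊢
    intro g hg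
    obtain ⟨L, hL⟩ := exists_linearEquiv_of_mem hG g
    have h1 := hx g hg
    rw [hL] at h1 ⊢
    rw [map_smul, h1]
  · intro x hx
    change x ∈ T
    rw [← hT.cl_eq]
    exact fun g _ => smul_eq_of_mem hG g hx

variable [Finite 𝔽] [Infinite Ψ]

include hF

/-- The closure lies in the span of `F ∪ S`. A point `x` outside this span is moved by a
transvection along a functional `l` that kills the span but not `x`. Its direction `l x • y - l y •
x` lies in the kernel of `l` and is nonzero because `y` is independent of `x`. -/
theorem finite_cl_of_linear {S : Set Ψ} (hS : S.Finite) : (cl G S).Finite := by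
  refine (finite_span (𝔽 := 𝔽) (hF.union hS)).subset fun x hx => ?_
  by_contra hxS
  obtain ⟨y, hy⟩ := (finite_span (𝔽 := 𝔽) ((hF.union hS).union
    (Set.finite_singleton x))).infinite_compl.nonempty
  obtain ⟨l, hlx, hl⟩ := Submodule.exists_le_ker_of_notMem hxS
  have hx' : x ∈ Submodule.span 𝔽 (F ∪ S ∪ {x}) := Submodule.subset_span (Or.inr rfl)
  have hlv : l (l x • y - l y • x) = 0 := by
    rw [map_sub, map_smul, map_smul, smul_eq_mul, smul_eq_mul, mul_comm, sub_self]
  obtain ⟨g, hg⟩ := exists_smul_eq hG (LinearEquiv.transvection hlv) fun z hz => by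
    have : l z = 0 := hl (Submodule.subset_span (Or.inl hz))
    change z + l z • _ = z
    rw [this, zero_smul, add_zero]
  have h1 := hx g (mem_fix.2 fun z hz => by
    have : l z = 0 := hl (Submodule.subset_span (Or.inr hz))
    rw [hg]
    change z + l z • _ = z
    rw [this, zero_smul, add_zero])
  rw [hg] at h1
  change x + l x • _ = x at h1
  rw [add_eq_left, smul_eq_zero, or_iff_right hlx, sub_eq_zero] at h1
  refine hy ?_
  have h2 : l x • y ∈ Submodule.span 𝔽 (F ∪ S ∪ {x}) := h1 ▸ Submodule.smul_mem _ _ hx'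
  exact (Submodule.smul_mem_iff _ hlx).1 h2

theorem isGood_of_linear : IsGood G := by
  refine ⟨fun S hS => finite_cl_of_linear hF hG hS, fun S W hS hW hWf hSW g hg => ?_,
    fun A B hA hAf hB hBf g h1 h2 => ?_, fun T' T W hT' hT hW hWf hTT hTW => ?_⟩
  · obtain ⟨S, rfl, hFS⟩ := exists_submodule_of_isGClosed hG hS
    obtain ⟨W, rfl, hFW⟩ := exists_submodule_of_isGClosed hG hW
    obtain ⟨L, hL⟩ := exists_linearEquiv_of_mem hG g
    have : Finite W := hWf
    obtain ⟨e, he, heW⟩ := exists_linearEquiv_comp_eq_of_le (W := W) (p := S.subtype)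
      (q := L.toLinearMap ∘ₗ S.subtype) (fun m => hSW m.2)
      (fun m => by
        have := hg m m.2
        rwa [hL] at this)
      (by rw [LinearMap.ker_comp_of_ker_eq_bot _ L.ker])
    obtain ⟨h, hh⟩ := exists_smul_eq hG e fun x hx => by
      refine (he ⟨x, hFS hx⟩).trans ?_
      exact (hL x).symm.trans (smul_eq_of_mem hG g hx)
    refine ⟨h, fun s hs => ?_, fun w hw => ?_⟩
    · rw [hh, hL]
      exact he ⟨s, hs⟩
    · rw [hh]
      exact heW w hw
  · obtain ⟨A, rfl, hFA⟩ := exists_submodule_of_isGClosed hG hA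
    obtain ⟨B, rfl, hFB⟩ := exists_submodule_of_isGClosed hG hB
    obtain ⟨L, hL⟩ := exists_linearEquiv_of_mem hG g
    have : Finite A := hAf
    have : Finite B := hBf
    simp only [hL, SetLike.mem_coe] at h1 h2
    -- The maps `a + b` and `a + L b` have the same kernel exactly because of the compatibility
    -- hypotheses, so an automorphism carries one to the other.
    let p : (A × B) →ₗ[𝔽] Ψ := A.subtype.coprod B.subtype
    let q : (A × B) →ₗ[𝔽] Ψ := A.subtype.coprod (L.toLinearMap ∘ₗ B.subtype)
    have hp : ∀ m, p m = m.1 + m.2 := fun m => rfl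
    have hq : ∀ m, q m = m.1 + L m.2 := fun m => rfl
    have : FiniteDimensional 𝔽 (LinearMap.range p ⊔ LinearMap.range q : Submodule 𝔽 Ψ) :=
      inferInstance
    obtain ⟨e, he, -⟩ := exists_linearEquiv_comp_eq_of_le
      (W := LinearMap.range p ⊔ LinearMap.range q) (p := p) (q := q)
      (fun m => Submodule.mem_sup_left ⟨m, rfl⟩) (fun m => Submodule.mem_sup_right ⟨m, rfl⟩) (by
        ext ⟨a, b⟩
        rw [LinearMap.mem_ker, LinearMap.mem_ker, hp, hq]
        simp only
        constructor
        · intro h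
          have hb : (b : Ψ) ∈ A := by
            rw [← neg_eq_of_add_eq_zero_right h]
            exact A.neg_mem a.2
          rw [h2 b b.2 hb, h]
        · intro h
          have hb : L b ∈ A := by
            rw [← neg_eq_of_add_eq_zero_right h]
            exact A.neg_mem a.2
          rw [h2 b b.2 (h1 b b.2 hb)] at h
          exact h)
    have heA : ∀ a ∈ A, e a = a := fun a ha => by
      simpa [hp, hq] using he (⟨a, ha⟩, 0)
    have heB : ∀ b ∈ B, e b = L b := fun b hb => by
      simpa [hp, hq] using he (0, ⟨b, hb⟩)
    obtain ⟨h, hh⟩ := exists_smul_eq hG e fun x hx => heA x (hFA hx)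
    exact ⟨h, fun a ha => (hh a).trans (heA a ha), fun b hb => by rw [hh, hL, heB b hb]⟩
  · obtain ⟨T', rfl, hFT'⟩ := exists_submodule_of_isGClosed hG hT'
    obtain ⟨T, rfl, hFT⟩ := exists_submodule_of_isGClosed hG hT
    obtain ⟨W, rfl, hFW⟩ := exists_submodule_of_isGClosed hG hW
    have : Finite W := hWf
    obtain ⟨C, hC⟩ := Submodule.exists_isCompl W
    obtain ⟨y₀, hy₀⟩ := hWf.infinite_compl.nonempty
    have hCne : C ≠ ⊥ := by
      rintro rfl
      have := hC.sup_eq_top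
      rw [sup_bot_eq] at this
      exact hy₀ (this ▸ Submodule.mem_top)
    obtain ⟨y, hyC, hy⟩ := (Submodule.ne_bot_iff C).1 hCne
    let π : Ψ →ₗ[𝔽] W := Submodule.projectionOnto W C hC
    have hπW : ∀ w (hw : w ∈ W), π w = ⟨w, hw⟩ := fun w hw =>
      Submodule.projectionOnto_apply_left hC ⟨w, hw⟩
    have hπy : π y = 0 := (Submodule.projectionOnto_apply_eq_zero_iff hC).2 hyC
    -- These are the transvections in a direction `y` of a complement of `W`, along functionals
    -- pulled back from `W` by the projection. Composing them adds the functionals, so `U` embeds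
    -- into the finite dual of `W`, and a point of `W` that is moved leaves `W`.
    let U : Subgroup G :=
      { carrier := {g | ∃ l : Module.Dual 𝔽 W, ∀ x, g • x = x + l (π x) • y}
        one_mem' := ⟨0, fun x => by simp⟩
        mul_mem' := by
          rintro a b ⟨l, hl⟩ ⟨l', hl'⟩
          refine ⟨l + l', fun x => ?_⟩
          rw [mul_smul, hl', hl, map_add, map_smul, hπy, smul_zero, add_zero, LinearMap.add_apply,
            add_smul]
          abel
        inv_mem' := by
          rintro a ⟨l, hl⟩
          refine ⟨-l, fun x => ?_⟩
          rw [inv_smul_eq_iff, hl, map_add, map_smul, hπy, smul_zero, add_zero,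
            LinearMap.neg_apply, neg_smul, neg_add_cancel_right] }
    have hmkU : ∀ l : Module.Dual 𝔽 W, (∀ x (hx : x ∈ F), l ⟨x, hFW hx⟩ = 0) →
        ∃ u ∈ U, ∀ x, u • x = x + l (π x) • y := by
      intro l hl
      have hly : (l ∘ₗ π) y = 0 := by rw [LinearMap.comp_apply, hπy, map_zero]
      obtain ⟨g, hg⟩ := exists_smul_eq hG (LinearEquiv.transvection hly) fun x hx => by
        change x + l (π x) • y = x
        rw [hπW x (hFW hx), hl x hx, zero_smul, add_zero]
      exact ⟨g, ⟨l, hg⟩, hg⟩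
    have hfixl : ∀ (u : G) (l : Module.Dual 𝔽 W), (∀ x, u • x = x + l (π x) • y) → ∀ x,
        u • x = x ↔ l (π x) = 0 := by
      intro u l hl x
      rw [hl, add_eq_left, smul_eq_zero, or_iff_left hy]
    refine ⟨U, ?_, ?_, ?_, ?_⟩
    · have : Finite (Module.Dual 𝔽 W) := DFunLike.finite _
      choose l hl using fun u : U => u.2
      refine Finite.of_injective l fun u v huv => Subtype.ext (Subtype.ext (Equiv.ext fun x => ?_))
      change u.1 • x = v.1 • x
      rw [hl, hl, huv]
    · rintro u ⟨l, hl⟩ w hw huw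
      rw [hl, SetLike.mem_coe, W.add_mem_iff_right hw] at huw
      have : l (π w) • y ∈ W ⊓ C := ⟨huw, C.smul_mem _ hyC⟩
      rw [hC.inf_eq_bot, Submodule.mem_bot] at this
      rw [hl, this, add_zero]
    · rintro S hSW hS hST u ⟨l, hl⟩ huT'
      obtain ⟨S, rfl, hFS⟩ := exists_submodule_of_isGClosed hG hS
      let T₁ : Submodule 𝔽 W := T.submoduleOf W
      let S₁ : Submodule 𝔽 W := S.submoduleOf W
      -- Since `l` vanishes on `T'`, which contains `S ∩ T`, its restriction to `S` factors through
      -- the image of `S` in `W/T`. Extending it to `W/T` gives a functional that vanishes on `T`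
      -- and agrees with `l` on `S`.
      obtain ⟨l', hl'⟩ := exists_dual_comp_eq (φ := T₁.mkQ ∘ₗ S₁.subtype) (l := l ∘ₗ S₁.subtype) (by
        rintro ⟨⟨s, hsW⟩, hsS⟩ hs
        have hsT : (⟨s, hsW⟩ : W) ∈ T₁ := (Submodule.Quotient.mk_eq_zero _).1 hs
        have h1 := (hfixl u l hl s).1 (mem_fix.1 huT' s (hST ⟨hsS, hsT⟩))
        rw [hπW s hsW] at h1
        exact h1)
      have hl'T : ∀ t (ht : t ∈ T), (l' ∘ₗ T₁.mkQ) ⟨t, hTW ht⟩ = 0 := by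
        intro t ht
        have : T₁.mkQ ⟨t, hTW ht⟩ = 0 := (Submodule.Quotient.mk_eq_zero T₁).2 ht
        rw [LinearMap.comp_apply, this, map_zero]
      obtain ⟨u', hu'U, hu'⟩ := hmkU (l' ∘ₗ T₁.mkQ) fun x hx => hl'T x (hFT hx)
      refine ⟨u', hu'U, mem_fix.2 fun t ht => ?_, fun s hs => ?_⟩
      · rw [hfixl u' _ hu', hπW t (hTW ht)]
        exact hl'T t ht
      · rw [hl, hu', hπW s (hSW hs)]
        have := hl' ⟨⟨s, hSW hs⟩, hs⟩
        exact congrArg (fun c => s + c • y) this.symm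
    · obtain ⟨t, htT, htT'⟩ := Set.exists_of_ssubset hTT
      have htT₁ : (⟨t, hTW htT⟩ : W) ∉ T'.submoduleOf W := htT'
      obtain ⟨l, hlt, hl⟩ := Submodule.exists_le_ker_of_notMem htT₁
      have hlT' : ∀ x (hx : x ∈ T'), l ⟨x, hTW (hTT.1 hx)⟩ = 0 := fun x hx =>
        hl (show (⟨x, hTW (hTT.1 hx)⟩ : W) ∈ T'.submoduleOf W from hx)
      obtain ⟨u, huU, hu⟩ := hmkU l fun x hx => hlT' x (hFT' hx)
      refine ⟨u, huU, mem_fix.2 fun x hx => ?_, fun h => hlt ?_⟩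
      · rw [hfixl u l hu, hπW x (hTW (hTT.1 hx))]
        exact hlT' x hx
      · have := (hfixl u l hu t).1 (mem_fix.1 h t htT)
        rwa [hπW t (hTW htT)] at this

end Linear

theorem IsAutFixing.isGood.{r, s} {Ψ : Type r} [Infinite Ψ] {G : Subgroup (Equiv.Perm Ψ)}
    (hG : IsAutFixing.{r, s} G) : IsGood G := by
  cases hG with
  | set F hF hG => exact isGood_of_eq_fixingSubgroup hF hG
  | vect 𝔽 F hF hG => exact isGood_of_linear hF hG

end PermRep

end

theorem mainTheorem1 {Ψ : Type v} [Countable Ψ] [Infinite Ψ]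
    (G : Subgroup (Equiv.Perm Ψ)) (hG : PermRep.IsAutFixing.{v, x} G)
    (k : Type u) [Field k] [CharZero k] :
    -- the modules `V_{T,α}` are simple
    (∀ T : Set Ψ, T.Finite → PermRep.IsGClosed G T →
      ∀ (Γ : Type u) [AddCommGroup Γ] [Module k Γ] (γ : Representation k (PermRep.AutT G T) Γ),
        γ.IsIrreducible → Representation.IsIrreducible (V := (PermRep.V G γ).toSubmodule) (PermRep.VRep G γ)) ∧
    -- the modules `V_T ⊗ k` are semisimple
    (∀ T : Set Ψ, T.Finite → PermRep.IsGClosed G T →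
      (PermRep.VTk G k T).toRepresentation.IsSemisimpleRepresentation) ∧
    -- `V_{T,α}` and `V_{T',α'}` are isomorphic if and only if `(T, α)`, `(T', α')` are conjugate
    (∀ T T' : Set Ψ, T.Finite → PermRep.IsGClosed G T → T'.Finite → PermRep.IsGClosed G T' →
      ∀ (Γ Γ' : Type u) [AddCommGroup Γ] [Module k Γ] [AddCommGroup Γ'] [Module k Γ']
        (γ : Representation k (PermRep.AutT G T) Γ)
        (γ' : Representation k (PermRep.AutT G T') Γ'), γ.IsIrreducible → γ'.IsIrreducible →
        (Nonempty ((PermRep.VRep G γ).Equiv (PermRep.VRep G γ')) ↔ PermRep.AreConj G γ γ')) ∧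
    -- every simple smooth module is isomorphic to some `V_{T,α}`
    (∀ (W : Type w) [AddCommGroup W] [Module k W] (ρ : Representation k G W),
      PermRep.IsSmooth ρ → ρ.IsIrreducible →
      ∃ T : Set Ψ, T.Finite ∧ PermRep.IsGClosed G T ∧
        ∃ (Γ : Type u) (_ : AddCommGroup Γ) (_ : Module k Γ)
          (γ : Representation k (PermRep.AutT G T) Γ),
          γ.IsIrreducible ∧ Nonempty (ρ.Equiv (PermRep.VRep G γ))) ∧
    -- any module of finite length has a socle, which is `V_T ⊗ k` for `k[G/G_T]`
    (∀ (M : Type w) [AddCommGroup M] [Module k M] (ρ : Representation k G M),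
      IsFiniteLength k[G] ρ.asModule → ∃ A : Subrepresentation ρ, PermRep.IsSocle A) ∧
    (∀ T : Set Ψ, T.Finite → PermRep.IsGClosed G T →
      IsFiniteLength k[G] (PermRep.permRep k (fixingSubgroup G T)).asModule ∧
      PermRep.IsSocle (PermRep.VTk G k T)) ∧
    -- `S_{T,α}` is an injective hull of `V_{T,α}`, and it is indecomposable
    (∀ T : Set Ψ, T.Finite → PermRep.IsGClosed G T →
      ∀ (Γ : Type u) [AddCommGroup Γ] [Module k Γ] (γ : Representation k (PermRep.AutT G T) Γ),
        γ.IsIrreducible →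
        PermRep.IsSmoothInjectiveHull (PermRep.V G γ) ∧
        PermRep.IsIndecomposable (PermRep.S G γ)) ∧
    -- `S_{T,α}` and `S_{T',α'}` are isomorphic if and only if `(T, α)`, `(T', α')` are conjugate
    (∀ T T' : Set Ψ, T.Finite → PermRep.IsGClosed G T → T'.Finite → PermRep.IsGClosed G T' →
      ∀ (Γ Γ' : Type u) [AddCommGroup Γ] [Module k Γ] [AddCommGroup Γ'] [Module k Γ']
        (γ : Representation k (PermRep.AutT G T) Γ)
        (γ' : Representation k (PermRep.AutT G T') Γ'), γ.IsIrreducible → γ'.IsIrreducible →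
        (Nonempty ((PermRep.S G γ).Equiv (PermRep.S G γ')) ↔ PermRep.AreConj G γ γ')) ∧
    -- every indecomposable injective smooth module is isomorphic to some `S_{T,α}`
    (∀ (I : Type (max u v)) [AddCommGroup I] [Module k I] (ρ : Representation k G I),
      PermRep.IsSmoothInjective ρ → PermRep.IsIndecomposable ρ →
      ∃ T : Set Ψ, T.Finite ∧ PermRep.IsGClosed G T ∧
        ∃ (Γ : Type u) (_ : AddCommGroup Γ) (_ : Module k Γ)
          (γ : Representation k (PermRep.AutT G T) Γ),
          γ.IsIrreducible ∧ Nonempty (ρ.Equiv (PermRep.S G γ))) ∧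
    -- the simple subquotients of `k[G/G_T]` are exactly the `V_{T',α}` with `T' ⊆ T`
    (∀ T : Set Ψ, T.Finite → PermRep.IsGClosed G T →
      (∀ A B : Subrepresentation (PermRep.permRep k (fixingSubgroup G T)), A ≤ B →
        (PermRep.subquotient A B).IsIrreducible →
        ∃ T' : Set Ψ, T' ⊆ T ∧ PermRep.IsGClosed G T' ∧
          ∃ (Γ : Type u) (_ : AddCommGroup Γ) (_ : Module k Γ)
            (γ : Representation k (PermRep.AutT G T') Γ),
            γ.IsIrreducible ∧
            Nonempty ((PermRep.subquotient A B).Equiv (PermRep.VRep G γ))) ∧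
      (∀ T' : Set Ψ, T' ⊆ T → PermRep.IsGClosed G T' →
        ∀ (Γ : Type u) [AddCommGroup Γ] [Module k Γ] (γ : Representation k (PermRep.AutT G T') Γ),
          γ.IsIrreducible →
          ∃ A B : Subrepresentation (PermRep.permRep k (fixingSubgroup G T)), A ≤ B ∧
            Nonempty ((PermRep.subquotient A B).Equiv (PermRep.VRep G γ)))) := by
  have hg := hG.isGood
  refine ⟨fun T hT hTc Γ _ _ γ hγ => PermRep.isIrreducible_VRep hg hT hTc hγ,
    fun T hT hTc => PermRep.isSemisimple_VTk hg hT hTc,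
    fun T T' hT hTc hT' hTc' Γ Γ' _ _ _ _ γ γ' hγ hγ' =>
      PermRep.nonempty_VRep_equiv_iff hg hT hTc hT' hTc' hγ hγ',
    fun W _ _ ρ hρ hirr => ?_,
    fun M _ _ ρ hρ => PermRep.exists_isSocle hρ,
    fun T hT hTc => ⟨PermRep.isFiniteLength_permRep k hg hT hTc, PermRep.isSocle_VTk hg hT hTc⟩,
    fun T hT hTc Γ _ _ γ hγ => ⟨PermRep.isSmoothInjectiveHull_V hg hT hTc hγ,
      PermRep.isIndecomposable_S hg hT hTc hγ⟩,
    fun T T' hT hTc hT' hTc' Γ Γ' _ _ _ _ γ γ' hγ hγ' =>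
      PermRep.nonempty_S_equiv_iff hg hT hTc hT' hTc' hγ hγ',
    fun I _ _ ρ hinj hind => ?_,
    fun T hT hTc => ⟨fun A B _ hAB => ?_,
      fun T' hT' hTc' Γ _ _ γ hγ => PermRep.exists_subquotient_equiv hg hT hT' hTc' hγ⟩⟩
  · obtain ⟨T, hT, hTc, n, δ, hδ, e⟩ := PermRep.exists_equiv_VRep_of_isSmooth hg hρ hirr
    exact ⟨T, hT, hTc, Fin n → k, _, _, δ, hδ, e⟩
  · obtain ⟨T, hT, hTc, n, δ, hδ, e⟩ := PermRep.exists_equiv_S_of_isIndecomposable hg hinj hind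
    exact ⟨T, hT, hTc, Fin n → k, _, _, δ, hδ, e⟩
  · obtain ⟨T', hT', hTc', n, δ, hδ, e⟩ :=
      PermRep.exists_equiv_VRep_of_subquotient hg hT hTc A B hAB
    exact ⟨T', hT', hTc', Fin n → k, _, _, δ, hδ, e⟩
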